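/- Let $l\ge 1$ and $q=e^{i\pi\tau}$, $\operatorname{Im}\tau>0$. Let $$\vartheta_1(v|\tau)=2Gq^{1/4}\sin v\prod_{n\ge1}(1-q^{2n}e^{2iv})(1-q^{2n}e^{-2iv}),\qquad G=\prod_{n\ge1}(1-q^{2n}),$$ and let $L_\tau=\pi\mathbb Z+\pi\tau\mathbb Z$. For $z=(z^1,\dots,z^l)\in\mathbb C^l$ put $z^0=-\sum_{i=1}^l z^i$. Call $(z,\tau)$ regular if $z^i\notin L_\tau$ and $z^i-z^j\notin L_\tau$ for all $0\le i\ne j\le l$. For $u\in\mathbb C$ let $$\lambda(v)=e^{2\pi i u}\prod_{i=0}^l\frac{\vartheta_1(v-z^i|\tau)}{\vartheta_1(v|\tau)} .$$ For $a,b,c$ among the coordinates $u,z^1,\dots,z^l,\tau$, the dual structure functions are $$\overset{\star}{c}_{abc}=\sum_{d\lambda=0}\operatorname{res}\frac{\partial_a(\log\lambda\,dv)\,\partial_b(\log\lambda\,dv)\,\partial_c(\log\lambda\,dv)}{d\log\lambda},$$ with $\partial_a$ taken at constant $v$ and the sum over the points of $\mathbb C/L_\tau$ where $d\lambda=0$;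 the overall sign is the one for which the analogous formula with two arguments gives the intersection form $2\pi^2\,du\,d\tau-\sum_{i=0}^l(dz^i)^2$. For an open set $U$ of regular points, $\overset{\star}{F}_{quantum}$ denotes any function of $(z,\tau)\in U$ such that $$\overset{\star}{F}=2\pi i\Big[\tfrac12\pi^2\tau u^2-\tfrac12u\sum_{i=0}^l(z^i)^2\Big]+\overset{\star}{F}_{quantum}(z|\tau)$$ is holomorphic on $\mathbb C\times U$ and $\partial_a\partial_b\partial_c\overset{\star}{F}=\overset{\star}{c}_{abc}$ there for all $a,b,c$. Let $\Lambda_3$ be the multivalued analytic function of $(z,\tau)\in\mathbb C\times\mathbb H$ obtained by analytic continuation along paths from $$\Lambda_3(z)=-\tfrac12\frac{(2iz)^3}{3!}-\sum_{n\ge0}Li_3(q^{2n}e^{2iz})-\sum_{n\ge1}Li_3(q^{2n}e^{-2iz}),\qquad 0<\operatorname{Im}z<\pi\operatorname{Im}\tau,\qquad Li_3(x)=\sum_{r\ge1}\frac{x^r}{r^3},$$ and let $$\overset{\star}{F}_{temp}=\frac18\sum_{0\le i\neq j\le l}\Lambda_3(z^i-z^j)-\frac{l+1}{4}\sum_{i=0}^l\Lambda_3(z^i),$$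 where on an open set any branch of each of the summands may be used. **Proposition.** Every regular point has an open neighbourhood on which a branch of $\overset{\star}{F}_{temp}$ exists. For every open set $U$ of regular points and every branch of $\overset{\star}{F}_{temp}$ on $U$, $$\overset{\star}{c}_{z_iz_jz_k}=\frac{\partial^3\overset{\star}{F}_{temp}}{\partial z^i\,\partial z^j\,\partial z^k}\qquad\text{on }\mathbb C\times U,\qquad i,j,k=1,\dots,l.$$ Consequently, if moreover for each $\tau$ the slice $\{z:(z,\tau)\in U\}$ is connected or empty, then for every $\overset{\star}{F}_{quantum}$ on $U$ there are functions $A_{ij},B_i,C$ of $\tau$ alone such that on $U$ $$\overset{\star}{F}_{quantum}=\overset{\star}{F}_{temp}+\frac12\sum_{i,j=0}^lA_{ij}(\tau)z^iz^j+\sum_{i=0}^lB_i(\tau)z^i+C(\tau).$$ -/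

import Mathlib

open Filter Topology

noncomputable section

namespace JacobiDual

/-! ### Theta function and superpotential -/

/-- The nome `q = exp (π i τ)`. -/
def nome (τ : ℂ) : ℂ := Complex.exp (Real.pi * Complex.I * τ)

/-- The theta function `ϑ₁(v|τ)` in the Whittaker-Watson normalisation (quasi-periods `π`, `πτ`),
`2 G q^(1/4) sin v ∏_{n ≥ 1} (1 - q^(2n) e^(2iv)) (1 - q^(2n) e^(-2iv))`,
with `G = ∏_{n ≥ 1} (1 - q^(2n))` and `q^(1/4) = exp (π i τ / 4)`. -/
def theta1 (v τ : ℂ) : ℂ :=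
  2 * (∏' n : ℕ, (1 - nome τ ^ (2 * (n + 1)))) * Complex.exp (Real.pi * Complex.I * τ / 4) *
    Complex.sin v *
    (∏' n : ℕ, (1 - nome τ ^ (2 * (n + 1)) * Complex.exp (2 * Complex.I * v))) *
    (∏' n : ℕ, (1 - nome τ ^ (2 * (n + 1)) * Complex.exp (-(2 * Complex.I * v))))

/-- The period lattice `πℤ + πτℤ`. -/
def periodLattice (τ : ℂ) : Set ℂ :=
  {w | ∃ m n : ℤ, w = m * (Real.pi : ℂ) + n * (Real.pi * τ)}

/-- The half-open period parallelogram: it contains exactly one representative of each point of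
the elliptic curve `ℂ / (πℤ + πτℤ)`. -/
def periodCell (τ : ℂ) : Set ℂ :=
  {w | ∃ s t : ℝ, s ∈ Set.Ico (0 : ℝ) 1 ∧ t ∈ Set.Ico (0 : ℝ) 1 ∧
    w = s * (Real.pi : ℂ) + t * (Real.pi * τ)}

/-- The coordinates `(z, τ)`, with `z = (z¹, …, zˡ)`. -/
abbrev Base (l : ℕ) : Type := (Fin l → ℂ) × ℂ

/-- The flat coordinates `(u, (z, τ))` of the intersection form. -/
abbrev Space (l : ℕ) : Type := ℂ × Base l

/-- `(z⁰, z¹, …, zˡ)`, where `z⁰ = -(z¹ + ⋯ + zˡ)`. -/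
def zFull {l : ℕ} (z : Fin l → ℂ) : Fin (l + 1) → ℂ := Fin.cons (-∑ i, z i) z

/-- The points `(z, τ)` with `Im τ > 0` for which `z⁰, …, zˡ, 0` are pairwise distinct on the
elliptic curve: `superpotential` then has `l + 1` simple zeros and one pole of order `l + 1`. -/
def regularBase (l : ℕ) : Set (Base l) :=
  {p | 0 < p.2.im ∧ (∀ i, zFull p.1 i ∉ periodLattice p.2) ∧
    ∀ i j, i ≠ j → zFull p.1 i - zFull p.1 j ∉ periodLattice p.2}

/-- The superpotential `λ(v) = e^(2πiu) ∏_{i=0}^l ϑ₁(v - zⁱ|τ) / ϑ₁(v|τ)`. -/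
def superpotential {l : ℕ} (P : Space l) (v : ℂ) : ℂ :=
  Complex.exp (2 * Real.pi * Complex.I * P.1) *
    ∏ i : Fin (l + 1), theta1 (v - zFull P.2.1 i) P.2.2 / theta1 v P.2.2

/-! ### Partial derivatives in the flat coordinates -/

/-- Labels of the flat coordinates `u, z¹, …, zˡ, τ`. -/
inductive Coord (l : ℕ) : Type
  | u : Coord l
  | z : Fin l → Coord l
  | tau : Coord l

/-- The coordinate vector belonging to a label. -/
def Coord.dir {l : ℕ} : Coord l → Space l
  | .u => (1, (0, 0))
  | .z i => (0, (Pi.single i 1, 0))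
  | .tau => (0, (0, 1))

/-- The partial derivative `∂F/∂pᵃ`. -/
def partialD {l : ℕ} (a : Coord l) (F : Space l → ℂ) (P : Space l) : ℂ :=
  lineDeriv ℂ F P a.dir

/-- The third partial derivative `∂³F/∂pᵃ∂pᵇ∂pᶜ`. -/
def partialD3 {l : ℕ} (a b c : Coord l) (F : Space l → ℂ) : Space l → ℂ :=
  partialD a (partialD b (partialD c F))

/-! ### The dual structure functions -/

/-- The residue at an isolated singularity: the limit (for a function that is holomorphic in a
punctured neighbourhood, the eventual value) of `(1/2πi) ∮ f` over small circles. -/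
def residue (f : ℂ → ℂ) (c : ℂ) : ℂ :=
  limUnder (𝓝[>] (0 : ℝ)) fun r : ℝ => (2 * Real.pi * Complex.I)⁻¹ * ∮ v in C(c, r), f v

/-- `∂(log λ(v))/∂pᵃ` at constant `v`. -/
def logPartial {l : ℕ} (a : Coord l) (P : Space l) (v : ℂ) : ℂ :=
  partialD a (fun Q => superpotential Q v) P / superpotential P v

/-- The points of the elliptic curve with `dλ = 0` (the pole `v = 0` is excluded). -/
def criticalPoints {l : ℕ} (P : Space l) : Set ℂ :=
  {v | v ∈ periodCell P.2.2 ∧ theta1 v P.2.2 ≠ 0 ∧ deriv (superpotential P) v = 0}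

/-- The dual structure functions in flat coordinates,
`c⋆(∂ₐ, ∂ᵦ, ∂_c) = ∑ res_{dλ=0} ∂ₐ(log λ dv) ∂ᵦ(log λ dv) ∂_c(log λ dv) / d log λ`. The overall
sign is the one for which the same residue formula with two arguments gives the intersection form
`2π² du dτ - ∑ (dzⁱ)²`. -/
def dualStructure {l : ℕ} (P : Space l) (a b c : Coord l) : ℂ :=
  ∑ᶠ v ∈ criticalPoints P,
    residue (fun w => logPartial a P w * logPartial b P w * logPartial c P w /
      logDeriv (superpotential P) w) v

/-- `F` is a dual prepotential on `W`: it is holomorphic and all its third partial derivatives in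
the flat coordinates are the dual structure functions. -/
def IsDualPrepotential {l : ℕ} (W : Set (Space l)) (F : Space l → ℂ) : Prop :=
  AnalyticOnNhd ℂ F W ∧ ∀ P ∈ W, ∀ a b c : Coord l, partialD3 a b c F P = dualStructure P a b c

/-- The explicit part `2πi (½ π² τ u² - ½ u ∑_{i=0}^l (zⁱ)²)` of the dual prepotential. -/
def classicalPart {l : ℕ} (P : Space l) : ℂ :=
  2 * Real.pi * Complex.I *
    (1 / 2 * (Real.pi : ℂ) ^ 2 * P.2.2 * P.1 ^ 2 - 1 / 2 * P.1 * ∑ i, zFull P.2.1 i ^ 2)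

/-- `Fq(z, τ)` is a function `F_quantum` on `U`: adding it to the explicit part gives a dual
prepotential for all `u ∈ ℂ` and `(z, τ) ∈ U`. -/
def IsQuantumPart {l : ℕ} (U : Set (Base l)) (Fq : Base l → ℂ) : Prop :=
  IsDualPrepotential {P : Space l | P.2 ∈ U} fun P => classicalPart P + Fq P.2

/-! ### The multivalued function `Λ_N` -/

/-- The polylogarithm series, for `|x| < 1`. -/
def polylog (N : ℕ) (x : ℂ) : ℂ := ∑' r : ℕ, x ^ (r + 1) / ((r : ℂ) + 1) ^ N

/-- The strip `0 < Im z < π Im τ` of points `(z, τ)`, where all the polylogarithm series in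
`lambdaSeries` converge. -/
def lambdaStrip : Set (ℂ × ℂ) := {x | 0 < x.1.im ∧ x.1.im < Real.pi * x.2.im}

/-- `Λ_N(z, q)` on the strip:
`-½ (2iz)^N / N! - ∑_{n≥0} Li_N(q^(2n) e^(2iz)) + (-1)^N ∑_{n≥1} Li_N(q^(2n) e^(-2iz))`. -/
def lambdaSeries (N : ℕ) (x : ℂ × ℂ) : ℂ :=
  -(1 / 2) * (2 * Complex.I * x.1) ^ N / (N.factorial : ℂ) -
    (∑' n : ℕ, polylog N (nome x.2 ^ (2 * n) * Complex.exp (2 * Complex.I * x.1))) +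
    (-1) ^ N *
      ∑' n : ℕ, polylog N (nome x.2 ^ (2 * (n + 1)) * Complex.exp (-(2 * Complex.I * x.1)))

/-- The germ of `f` at the point `x = (z, τ)` is a branch of the multivalued function `Λ_N`: it
arises from `lambdaSeries` by analytic continuation along a path in `ℂ × ℍ` that starts in the
strip. Here `g t` represents the function element at the point `γ t` of the path. -/
def IsLambdaGerm (N : ℕ) (f : ℂ × ℂ → ℂ) (x : ℂ × ℂ) : Prop :=
  ∃ (γ : ℝ → ℂ × ℂ) (g : ℝ → ℂ × ℂ → ℂ),
    ContinuousOn γ (Set.Icc 0 1) ∧ γ 0 ∈ lambdaStrip ∧ γ 1 = x ∧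
    (∀ t ∈ Set.Icc (0 : ℝ) 1, 0 < (γ t).2.im ∧ AnalyticAt ℂ (g t) (γ t)) ∧
    (∀ t ∈ Set.Icc (0 : ℝ) 1, ∀ᶠ s in 𝓝[Set.Icc 0 1] t, g s =ᶠ[𝓝 (γ s)] g t) ∧
    g 0 =ᶠ[𝓝 (γ 0)] lambdaSeries N ∧ g 1 =ᶠ[𝓝 x] f

/-- `h` is a branch on `U` of the multivalued function `(z, τ) ↦ Λ_N(w(z), q)`. -/
def IsLambdaBranch {l : ℕ} (N : ℕ) (U : Set (Base l)) (w : (Fin l → ℂ) → ℂ) (h : Base l → ℂ) :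
    Prop :=
  ∀ p ∈ U, ∃ f : ℂ × ℂ → ℂ, IsLambdaGerm N f (w p.1, p.2) ∧
    h =ᶠ[𝓝 p] fun p' => f (w p'.1, p'.2)

/-- `Ft` is a branch on `U` of
`F_temp = ⅛ ∑_{i≠j} Λ₃(zⁱ - zʲ) - ((l+1)/4) ∑ᵢ Λ₃(zⁱ)`, with `i, j = 0, …, l`. -/
def IsTempBranch {l : ℕ} (U : Set (Base l)) (Ft : Base l → ℂ) : Prop :=
  ∃ (L : Fin (l + 1) → Fin (l + 1) → Base l → ℂ) (M : Fin (l + 1) → Base l → ℂ),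
    (∀ i j, i ≠ j → IsLambdaBranch 3 U (fun z => zFull z i - zFull z j) (L i j)) ∧
    (∀ i, IsLambdaBranch 3 U (fun z => zFull z i) (M i)) ∧
    ∀ p ∈ U, Ft p =
      1 / 8 * (∑ i, ∑ j, if i ≠ j then L i j p else 0) - ((l : ℂ) + 1) / 4 * ∑ i, M i p

end JacobiDual

end

/-! Write ζ = ϑ₁'/ϑ₁. In the z-directions both sides of the identity are combinations of ζ(zᵃ - zᵇ)
and ζ(zᵃ). The left side is evaluated by the residue theorem on the torus, the right side by Λ₃''' =
-4ζ.

Residue side. Put δₖ(a) = ∂zᵃ/∂zᵏ. Then ∂ₖ log λ = -∑ₐ δₖ(a) ζ(v - zᵃ) (`logPartial_z`), and d log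
λ/dv = ∑ₐ ζ(v - zᵃ) - (l+1) ζ(v) (`logDeriv_superpotential`). The quasi-period -2i of ζ cancels in
both, because ∑ₐ δₖ(a) = 0 and λ has as many zeros as poles, so the integrand is elliptic. It is
regular at v = 0, where only its denominator has a pole. Hence its residues at the critical points
add up to minus those at the zᵃ (`sum_residue_logFormZeros`, from `sum_residue_eq_zero`). At zᵃ
three simple poles over one leave at most a double pole, whose residue is explicit
(`residue_tripleForm`). As ζ is odd, the double sum may be antisymmetrised (`sum_antisymm`), and its
cubic coefficient collapses to -½ times the product of the three differences δ(a) - δ(b).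

Branch side. On the strip Λ_N' = 2i Λ_{N-1} and ζ = 2i Λ₀ (`thetaZeta_eq_lambdaSeries`), whence
Λ₃''' = (2i)³Λ₀ = -4ζ. Cleared of its denominator, this relation is holomorphic on ℂ × ℍ wherever
the branch is, so the identity theorem carries it along every path of continuation
(`IsLambdaGerm.thetaRelation_eq`). The coefficients 1/8 and -(l+1)/4 then match the residue side
(`IsTempBranch.local`). Branches exist because ζ can be integrated three times in z near a segment
that avoids the lattice (`exists_lambdaGerm`).

The last assertion follows: a dual prepotential and a branch of F_temp have the same third
z-derivatives, and a holomorphic function on a connected slice with vanishing third derivatives is a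
quadratic polynomial (`exists_quadratic`). -/

noncomputable section
namespace JacobiDual
open MeasureTheory Set Metric BoundedContinuousFunction

/-! ### Holomorphic functions of two variables -/

/-- Integration of bounded continuous functions of two real variables over `(0, 2π]²`. -/
def torusIntegral : ((ℝ × ℝ) →ᵇ ℂ) →L[ℂ] ℂ :=
  LinearMap.mkContinuous
    { toFun := fun φ => ∫ p, φ p ∂((volume.restrict (Ioc (0 : ℝ) (2 * Real.pi))).prod
        (volume.restrict (Ioc (0 : ℝ) (2 * Real.pi))))
      map_add' := fun φ ψ => integral_add (φ.integrable _) (ψ.integrable _)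
      map_smul' := fun c _ => integral_const_mul c _ }
    (((volume.restrict (Ioc (0 : ℝ) (2 * Real.pi))).prod
        (volume.restrict (Ioc (0 : ℝ) (2 * Real.pi)))).real univ)
    (fun φ => BoundedContinuousFunction.norm_integral_le_mul_norm _ φ)

theorem torusIntegral_apply (φ : (ℝ × ℝ) →ᵇ ℂ) :
    torusIntegral φ = ∫ s in (0 : ℝ)..2 * Real.pi, ∫ t in (0 : ℝ)..2 * Real.pi, φ (s, t) := by
  have h : (0 : ℝ) ≤ 2 * Real.pi := by positivity
  simp only [intervalIntegral.integral_of_le h]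
  exact integral_prod _ (φ.integrable _)

/-- Inversion is analytic on the units of a Banach algebra. With `c` a parametrised circle, this
makes the whole Cauchy kernel one analytic function of z with values in the bounded continuous
functions. -/
theorem analyticAt_inverse_sub (c : (ℝ × ℝ) →ᵇ ℂ) (a : ℂ) (h : IsUnit (c - algebraMap ℂ _ a)) :
    AnalyticAt ℂ (fun z : ℂ => Ring.inverse (c - algebraMap ℂ ((ℝ × ℝ) →ᵇ ℂ) z)) a := by
  obtain ⟨u, hu⟩ := h
  have h1 : AnalyticAt ℂ (fun z : ℂ => c - algebraMap ℂ ((ℝ × ℝ) →ᵇ ℂ) z) a :=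
    analyticAt_const.sub ((Algebra.linearMap ℂ ((ℝ × ℝ) →ᵇ ℂ)).mkContinuous 1
      (fun x => by simp)|>.analyticAt a)
  have h2 := analyticAt_inverse (𝕜 := ℂ) u
  rw [hu] at h2
  exact AnalyticAt.comp (f := fun z : ℂ => c - algebraMap ℂ ((ℝ × ℝ) →ᵇ ℂ) z) h2 h1

theorem ringInverse_apply (c : (ℝ × ℝ) →ᵇ ℂ) (h : IsUnit c) (p : ℝ × ℝ) :
    Ring.inverse c p = (c p)⁻¹ := by
  have h1 := congrArg (fun φ : (ℝ × ℝ) →ᵇ ℂ => φ p) (Ring.mul_inverse_cancel c h)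
  exact eq_inv_of_mul_eq_one_right (by simpa using h1)

/-- The bounded continuous function `(s, t) ↦ c + r e^{iσ(s,t)}`. -/
def circleBCF (c : ℂ) (r : ℝ) (σ : C(ℝ × ℝ, ℝ)) : (ℝ × ℝ) →ᵇ ℂ :=
  BoundedContinuousFunction.ofNormedAddCommGroup (fun p => circleMap c r (σ p))
    ((continuous_circleMap c r).comp σ.continuous) (‖c‖ + |r|) (fun p => by
      refine (norm_add_le _ _).trans ?_
      simp)

theorem circleBCF_apply (c : ℂ) (r : ℝ) (σ : C(ℝ × ℝ, ℝ)) (p : ℝ × ℝ) :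
    circleBCF c r σ p = circleMap c r (σ p) := rfl

/-- A point inside the circle has distance at least r - |z - c| from it, so the pointwise inverse is
bounded and stays in the algebra. -/
theorem isUnit_circleBCF_sub {c z : ℂ} {r : ℝ} (σ : C(ℝ × ℝ, ℝ)) (hz : z ∈ ball c r) :
    IsUnit (circleBCF c r σ - algebraMap ℂ ((ℝ × ℝ) →ᵇ ℂ) z) := by
  have hr : 0 < r := pos_of_mem_ball hz
  have hd : 0 < r - dist z c := by simpa using hz
  have hlow : ∀ t, r - dist z c ≤ ‖circleMap c r t - z‖ := fun t => by
    have h1 : dist (circleMap c r t) c = r := circleMap_mem_sphere c hr.le t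
    have := dist_triangle (circleMap c r t) z c
    rw [← dist_eq_norm]
    linarith
  have hne : ∀ t, circleMap c r t - z ≠ 0 := fun t => norm_pos_iff.1 (hd.trans_le (hlow t))
  let b : (ℝ × ℝ) →ᵇ ℂ := BoundedContinuousFunction.ofNormedAddCommGroup
    (fun p => (circleMap c r (σ p) - z)⁻¹)
    ((((continuous_circleMap c r).comp σ.continuous).sub continuous_const).inv₀ fun p => hne _)
    (r - dist z c)⁻¹ (fun p => by
      rw [norm_inv]
      exact inv_anti₀ hd (hlow _))
  refine IsUnit.of_mul_eq_one b ?_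
  ext p
  simpa [circleBCF_apply, b] using mul_inv_cancel₀ (hne (σ p))

/-- Osgood's lemma: a continuous, separately holomorphic function is analytic. -/
theorem analyticAt_of_separately {f : ℂ × ℂ → ℂ} {x : ℂ × ℂ} {r : ℝ} (hr : 0 < r)
    (hc : ContinuousOn f (closedBall x.1 r ×ˢ closedBall x.2 r))
    (h1 : ∀ w ∈ closedBall x.2 r, DifferentiableOn ℂ (fun z => f (z, w)) (closedBall x.1 r))
    (h2 : ∀ z ∈ closedBall x.1 r, DifferentiableOn ℂ (fun w => f (z, w)) (closedBall x.2 r)) :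
    AnalyticAt ℂ f x := by
  have hm1 : ∀ t, circleMap x.1 r t ∈ closedBall x.1 r := fun t =>
    sphere_subset_closedBall (circleMap_mem_sphere _ hr.le t)
  have hm2 : ∀ t, circleMap x.2 r t ∈ closedBall x.2 r := fun t =>
    sphere_subset_closedBall (circleMap_mem_sphere _ hr.le t)
  obtain ⟨M, hM⟩ := ((isCompact_closedBall x.1 r).prod
    (isCompact_closedBall x.2 r)).exists_bound_of_continuousOn hc
  let e0 : (ℝ × ℝ) →ᵇ ℂ := BoundedContinuousFunction.ofNormedAddCommGroup
    (fun p => f (circleMap x.1 r p.1, circleMap x.2 r p.2))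
    (hc.comp_continuous (((continuous_circleMap _ _).comp continuous_fst).prodMk
      ((continuous_circleMap _ _).comp continuous_snd)) fun p => ⟨hm1 _, hm2 _⟩)
    M (fun p => hM _ ⟨hm1 _, hm2 _⟩)
  let C1 := circleBCF x.1 r ⟨_, continuous_fst⟩
  let C2 := circleBCF x.2 r ⟨_, continuous_snd⟩
  let w1 := circleBCF 0 r ⟨_, continuous_fst⟩
  let w2 := circleBCF 0 r ⟨_, continuous_snd⟩
  -- Cauchy's formula is applied once in each variable: two factors 1/(2πi), and a factor i from
  -- each circle's velocity i·re^{iθ}; the factors re^{iθ} are `w1` and `w2`. The map `g` is a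
  -- continuous linear functional applied to an analytic algebra-valued map.
  let k : ℂ := (2 * Real.pi * Complex.I)⁻¹ * (2 * Real.pi * Complex.I)⁻¹ * (Complex.I * Complex.I)
  let g : ℂ × ℂ → ℂ := fun y => k * torusIntegral
    (Ring.inverse (C1 - algebraMap ℂ ((ℝ × ℝ) →ᵇ ℂ) y.1) *
      Ring.inverse (C2 - algebraMap ℂ ((ℝ × ℝ) →ᵇ ℂ) y.2) * (e0 * w1 * w2))
  have hg : AnalyticAt ℂ g x := by
    have a1 := (analyticAt_inverse_sub C1 x.1
      (isUnit_circleBCF_sub _ (mem_ball_self hr))).comp (f := fun y : ℂ × ℂ => y.1)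
        (x := x) analyticAt_fst
    have a2 := (analyticAt_inverse_sub C2 x.2
      (isUnit_circleBCF_sub _ (mem_ball_self hr))).comp (f := fun y : ℂ × ℂ => y.2)
        (x := x) analyticAt_snd
    exact analyticAt_const.mul ((torusIntegral.analyticAt _).comp ((a1.mul a2).mul analyticAt_const))
  refine hg.congr ?_
  have hU : ball x.1 r ×ˢ ball x.2 r ∈ 𝓝 x :=
    prod_mem_nhds (ball_mem_nhds _ hr) (ball_mem_nhds _ hr)
  filter_upwards [hU] with y hy
  have hpi : (2 * Real.pi * Complex.I : ℂ) ≠ 0 := Complex.two_pi_I_ne_zero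
  have c1 := (h1 y.2 (ball_subset_closedBall hy.2)).circleIntegral_sub_inv_smul hy.1
  have c2 : ∀ t, (∮ w in C(x.2, r), (w - y.2)⁻¹ • f (circleMap x.1 r t, w)) =
      (2 * Real.pi * Complex.I) • f (circleMap x.1 r t, y.2) := fun t =>
    (h2 _ (hm1 t)).circleIntegral_sub_inv_smul hy.2
  have hf : f y = (2 * Real.pi * Complex.I)⁻¹ * (2 * Real.pi * Complex.I)⁻¹ *
      ∮ z in C(x.1, r), (z - y.1)⁻¹ • ((2 * Real.pi * Complex.I) • f (z, y.2)) := by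
    have : (∮ z in C(x.1, r), (z - y.1)⁻¹ • ((2 * Real.pi * Complex.I : ℂ) • f (z, y.2))) =
        (2 * Real.pi * Complex.I : ℂ) • ∮ z in C(x.1, r), (z - y.1)⁻¹ • f (z, y.2) := by
      rw [← circleIntegral.integral_smul]
      simp only [smul_eq_mul]
      congr 1; ext z; ring
    rw [this, c1]
    simp only [smul_eq_mul]
    field_simp
  rw [hf]
  simp only [g, torusIntegral_apply, k]
  rw [mul_assoc]
  congr 1
  rw [circleIntegral, ← intervalIntegral.integral_const_mul]
  congr 1; ext s
  rw [← c2, circleIntegral]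
  simp only [smul_eq_mul, deriv_circleMap]
  rw [← intervalIntegral.integral_const_mul, ← intervalIntegral.integral_const_mul,
    ← intervalIntegral.integral_const_mul]
  congr 1; ext t
  simp only [BoundedContinuousFunction.mul_apply]
  rw [ringInverse_apply _ (isUnit_circleBCF_sub _ hy.1),
    ringInverse_apply _ (isUnit_circleBCF_sub _ hy.2)]
  simp only [w1, w2, e0, circleBCF_apply, BoundedContinuousFunction.sub_apply,
    BoundedContinuousFunction.coe_ofNormedAddCommGroup, ContinuousMap.coe_mk]
  have e1 : ∀ z : ℂ, (algebraMap ℂ ((ℝ × ℝ) →ᵇ ℂ) z) (s, t) = z := fun z => by simp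
  rw [e1, e1]
  ring

theorem analyticOnNhd_of_separately {f : ℂ × ℂ → ℂ} {U : Set (ℂ × ℂ)} (hU : IsOpen U)
    (hc : ContinuousOn f U) (h1 : ∀ x ∈ U, DifferentiableAt ℂ (fun z => f (z, x.2)) x.1)
    (h2 : ∀ x ∈ U, DifferentiableAt ℂ (fun w => f (x.1, w)) x.2) : AnalyticOnNhd ℂ f U := by
  intro x hx
  obtain ⟨r, hr, hrU⟩ := nhds_basis_closedBall.mem_iff.1 (hU.mem_nhds hx)
  rw [← closedBall_prod_same] at hrU
  exact analyticAt_of_separately hr (hc.mono hrU)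
    (fun w hw z hz => (h1 (z, w) (hrU ⟨hz, hw⟩)).differentiableWithinAt)
    (fun z hz w hw => (h2 (z, w) (hrU ⟨hz, hw⟩)).differentiableWithinAt)

theorem analyticOnNhd_of_differentiableOn {f : ℂ × ℂ → ℂ} {U : Set (ℂ × ℂ)} (hU : IsOpen U)
    (hf : DifferentiableOn ℂ f U) : AnalyticOnNhd ℂ f U := by
  refine analyticOnNhd_of_separately hU hf.continuousOn (fun x hx => ?_) fun x hx => ?_
  · exact (hf.differentiableAt (hU.mem_nhds hx)).comp x.1
      (differentiableAt_id.prodMk (differentiableAt_const _))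
  · exact (hf.differentiableAt (hU.mem_nhds hx)).comp x.2
      ((differentiableAt_const _).prodMk differentiableAt_id)

/-- A locally uniform limit of analytic functions of two variables is analytic. -/
theorem _root_.TendstoLocallyUniformlyOn.analyticOnNhd_prod {ι : Type*} {l : Filter ι} [l.NeBot]
    {F : ι → ℂ × ℂ → ℂ} {f : ℂ × ℂ → ℂ} {U : Set (ℂ × ℂ)} (hU : IsOpen U)
    (h : TendstoLocallyUniformlyOn F f l U) (hF : ∀ i, AnalyticOnNhd ℂ (F i) U) :
    AnalyticOnNhd ℂ f U := by
  refine analyticOnNhd_of_separately hU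
    (h.continuousOn (Frequently.of_forall fun i => (hF i).continuousOn)) (fun x hx => ?_)
      fun x hx => ?_
  · have hV : IsOpen ((fun z : ℂ => (z, x.2)) ⁻¹' U) := hU.preimage (by fun_prop)
    have := (h.comp (fun z : ℂ => (z, x.2)) (fun z hz => hz)
      (by fun_prop : Continuous fun z : ℂ => (z, x.2)).continuousOn).differentiableOn
      (Eventually.of_forall fun i z hz => ((hF i _ hz).differentiableAt.comp z
      (differentiableAt_id.prodMk (differentiableAt_const _))).differentiableWithinAt) hV
    exact this.differentiableAt (hV.mem_nhds hx)
  · have hV : IsOpen ((fun z : ℂ => (x.1, z)) ⁻¹' U) := hU.preimage (by fun_prop)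
    have := (h.comp (fun z : ℂ => (x.1, z)) (fun z hz => hz)
      (by fun_prop : Continuous fun z : ℂ => (x.1, z)).continuousOn).differentiableOn
      (Eventually.of_forall fun i z hz => ((hF i _ hz).differentiableAt.comp z
      ((differentiableAt_const _).prodMk differentiableAt_id)).differentiableWithinAt) hV
    exact this.differentiableAt (hV.mem_nhds hx)

end JacobiDual
end

/-! ### Primitives in one variable, depending holomorphically on a parameter -/

noncomputable section
namespace JacobiDual
open MeasureTheory Set Metric

theorem analyticAt_of_differentiable {f : ℂ × ℂ → ℂ} (hf : Differentiable ℂ f) (x : ℂ × ℂ) :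
    AnalyticAt ℂ f x :=
  analyticOnNhd_of_differentiableOn isOpen_univ hf.differentiableOn x trivial

/-- Differentiation under the integral sign; the dominating constant is the maximum of `F'` over a
compact ball times [0, 1]. -/
theorem differentiableOn_intervalIntegral {F : ℂ × ℂ → ℝ → ℂ} {F' : ℂ × ℂ → ℝ → (ℂ × ℂ →L[ℂ] ℂ)}
    {U : Set (ℂ × ℂ)} (hU : IsOpen U)
    (hF : ContinuousOn (fun y : (ℂ × ℂ) × ℝ => F y.1 y.2) (U ×ˢ Icc 0 1))
    (hF' : ContinuousOn (fun y : (ℂ × ℂ) × ℝ => F' y.1 y.2) (U ×ˢ Icc 0 1))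
    (hd : ∀ x ∈ U, ∀ t ∈ Icc (0 : ℝ) 1, HasFDerivAt (fun y => F y t) (F' x t) x) :
    DifferentiableOn ℂ (fun x => ∫ t in (0 : ℝ)..1, F x t) U := by
  intro x hx
  have hsub : ∀ x ∈ U, ContinuousOn (F x) (Icc 0 1) := fun x hx =>
    hF.comp (by fun_prop : Continuous fun t : ℝ => (x, t)).continuousOn fun t ht => ⟨hx, ht⟩
  have hsub' : ContinuousOn (F' x) (Icc 0 1) :=
    hF'.comp (by fun_prop : Continuous fun t : ℝ => (x, t)).continuousOn fun t ht => ⟨hx, ht⟩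
  have hu : Set.uIoc (0 : ℝ) 1 ⊆ Icc 0 1 := by
    rw [uIoc_of_le zero_le_one]; exact Ioc_subset_Icc_self
  obtain ⟨r, hr, hrU⟩ := nhds_basis_closedBall.mem_iff.1 (hU.mem_nhds hx)
  obtain ⟨M, hM⟩ := ((isCompact_closedBall x r).prod
    (isCompact_Icc (a := (0 : ℝ)) (b := 1))).exists_bound_of_continuousOn
      (hF'.mono (prod_mono hrU subset_rfl))
  have h1 : ∀ᶠ y in 𝓝 x, AEStronglyMeasurable (F y) (volume.restrict (uIoc 0 1)) := by
    filter_upwards [hU.mem_nhds hx] with y hy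
    exact ((hsub y hy).mono hu).aestronglyMeasurable measurableSet_uIoc
  have h2 : IntervalIntegrable (F x) volume 0 1 :=
    ContinuousOn.intervalIntegrable (by simpa [uIcc_of_le] using hsub x hx)
  have h3 : AEStronglyMeasurable (F' x) (volume.restrict (uIoc 0 1)) :=
    (hsub'.mono hu).aestronglyMeasurable measurableSet_uIoc
  have h4 := intervalIntegral.hasFDerivAt_integral_of_dominated_of_fderiv_le (𝕜 := ℂ)
    (F := F) (F' := F')
    (bound := fun _ => M) (closedBall_mem_nhds x hr) h1 h2 h3
    (Eventually.of_forall fun t ht y hy => hM (y, t) ⟨hy, hu ht⟩)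
    intervalIntegrable_const
    (Eventually.of_forall fun t ht y hy => hd y (hrU hy) t (hu ht))
  exact h4.differentiableAt.differentiableWithinAt

theorem differentiableOn_segmentIntegral {V W : Set ℂ} (hV : IsOpen V) (hVc : Convex ℝ V)
    (hW : IsOpen W) {a : ℂ} (ha : a ∈ V) {Φ : ℂ × ℂ → ℂ} (hΦ : AnalyticOnNhd ℂ Φ (V ×ˢ W)) :
    DifferentiableOn ℂ
      (fun x : ℂ × ℂ => ∫ t in (0 : ℝ)..1, (x.1 - a) * Φ (a + t * (x.1 - a), x.2)) (V ×ˢ W) := by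
  have hpm : MapsTo (fun y : (ℂ × ℂ) × ℝ => (a + y.2 * (y.1.1 - a), y.1.2))
      ((V ×ˢ W) ×ˢ Icc 0 1) (V ×ˢ W) := fun y hy =>
    ⟨by simpa using hVc.add_smul_sub_mem ha hy.1.1 hy.2, hy.1.2⟩
  have hpc : Continuous fun y : (ℂ × ℂ) × ℝ => (a + y.2 * (y.1.1 - a), y.1.2) := by fun_prop
  have hs : Continuous fun y : (ℂ × ℂ) × ℝ => y.1.1 - a := by fun_prop
  have h0 := hΦ.continuousOn.comp hpc.continuousOn hpm
  have h1 : Continuous fun y : (ℂ × ℂ) × ℝ => ((y.2 : ℂ) • ContinuousLinearMap.fst ℂ ℂ ℂ).prod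
      (ContinuousLinearMap.snd ℂ ℂ ℂ) := by
    have : ∀ y : (ℂ × ℂ) × ℝ, ((y.2 : ℂ) • ContinuousLinearMap.fst ℂ ℂ ℂ).prod
        (ContinuousLinearMap.snd ℂ ℂ ℂ) =
        (y.2 : ℂ) • (ContinuousLinearMap.fst ℂ ℂ ℂ).prod (0 : ℂ × ℂ →L[ℂ] ℂ) +
        (0 : ℂ × ℂ →L[ℂ] ℂ).prod (ContinuousLinearMap.snd ℂ ℂ ℂ) := fun y => by
      ext <;> simp
    simp only [this]
    fun_prop
  refine differentiableOn_intervalIntegral (F' := fun x t =>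
    (x.1 - a) • (fderiv ℂ Φ (a + t * (x.1 - a), x.2)).comp
      (((t : ℂ) • ContinuousLinearMap.fst ℂ ℂ ℂ).prod (ContinuousLinearMap.snd ℂ ℂ ℂ)) +
      Φ (a + t * (x.1 - a), x.2) • ContinuousLinearMap.fst ℂ ℂ ℂ)
    (hV.prod hW) (hs.continuousOn.mul h0) ?_ ?_
  · have h2 := hΦ.fderiv.continuousOn.comp hpc.continuousOn hpm
    exact (hs.continuousOn.smul (h2.clm_comp h1.continuousOn)).add (h0.smul continuousOn_const)
  · intro x hx t ht
    have h1 : HasFDerivAt (fun y : ℂ × ℂ => (a + t * (y.1 - a), y.2))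
        (((t : ℂ) • ContinuousLinearMap.fst ℂ ℂ ℂ).prod (ContinuousLinearMap.snd ℂ ℂ ℂ)) x :=
      (((hasFDerivAt_fst.sub_const a).const_mul (t : ℂ)).const_add a).prodMk hasFDerivAt_snd
    have hmem : (a + t * (x.1 - a), x.2) ∈ V ×ˢ W := hpm (x := (x, t)) ⟨hx, ht⟩
    exact (hasFDerivAt_fst.sub_const a).mul
      (((hΦ _ hmem).differentiableAt.hasFDerivAt).comp x h1)

/-- The primitive is the integral along the segment from a, which is visibly holomorphic in endpoint
and parameter together. Its z-derivative is found by comparison, for each fixed parameter, with a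
one-variable primitive on the convex set V. -/
theorem exists_primitive_fst {V W : Set ℂ} (hV : IsOpen V) (hVc : Convex ℝ V) (hW : IsOpen W)
    {a : ℂ} (ha : a ∈ V) {Φ : ℂ × ℂ → ℂ} (hΦ : AnalyticOnNhd ℂ Φ (V ×ˢ W)) :
    ∃ G : ℂ × ℂ → ℂ, AnalyticOnNhd ℂ G (V ×ˢ W) ∧
      (∀ x ∈ V ×ˢ W, HasDerivAt (fun z => G (z, x.2)) (Φ x) x.1) ∧ ∀ w, G (a, w) = 0 := by
  refine ⟨_, analyticOnNhd_of_differentiableOn (hV.prod hW)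
    (differentiableOn_segmentIntegral hV hVc hW ha hΦ), fun x hx => ?_, fun w => by simp⟩
  have hΦd : DifferentiableOn ℂ (fun z => Φ (z, x.2)) V := fun z hz =>
    ((hΦ (z, x.2) ⟨hz, hx.2⟩).differentiableAt.comp z
      (differentiableAt_id.prodMk (differentiableAt_const _))).differentiableWithinAt
  obtain ⟨H, hH⟩ := hVc.exists_forall_hasDerivWithinAt hΦd
  have hH' : ∀ z ∈ V, HasDerivAt H (Φ (z, x.2)) z := fun z hz =>
    (hH z hz).hasDerivAt (hV.mem_nhds hz)
  have key : ∀ z ∈ V, ∫ t in (0 : ℝ)..1, (z - a) * Φ (a + t * (z - a), x.2) = H z - H a := by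
    intro z hz
    have hm : ∀ t ∈ Icc (0 : ℝ) 1, a + t * (z - a) ∈ V := fun t ht => by
      simpa using hVc.add_smul_sub_mem ha hz ht
    have hcont : ContinuousOn (fun t : ℝ => (z - a) * Φ (a + t * (z - a), x.2)) (uIcc 0 1) := by
      rw [uIcc_of_le zero_le_one]
      exact continuousOn_const.mul (hΦd.continuousOn.comp
        (by fun_prop : Continuous fun t : ℝ => a + t * (z - a)).continuousOn hm)
    have := intervalIntegral.integral_eq_sub_of_hasDerivAt (a := (0 : ℝ)) (b := 1)
      (f := fun t : ℝ => H (a + t * (z - a))) (fun t ht => ?_) hcont.intervalIntegrable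
    · simpa using this
    · rw [uIcc_of_le zero_le_one] at ht
      have h1 : HasDerivAt (fun t : ℝ => a + (t : ℂ) * (z - a)) (z - a) t := by
        simpa using ((Complex.ofRealCLM.hasDerivAt (x := t)).mul_const (z - a)).const_add a
      have h2 := (hH' _ (hm t ht)).comp_of_eq t h1 rfl
      rw [mul_comm] at h2
      exact h2
  refine ((hH' x.1 hx.1).sub_const (H a)).congr_of_eventuallyEq ?_
  filter_upwards [hV.mem_nhds hx.1] with z hz
  exact key z hz

/-- If `s` is a primitive of `Ψ` with respect to the first variable near `{a} × W`, it extends to a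
primitive of `Ψ` on `V × W`. -/
theorem exists_extension_primitive_fst {V V₀ W : Set ℂ} (hV : IsOpen V) (hVc : Convex ℝ V)
    (hW : IsOpen W) (hV₀ : IsOpen V₀) (hV₀c : Convex ℝ V₀) (hsub : V₀ ⊆ V) {a : ℂ} (ha : a ∈ V₀)
    {Ψ s : ℂ × ℂ → ℂ} (hΨ : AnalyticOnNhd ℂ Ψ (V ×ˢ W)) (hs : AnalyticOnNhd ℂ s (V₀ ×ˢ W))
    (hd : ∀ x ∈ V₀ ×ˢ W, HasDerivAt (fun z => s (z, x.2)) (Ψ x) x.1) :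
    ∃ G : ℂ × ℂ → ℂ, AnalyticOnNhd ℂ G (V ×ˢ W) ∧
      (∀ x ∈ V ×ˢ W, HasDerivAt (fun z => G (z, x.2)) (Ψ x) x.1) ∧ EqOn G s (V₀ ×ˢ W) := by
  obtain ⟨G, hG, hGd, hG0⟩ := exists_primitive_fst hV hVc hW (hsub ha) hΨ
  -- The primitive vanishing at a is corrected by a function of the parameter alone, namely the
  -- value of `s` at a.
  refine ⟨fun x => G x + s (a, x.2), fun x hx => (hG x hx).add ?_, fun x hx =>
    (hGd x hx).add_const (s (a, x.2)), fun x hx => ?_⟩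
  · exact (hs (a, x.2) ⟨ha, hx.2⟩).comp (f := fun x : ℂ × ℂ => (a, x.2)) (x := x)
      (analyticAt_const.prod analyticAt_snd)
  · have h1 : ∀ z ∈ V₀, HasDerivAt (fun z => G (z, x.2) - s (z, x.2)) 0 z := fun z hz => by
      have := (hGd (z, x.2) ⟨hsub hz, hx.2⟩).sub (hd (z, x.2) ⟨hz, hx.2⟩)
      rwa [sub_self] at this
    have h2 := hV₀.is_const_of_deriv_eq_zero hV₀c.isPreconnected
      (fun z hz => (h1 z hz).differentiableAt.differentiableWithinAt)
      (fun z hz => (h1 z hz).deriv) hx.1 ha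
    simp only [hG0, zero_sub] at h2
    simp only [sub_eq_iff_eq_add] at h2
    change G (x.1, x.2) + _ = s (x.1, x.2)
    rw [h2]; ring

end JacobiDual
end

noncomputable section
namespace JacobiDual
open Set

/-! ### The theta function -/

theorem norm_nome_lt_one {τ : ℂ} (hτ : 0 < τ.im) : ‖nome τ‖ < 1 := by
  rw [nome, Complex.norm_exp, Real.exp_lt_one_iff]
  simp
  positivity

/-- Powers of the nome become translations by nπτ; the theta product and the polylogarithm sums are
compared in this form. -/
theorem nome_pow_mul_exp (τ v : ℂ) (n : ℕ) :
    nome τ ^ (2 * n) * Complex.exp (2 * Complex.I * v) =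
      Complex.exp (2 * Complex.I * (v + n * (Real.pi * τ))) := by
  rw [nome, ← Complex.exp_nat_mul, ← Complex.exp_add]
  congr 1
  push_cast; ring

/-- The product `∏_{n ≥ 1} (1 - q^(2n) e^(2iv))`. -/
def thetaProd (v τ : ℂ) : ℂ :=
  ∏' n : ℕ, (1 - nome τ ^ (2 * (n + 1)) * Complex.exp (2 * Complex.I * v))

theorem theta1_eq (v τ : ℂ) : theta1 v τ =
    2 * thetaProd 0 τ * Complex.exp (Real.pi * Complex.I * τ / 4) * Complex.sin v *
      thetaProd v τ * thetaProd (-v) τ := by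
  simp [theta1, thetaProd]

theorem summable_nome_pow_mul {τ : ℂ} (hτ : 0 < τ.im) (c : ℂ) :
    Summable fun n : ℕ => ‖-(nome τ ^ (2 * (n + 1)) * c)‖ := by
  have h := norm_nome_lt_one hτ
  have h2 : ‖nome τ‖ ^ 2 < 1 := pow_lt_one₀ (norm_nonneg _) h two_ne_zero
  have := ((summable_geometric_of_lt_one (by positivity) h2).mul_left (‖nome τ‖ ^ 2)).mul_right ‖c‖
  refine this.congr fun n => ?_
  rw [norm_neg, norm_mul, norm_pow]
  ring

/-- On this domain the n-th factor differs from 1 by at most ρ^(2n+2) R, which is summable. The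
bound is uniform in v and τ together, as joint analyticity requires. -/
theorem hasProdLocallyUniformlyOn_theta {ρ R : ℝ} (hρ : ρ < 1) :
    HasProdLocallyUniformlyOn
      (fun (n : ℕ) (x : ℂ × ℂ) => 1 + -(nome x.2 ^ (2 * (n + 1)) * Complex.exp (2 * Complex.I * x.1)))
      (fun x => ∏' n : ℕ, (1 + -(nome x.2 ^ (2 * (n + 1)) * Complex.exp (2 * Complex.I * x.1))))
      {x : ℂ × ℂ | ‖nome x.2‖ < ρ ∧ ‖Complex.exp (2 * Complex.I * x.1)‖ < R} := by
  have hc1 : Continuous fun x : ℂ × ℂ => nome x.2 := by unfold nome; fun_prop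
  have hc2 : Continuous fun x : ℂ × ℂ => Complex.exp (2 * Complex.I * x.1) := by fun_prop
  rcases lt_or_ge ρ 0 with h0 | h0
  · have : {x : ℂ × ℂ | ‖nome x.2‖ < ρ ∧ ‖Complex.exp (2 * Complex.I * x.1)‖ < R} = ∅ :=
      eq_empty_of_forall_notMem fun x hx => (hx.1.trans h0).not_ge (norm_nonneg _)
    rw [this]
    exact fun _ _ x hx => hx.elim
  have h2 : ρ ^ 2 < 1 := pow_lt_one₀ h0 hρ two_ne_zero
  refine Summable.hasProdLocallyUniformlyOn_nat_one_add
    ((isOpen_lt hc1.norm continuous_const).inter (isOpen_lt hc2.norm continuous_const))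
    (((summable_geometric_of_lt_one (by positivity) h2).mul_left (ρ ^ 2)).mul_right R)
    (Eventually.of_forall fun n x hx => ?_) (fun n => by fun_prop)
  rw [norm_neg, norm_mul, norm_pow]
  have e : ρ ^ 2 * (ρ ^ 2) ^ n * R = ρ ^ (2 * (n + 1)) * R := by ring
  rw [e]
  exact mul_le_mul (pow_le_pow_left₀ (norm_nonneg _) hx.1.le _) hx.2.le (norm_nonneg _)
    (by positivity)

theorem thetaProd_eq (v τ : ℂ) : thetaProd v τ =
    ∏' n : ℕ, (1 + -(nome τ ^ (2 * (n + 1)) * Complex.exp (2 * Complex.I * v))) := by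
  simp only [thetaProd, sub_eq_add_neg]

theorem analyticAt_thetaProd {x : ℂ × ℂ} (hx : 0 < x.2.im) :
    AnalyticAt ℂ (fun x : ℂ × ℂ => thetaProd x.1 x.2) x := by
  obtain ⟨ρ, hρ, hρ1⟩ := exists_between (norm_nome_lt_one hx)
  simp only [thetaProd_eq]
  have h := hasProdLocallyUniformlyOn_theta
    (R := ‖Complex.exp (2 * Complex.I * x.1)‖ + 1) hρ1
  have hc1 : Continuous fun x : ℂ × ℂ => nome x.2 := by unfold nome; fun_prop
  have hc2 : Continuous fun x : ℂ × ℂ => Complex.exp (2 * Complex.I * x.1) := by fun_prop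
  refine TendstoLocallyUniformlyOn.analyticOnNhd_prod
    ((isOpen_lt hc1.norm continuous_const).inter (isOpen_lt hc2.norm continuous_const)) h
      (fun s => ?_) x ⟨hρ, lt_add_one ‖Complex.exp (2 * Complex.I * x.1)‖⟩
  intro y _
  have : AnalyticAt ℂ (fun y : ℂ × ℂ => ∏ n ∈ s, (1 + -(nome y.2 ^ (2 * (n + 1)) *
      Complex.exp (2 * Complex.I * y.1)))) y :=
    Finset.analyticAt_fun_prod _ fun n _ => analyticAt_of_differentiable
      (by unfold nome; fun_prop) y
  refine this.congr (Eventually.of_forall fun y => by simp)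

theorem analyticAt_theta1 {x : ℂ × ℂ} (hx : 0 < x.2.im) :
    AnalyticAt ℂ (fun x : ℂ × ℂ => theta1 x.1 x.2) x := by
  simp only [theta1_eq]
  have h0 : AnalyticAt ℂ (fun x : ℂ × ℂ => thetaProd 0 x.2) x :=
    (analyticAt_thetaProd (x := (0, x.2)) hx).comp (f := fun x : ℂ × ℂ => ((0 : ℂ), x.2)) (x := x)
      (analyticAt_const.prod analyticAt_snd)
  have h1 : AnalyticAt ℂ (fun x : ℂ × ℂ => thetaProd (-x.1) x.2) x :=
    (analyticAt_thetaProd (x := (-x.1, x.2)) hx).comp (f := fun x : ℂ × ℂ => (-x.1, x.2)) (x := x)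
      (analyticAt_fst.neg.prod analyticAt_snd)
  have h2 : AnalyticAt ℂ (fun x : ℂ × ℂ => Complex.sin x.1) x :=
    (Complex.analyticAt_sin (x := x.1)).comp (f := fun x : ℂ × ℂ => x.1) (x := x) analyticAt_fst
  have h3 : AnalyticAt ℂ (fun x : ℂ × ℂ => Complex.exp (Real.pi * Complex.I * x.2 / 4)) x :=
    (by fun_prop : AnalyticAt ℂ (fun t : ℂ => Complex.exp (Real.pi * Complex.I * t / 4)) x.2).comp
      (f := fun x : ℂ × ℂ => x.2) (x := x) analyticAt_snd
  exact ((((analyticAt_const.mul h0).mul h3).mul h2).mul (analyticAt_thetaProd hx)).mul h1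

theorem differentiable_theta1 {τ : ℂ} (hτ : 0 < τ.im) : Differentiable ℂ fun v => theta1 v τ :=
  fun v => (analyticAt_theta1 (x := (v, τ)) hτ).differentiableAt.comp (f := fun v => (v, τ)) v
    (differentiableAt_id.prodMk (differentiableAt_const _))

theorem differentiable_thetaProd {τ : ℂ} (hτ : 0 < τ.im) :
    Differentiable ℂ fun v => thetaProd v τ :=
  fun v => (analyticAt_thetaProd (x := (v, τ)) hτ).differentiableAt.comp (f := fun v => (v, τ)) v
    (differentiableAt_id.prodMk (differentiableAt_const _))

theorem thetaProd_eq_zero_iff {τ : ℂ} (hτ : 0 < τ.im) (v : ℂ) : thetaProd v τ = 0 ↔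
    ∃ n : ℕ, Complex.exp (2 * Complex.I * (v + (n + 1 : ℕ) * (Real.pi * τ))) = 1 := by
  constructor
  · intro h
    by_contra! hne
    rw [thetaProd_eq] at h
    refine tprod_one_add_ne_zero_of_summable (fun n => ?_) (summable_nome_pow_mul hτ _) h
    rw [nome_pow_mul_exp, ← sub_eq_add_neg, sub_ne_zero]
    exact (hne n).symm
  · rintro ⟨n, hn⟩
    refine tprod_of_exists_eq_zero ⟨n, ?_⟩
    rw [nome_pow_mul_exp, hn, sub_self]

theorem thetaProd_add_pi (v τ : ℂ) : thetaProd (v + Real.pi) τ = thetaProd v τ := by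
  have : Complex.exp (2 * Complex.I * (v + Real.pi)) = Complex.exp (2 * Complex.I * v) := by
    rw [show 2 * Complex.I * (v + Real.pi) = 2 * Complex.I * v + 2 * Real.pi * Complex.I by ring,
      Complex.exp_periodic]
  simp only [thetaProd, this]

/-- Translation by πτ shifts the index of the product by one, so exactly the first factor splits
off. -/
theorem thetaProd_eq_mul {τ : ℂ} (hτ : 0 < τ.im) (v : ℂ) : thetaProd v τ =
    (1 - Complex.exp (2 * Complex.I * (v + Real.pi * τ))) * thetaProd (v + Real.pi * τ) τ := by
  have key : ∀ n : ℕ, nome τ ^ (2 * (n + 1)) * Complex.exp (2 * Complex.I * (v + Real.pi * τ)) =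
      nome τ ^ (2 * (n + 1 + 1)) * Complex.exp (2 * Complex.I * v) := fun n => by
    rw [nome_pow_mul_exp, nome_pow_mul_exp]; congr 1; push_cast; ring
  have hm : Multipliable fun n : ℕ => (1 + -(nome τ ^ (2 * (n + 1)) *
      Complex.exp (2 * Complex.I * (v + Real.pi * τ)))) :=
    multipliable_one_add_of_summable (summable_nome_pow_mul hτ _)
  rw [thetaProd_eq, thetaProd_eq]
  simp only [key] at hm ⊢
  rw [tprod_eq_zero_mul' (f := fun n : ℕ => 1 + -(nome τ ^ (2 * (n + 1)) *
    Complex.exp (2 * Complex.I * v))) hm, nome_pow_mul_exp]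
  simp [sub_eq_add_neg]

theorem theta1_neg (v τ : ℂ) : theta1 (-v) τ = -theta1 v τ := by
  rw [theta1_eq, theta1_eq, neg_neg, Complex.sin_neg]; ring

theorem theta1_add_pi (v τ : ℂ) : theta1 (v + Real.pi) τ = -theta1 v τ := by
  rw [theta1_eq, theta1_eq, thetaProd_add_pi, Complex.sin_add_pi,
    ← thetaProd_add_pi (-(v + Real.pi)), show -(v + Real.pi) + Real.pi = -v by ring]
  ring

theorem sin_eq_exp (v : ℂ) : Complex.sin v =
    -Complex.exp (-(Complex.I * v)) * (1 - Complex.exp (2 * Complex.I * v)) / (2 * Complex.I) := by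
  have h : Complex.exp (2 * Complex.I * v) = Complex.exp (Complex.I * v) * Complex.exp (Complex.I * v) := by
    rw [← Complex.exp_add]; congr 1; ring
  rw [Complex.sin, h, show -v * Complex.I = -(Complex.I * v) by ring, mul_comm v, Complex.exp_neg]
  have := Complex.exp_ne_zero (Complex.I * v)
  field_simp
  rw [Complex.I_sq]; ring

/-- The product in v loses a factor, the product in -v gains one, and the factor 1 - e^{2iv} inside
sin v makes up the balance; only exponentials remain. -/
theorem theta1_add_pi_mul {τ : ℂ} (hτ : 0 < τ.im) (v : ℂ) : theta1 (v + Real.pi * τ) τ =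
    -Complex.exp (-(Complex.I * (2 * v + Real.pi * τ))) * theta1 v τ := by
  have h1 := thetaProd_eq_mul hτ v
  have h2 := thetaProd_eq_mul hτ (-(v + Real.pi * τ))
  rw [show -(v + Real.pi * τ) + Real.pi * τ = -v by ring] at h2
  rw [theta1_eq, theta1_eq, h1, h2, sin_eq_exp, sin_eq_exp]
  have e1 : Complex.exp (2 * Complex.I * -v) = (Complex.exp (2 * Complex.I * v))⁻¹ := by
    rw [← Complex.exp_neg]; congr 1; ring
  have e2 : Complex.exp (-(Complex.I * (2 * v + Real.pi * τ))) =
      (Complex.exp (2 * Complex.I * v))⁻¹ * (Complex.exp (Complex.I * (Real.pi * τ)))⁻¹ := by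
    rw [← Complex.exp_neg, ← Complex.exp_neg, ← Complex.exp_add]; congr 1; ring
  have e3 : Complex.exp (-(Complex.I * (v + Real.pi * τ))) =
      Complex.exp (-(Complex.I * v)) * (Complex.exp (Complex.I * (Real.pi * τ)))⁻¹ := by
    rw [← Complex.exp_neg, ← Complex.exp_add]; congr 1; ring
  rw [e1, e2, e3]
  have := Complex.exp_ne_zero (2 * Complex.I * v)
  field_simp
  ring

theorem periodLattice_zero (τ : ℂ) : (0 : ℂ) ∈ periodLattice τ := ⟨0, 0, by simp⟩

theorem periodLattice_neg {τ w : ℂ} (h : w ∈ periodLattice τ) : -w ∈ periodLattice τ := by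
  obtain ⟨m, n, rfl⟩ := h
  exact ⟨-m, -n, by push_cast; ring⟩

theorem periodLattice_add {τ w w' : ℂ} (h : w ∈ periodLattice τ) (h' : w' ∈ periodLattice τ) :
    w + w' ∈ periodLattice τ := by
  obtain ⟨m, n, rfl⟩ := h
  obtain ⟨m', n', rfl⟩ := h'
  exact ⟨m + m', n + n', by push_cast; ring⟩

theorem periodLattice_sub {τ w w' : ℂ} (h : w ∈ periodLattice τ) (h' : w' ∈ periodLattice τ) :
    w - w' ∈ periodLattice τ := sub_eq_add_neg w w' ▸ periodLattice_add h (periodLattice_neg h')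

/-- This replaces passing to the quotient torus: invariance is checked on the two generators only.
-/
theorem iff_of_sub_mem_periodLattice {τ : ℂ} {Q : ℂ → Prop} (h1 : ∀ v, Q v ↔ Q (v + Real.pi))
    (h2 : ∀ v, Q v ↔ Q (v + Real.pi * τ)) {v w : ℂ} (h : w - v ∈ periodLattice τ) : Q v ↔ Q w := by
  have key : ∀ c : ℂ, (∀ v, Q v ↔ Q (v + c)) → ∀ (m : ℤ) v, Q v ↔ Q (v + m * c) := by
    intro c hc m
    induction m using Int.induction_on with
    | zero => simp
    | succ n ih => intro v; rw [ih v, hc]; push_cast; ring_nf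
    | pred n ih =>
      intro v
      rw [ih v, hc (v + ((-(n : ℤ) - 1 : ℤ) : ℂ) * c)]
      push_cast; ring_nf
  obtain ⟨m, n, hw⟩ := h
  rw [key _ h1 m v, key _ h2 n]
  rw [show w = v + m * Real.pi + n * (Real.pi * τ) by linear_combination hw]

/-- A convergent product vanishes only through one of its factors. The sine gives the row n = 0 of
the lattice, the product in v the rows n < 0, the product in -v the rows n > 0. -/
theorem theta1_eq_zero_iff {τ : ℂ} (hτ : 0 < τ.im) (v : ℂ) :
    theta1 v τ = 0 ↔ v ∈ periodLattice τ := by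
  have hP : ∀ v, thetaProd v τ = 0 ↔ ∃ (n : ℕ) (m : ℤ), v = m * Real.pi - (n + 1) * (Real.pi * τ) := by
    intro v
    rw [thetaProd_eq_zero_iff hτ]
    refine exists_congr fun n => ?_
    rw [Complex.exp_eq_one_iff]
    refine exists_congr fun m => ⟨fun h => ?_, fun h => ?_⟩
    · have h' : 2 * Complex.I * (v + (n + 1 : ℕ) * (Real.pi * τ)) = 2 * Complex.I * (m * Real.pi) := by
        rw [h]; ring
      have := mul_left_cancel₀ (by simp) h'
      push_cast at this
      linear_combination this
    · rw [h]; push_cast; ring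
  have h0 : thetaProd 0 τ ≠ 0 := by
    intro h
    obtain ⟨n, m, h⟩ := (hP 0).1 h
    have := congrArg Complex.im h
    simp at this
    have h3 : (0 : ℝ) < n + 1 := by positivity
    exact this.elim h3.ne' hτ.ne'
  rw [theta1_eq]
  simp only [mul_eq_zero, OfNat.ofNat_ne_zero, h0, Complex.exp_ne_zero, or_false, false_or,
    Complex.sin_eq_zero_iff, hP]
  constructor
  · rintro ((⟨k, rfl⟩ | ⟨n, m, rfl⟩) | ⟨n, m, h⟩)
    · exact ⟨k, 0, by simp⟩
    · exact ⟨m, -(n + 1), by push_cast; ring⟩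
    · exact ⟨-m, n + 1, by push_cast; linear_combination -h⟩
  · rintro ⟨m, n, rfl⟩
    obtain ⟨k, rfl | rfl⟩ := n.eq_nat_or_neg
    · rcases k with _ | k
      · exact Or.inl (Or.inl ⟨m, by simp⟩)
      · exact Or.inr ⟨k, -m, by push_cast; ring⟩
    · rcases k with _ | k
      · exact Or.inl (Or.inl ⟨m, by simp⟩)
      · exact Or.inl (Or.inr ⟨k, m, by push_cast; ring⟩)

theorem deriv_theta1_ne_zero {τ : ℂ} (hτ : 0 < τ.im) {v : ℂ} (hv : v ∈ periodLattice τ) :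
    deriv (fun v => theta1 v τ) v ≠ 0 := by
  have hd := differentiable_theta1 hτ
  suffices h : v ∈ periodLattice τ ∧ deriv (fun v => theta1 v τ) v ≠ 0 from h.2
  -- Lattice membership is part of the invariant property: under v ↦ v + πτ the derivative picks up
  -- a multiple of ϑ₁(v), which drops out only at a zero. At v = 0 the function is sin v times a
  -- nonzero factor.
  refine (iff_of_sub_mem_periodLattice (Q := fun v => v ∈ periodLattice τ ∧
    deriv (fun v => theta1 v τ) v ≠ 0) (fun v => ?_) (fun v => ?_)
      (by simpa using hv : v - 0 ∈ periodLattice τ)).1 ⟨periodLattice_zero τ, ?_⟩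
  · have hp : v ∈ periodLattice τ ↔ v + Real.pi ∈ periodLattice τ := by
      rw [← theta1_eq_zero_iff hτ, ← theta1_eq_zero_iff hτ, theta1_add_pi, neg_eq_zero]
    have e : deriv (fun v => theta1 v τ) (v + Real.pi) = -deriv (fun v => theta1 v τ) v := by
      rw [← deriv_comp_add_const, ← deriv.fun_neg]
      simp only [theta1_add_pi]
    rw [← hp, e, neg_ne_zero]
  · have hp : v ∈ periodLattice τ ↔ v + Real.pi * τ ∈ periodLattice τ := by
      rw [← theta1_eq_zero_iff hτ, ← theta1_eq_zero_iff hτ, theta1_add_pi_mul hτ, mul_eq_zero]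
      simp
    rw [← hp]
    refine and_congr_right fun hv => ?_
    have e : deriv (fun v => theta1 v τ) (v + Real.pi * τ) =
        -Complex.exp (-(Complex.I * (2 * v + Real.pi * τ))) * deriv (fun v => theta1 v τ) v := by
      rw [← deriv_comp_add_const]
      simp only [theta1_add_pi_mul hτ]
      rw [deriv_fun_mul (by fun_prop) (hd v), (theta1_eq_zero_iff hτ v).2 hv, mul_zero, zero_add]
    rw [e, mul_ne_zero_iff]
    simp
  · have h0 : thetaProd 0 τ ≠ 0 := by
      rw [Ne, thetaProd_eq_zero_iff hτ]
      rintro ⟨n, hn⟩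
      have h1 := congrArg norm hn
      rw [Complex.norm_exp, norm_one, Real.exp_eq_one_iff] at h1
      simp at h1
      have h3 : (0 : ℝ) < (n + 1) * (Real.pi * τ.im) := by positivity
      exact h3.ne' (by simpa using h1)
    have hk : DifferentiableAt ℂ (fun v => 2 * thetaProd 0 τ *
        Complex.exp (Real.pi * Complex.I * τ / 4) * (thetaProd v τ * thetaProd (-v) τ)) 0 := by
      have h1 := differentiable_thetaProd hτ
      have h2 : Differentiable ℂ fun v => thetaProd (-v) τ := h1.comp differentiable_neg
      exact ((h1 0).mul (h2 0)).const_mul _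
    have hs := (Complex.hasDerivAt_sin 0).mul hk.hasDerivAt
    have : deriv (fun v => theta1 v τ) 0 = _ :=
      (hs.congr_of_eventuallyEq (Eventually.of_forall fun v => by
        simp only [theta1_eq, Pi.mul_apply]; ring)).deriv
    rw [this]
    simp [h0]

theorem isClosed_periodLattice {τ : ℂ} (hτ : 0 < τ.im) : IsClosed (periodLattice τ) := by
  have : periodLattice τ = (fun v => theta1 v τ) ⁻¹' {0} := by
    ext v; simp [theta1_eq_zero_iff hτ]
  rw [this]
  exact isClosed_singleton.preimage (differentiable_theta1 hτ).continuous

theorem eventually_notMem_periodLattice {τ : ℂ} (hτ : 0 < τ.im) (v : ℂ) :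
    ∀ᶠ w in 𝓝[≠] v, w ∉ periodLattice τ := by
  by_cases hv : v ∈ periodLattice τ
  · rcases ((differentiable_theta1 hτ).analyticAt v).eventually_eq_zero_or_eventually_ne_zero
      with h | h
    · exact absurd (EventuallyEq.deriv_eq (f := fun _ => (0 : ℂ)) h |>.trans (deriv_const _ _))
        (deriv_theta1_ne_zero hτ hv)
    · filter_upwards [h] with w hw
      rwa [← theta1_eq_zero_iff hτ]
  · exact nhdsWithin_le_nhds ((isClosed_periodLattice hτ).isOpen_compl.mem_nhds hv)

/-- The logarithmic derivative of `ϑ₁` with respect to `v`. -/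
def thetaZeta (v τ : ℂ) : ℂ := logDeriv (fun v => theta1 v τ) v

theorem thetaZeta_add_pi (v τ : ℂ) : thetaZeta (v + Real.pi) τ = thetaZeta v τ := by
  have e : deriv (fun v => theta1 v τ) (v + Real.pi) = -deriv (fun v => theta1 v τ) v := by
    rw [← deriv_comp_add_const, ← deriv.fun_neg]
    simp only [theta1_add_pi]
  simp only [thetaZeta, logDeriv_apply]
  rw [e, theta1_add_pi, neg_div_neg_eq]

theorem thetaZeta_neg (v τ : ℂ) : thetaZeta (-v) τ = -thetaZeta v τ := by
  have e : deriv (fun v => theta1 v τ) (-v) = deriv (fun v => theta1 v τ) v := by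
    have := deriv_comp_neg (fun v => theta1 v τ) v
    simp only [theta1_neg, deriv.fun_neg] at this
    exact (neg_injective this).symm
  simp only [thetaZeta, logDeriv_apply]
  rw [e, theta1_neg, div_neg]

/-- The logarithmic derivative of the multiplier -exp(-i(2v + πτ)) is -2i. -/
theorem thetaZeta_add_pi_mul {τ : ℂ} (hτ : 0 < τ.im) {v : ℂ} (hv : v ∉ periodLattice τ) :
    thetaZeta (v + Real.pi * τ) τ = thetaZeta v τ - 2 * Complex.I := by
  have hd := differentiable_theta1 hτ
  have h0 : theta1 v τ ≠ 0 := by rwa [Ne, theta1_eq_zero_iff hτ]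
  have he : HasDerivAt (fun v => -Complex.exp (-(Complex.I * (2 * v + Real.pi * τ))))
      (-(Complex.exp (-(Complex.I * (2 * v + Real.pi * τ))) * (-(Complex.I * 2)))) v := by
    have h1 : HasDerivAt (fun v : ℂ => -(Complex.I * (2 * v + Real.pi * τ))) (-(Complex.I * 2)) v := by
      simpa using ((((hasDerivAt_id v).const_mul 2).add_const (Real.pi * τ)).const_mul
        Complex.I).fun_neg
    exact h1.cexp.fun_neg
  have e : deriv (fun v => theta1 v τ) (v + Real.pi * τ) =
      -(Complex.exp (-(Complex.I * (2 * v + Real.pi * τ))) * (-(Complex.I * 2))) * theta1 v τ +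
        -Complex.exp (-(Complex.I * (2 * v + Real.pi * τ))) * deriv (fun v => theta1 v τ) v := by
    rw [← deriv_comp_add_const]
    simp only [theta1_add_pi_mul hτ]
    exact (he.mul (hd v).hasDerivAt).deriv
  simp only [thetaZeta, logDeriv_apply]
  rw [e, theta1_add_pi_mul hτ]
  have := Complex.exp_ne_zero (-(Complex.I * (2 * v + Real.pi * τ)))
  field_simp
  ring

theorem analyticAt_thetaZeta {τ : ℂ} (hτ : 0 < τ.im) {v : ℂ} (hv : v ∉ periodLattice τ) :
    AnalyticAt ℂ (fun v => thetaZeta v τ) v := by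
  have hd := (differentiable_theta1 hτ).analyticAt v
  exact hd.deriv.div hd (by rwa [Ne, theta1_eq_zero_iff hτ])

/-- The zero of ϑ₁ at 0 is simple, so ϑ₁ = v g with g(0) ≠ 0 and a = g'/g. Oddness of ζ makes a odd,
hence a(0) = 0; this keeps constant terms out of the residue formula. -/
theorem thetaZeta_near_zero {τ : ℂ} (hτ : 0 < τ.im) : ∃ a : ℂ → ℂ, AnalyticAt ℂ a 0 ∧ a 0 = 0 ∧
    ∀ᶠ v in 𝓝[≠] 0, thetaZeta v τ = v⁻¹ + a v := by
  have hd := differentiable_theta1 hτ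
  have h0 : theta1 0 τ = 0 := (theta1_eq_zero_iff hτ 0).2 (periodLattice_zero τ)
  obtain ⟨g, hg⟩ : ∃ g, g = dslope (fun v => theta1 v τ) 0 := ⟨_, rfl⟩
  have hgd : Differentiable ℂ g := by
    rw [← differentiableOn_univ, hg, Complex.differentiableOn_dslope univ_mem]
    exact hd.differentiableOn
  have hg0 : g 0 ≠ 0 := by
    rw [hg, dslope_same]; exact deriv_theta1_ne_zero hτ (periodLattice_zero τ)
  have hθ : ∀ v, theta1 v τ = v * g v := fun v => by
    have := sub_smul_dslope (fun v => theta1 v τ) 0 v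
    simp only [h0, sub_zero, smul_eq_mul, ← hg] at this
    exact this.symm
  have ha : AnalyticAt ℂ (fun v => deriv g v / g v) 0 :=
    (hgd.analyticAt 0).deriv.div (hgd.analyticAt 0) hg0
  have hev : ∀ᶠ v in 𝓝[≠] 0, thetaZeta v τ = v⁻¹ + deriv g v / g v := by
    filter_upwards [eventually_notMem_periodLattice hτ 0, self_mem_nhdsWithin] with v hv hv0
    have hv0' : v ≠ 0 := hv0
    have h1 : theta1 v τ ≠ 0 := by rwa [Ne, theta1_eq_zero_iff hτ]
    rw [hθ] at h1
    have e : deriv (fun v => theta1 v τ) v = 1 * g v + v * deriv g v := by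
      simp only [hθ]
      exact ((hasDerivAt_id v).mul (hgd v).hasDerivAt).deriv
    rw [thetaZeta, logDeriv_apply, e, hθ]
    have := right_ne_zero_of_mul h1
    field_simp
  refine ⟨_, ha, ?_, hev⟩
  have hneg : Tendsto (fun v : ℂ => -v) (𝓝[≠] 0) (𝓝[≠] 0) := by
    refine tendsto_nhdsWithin_iff.2 ⟨?_, ?_⟩
    · have : Tendsto (fun v : ℂ => -v) (𝓝 0) (𝓝 0) := by
        simpa using (continuous_neg (G := ℂ)).tendsto 0
      exact this.mono_left nhdsWithin_le_nhds
    · filter_upwards [self_mem_nhdsWithin] with v hv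
      simpa using hv
  have hodd : ∀ᶠ v in 𝓝[≠] (0 : ℂ), deriv g (-v) / g (-v) = -(deriv g v / g v) := by
    filter_upwards [hev, hneg.eventually hev] with v h1 h2
    rw [thetaZeta_neg, h1, inv_neg] at h2
    linear_combination -h2
  have t1 : Tendsto (fun v => deriv g v / g v) (𝓝[≠] 0) (𝓝 (deriv g 0 / g 0)) :=
    ha.continuousAt.tendsto.mono_left nhdsWithin_le_nhds
  have t2 : Tendsto (fun v => deriv g (-v) / g (-v)) (𝓝[≠] 0) (𝓝 (deriv g 0 / g 0)) :=
    t1.comp hneg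
  have t3 := tendsto_nhds_unique (t2.congr' hodd) t1.neg
  have : (2 : ℂ) * (deriv g 0 / g 0) = 0 := by linear_combination t3
  simpa using this

end JacobiDual
end

noncomputable section
namespace JacobiDual
open Set

/-! ### The series defining `Λ_N` -/

/-- `Li_N(e^(2is))`. -/
def polylogExp (N : ℕ) (s : ℂ) : ℂ := polylog N (Complex.exp (2 * Complex.I * s))

theorem norm_exp_two_I_mul (s : ℂ) : ‖Complex.exp (2 * Complex.I * s)‖ = Real.exp (-2 * s.im) := by
  rw [Complex.norm_exp]; simp

theorem norm_polylog_term_le (N : ℕ) {c : ℝ} {s : ℂ} (hs : c ≤ s.im) (r : ℕ) :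
    ‖Complex.exp (2 * Complex.I * s) ^ (r + 1) / ((r : ℂ) + 1) ^ N‖ ≤
      Real.exp (-2 * c) * Real.exp (-2 * c) ^ r := by
  rw [norm_div, norm_pow, norm_pow, norm_exp_two_I_mul, ← pow_succ']
  have h1 : (1 : ℝ) ≤ ‖(r : ℂ) + 1‖ := by
    rw [← Nat.cast_succ, Complex.norm_natCast]; simp
  refine (div_le_self (by positivity) (one_le_pow₀ h1)).trans ?_
  exact pow_le_pow_left₀ (Real.exp_pos _).le (Real.exp_le_exp.2 (by linarith)) _

theorem exp_neg_two_mul_lt_one {c : ℝ} (hc : 0 < c) : Real.exp (-2 * c) < 1 :=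
  Real.exp_lt_one_iff.2 (by linarith)

theorem summable_exp_geometric {c : ℝ} (hc : 0 < c) :
    Summable fun r : ℕ => Real.exp (-2 * c) * Real.exp (-2 * c) ^ r :=
  (summable_geometric_of_lt_one (Real.exp_pos _).le (exp_neg_two_mul_lt_one hc)).mul_left _

theorem norm_polylogExp_le (N : ℕ) {s : ℂ} (hs : 0 < s.im) :
    ‖polylogExp N s‖ ≤ Real.exp (-2 * s.im) * (1 - Real.exp (-2 * s.im))⁻¹ := by
  refine tsum_of_norm_bounded ?_ (norm_polylog_term_le N le_rfl)
  exact (hasSum_geometric_of_lt_one (Real.exp_pos _).le (exp_neg_two_mul_lt_one hs)).mul_left _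

theorem hasDerivAt_polylogExp (N : ℕ) {s : ℂ} (hs : 0 < s.im) :
    HasDerivAt (polylogExp (N + 1)) (2 * Complex.I * polylogExp N s) s := by
  have hU : IsOpen {w : ℂ | s.im / 2 < w.im} := isOpen_lt continuous_const Complex.continuous_im
  have hsU : s ∈ {w : ℂ | s.im / 2 < w.im} := by simp only [mem_ofPred_eq]; linarith
  have hb := summable_exp_geometric (half_pos hs)
  have hd : ∀ r : ℕ, DifferentiableOn ℂ (fun w : ℂ =>
      Complex.exp (2 * Complex.I * w) ^ (r + 1) / ((r : ℂ) + 1) ^ (N + 1))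
      {w : ℂ | s.im / 2 < w.im} := fun r => by fun_prop
  have hle : ∀ (r : ℕ) (w : ℂ), w ∈ {w : ℂ | s.im / 2 < w.im} →
      ‖Complex.exp (2 * Complex.I * w) ^ (r + 1) / ((r : ℂ) + 1) ^ (N + 1)‖ ≤
        Real.exp (-2 * (s.im / 2)) * Real.exp (-2 * (s.im / 2)) ^ r :=
    fun r w hw => norm_polylog_term_le (N + 1) (le_of_lt hw) r
  have h1 := (Complex.differentiableOn_tsum_of_summable_norm hb hd hU hle).differentiableAt
    (hU.mem_nhds hsU)
  have h2 := Complex.hasSum_deriv_of_summable_norm hb hd hU hle hsU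
  have h3 : ∀ r : ℕ, deriv (fun w : ℂ => Complex.exp (2 * Complex.I * w) ^ (r + 1) /
      ((r : ℂ) + 1) ^ (N + 1)) s =
      2 * Complex.I * (Complex.exp (2 * Complex.I * s) ^ (r + 1) / ((r : ℂ) + 1) ^ N) := by
    intro r
    have e : HasDerivAt (fun w : ℂ => Complex.exp (2 * Complex.I * w))
        (Complex.exp (2 * Complex.I * s) * (2 * Complex.I)) s := by
      simpa using ((hasDerivAt_id s).const_mul (2 * Complex.I)).cexp
    rw [((e.fun_pow (r + 1)).div_const _).deriv]
    have : (r : ℂ) + 1 ≠ 0 := Nat.cast_add_one_ne_zero r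
    field_simp
    push_cast
    ring
  have h4 := h1.hasDerivAt
  rw [← h2.tsum_eq] at h4
  simp only [h3, tsum_mul_left] at h4
  exact h4

theorem analyticAt_polylogExp (N : ℕ) {s : ℂ} (hs : 0 < s.im) :
    AnalyticAt ℂ (polylogExp N) s := by
  have hU : IsOpen {w : ℂ | s.im / 2 < w.im} := isOpen_lt continuous_const Complex.continuous_im
  have hsU : s ∈ {w : ℂ | s.im / 2 < w.im} := by simp only [mem_ofPred_eq]; linarith
  have := Complex.differentiableOn_tsum_of_summable_norm (summable_exp_geometric (half_pos hs))
    (F := fun (r : ℕ) (w : ℂ) => Complex.exp (2 * Complex.I * w) ^ (r + 1) / ((r : ℂ) + 1) ^ N)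
    (U := {w : ℂ | s.im / 2 < w.im}) (fun r => by fun_prop) hU
    (fun r w hw => norm_polylog_term_le N (le_of_lt hw) r)
  exact this.analyticAt (hU.mem_nhds hsU)

theorem polylogExp_zero {s : ℂ} (hs : 0 < s.im) : polylogExp 0 s =
    Complex.exp (2 * Complex.I * s) * (1 - Complex.exp (2 * Complex.I * s))⁻¹ := by
  have h : ‖Complex.exp (2 * Complex.I * s)‖ < 1 := by
    rw [norm_exp_two_I_mul]; exact exp_neg_two_mul_lt_one hs
  simp only [polylogExp, polylog, pow_zero, div_one, pow_succ']
  rw [tsum_mul_left, tsum_geometric_of_norm_lt_one h]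

/-- `∑_{n ≥ 0} Li_N(q^(2n) e^(2iz))`. -/
def polylogSum (N : ℕ) (x : ℂ × ℂ) : ℂ := ∑' n : ℕ, polylogExp N (x.1 + n * (Real.pi * x.2))

/-- The n-th argument has imaginary part at least c + nπc, so the terms decay geometrically,
uniformly in z and τ. -/
theorem norm_polylogSum_term_le (N : ℕ) {c : ℝ} (hc : 0 < c) {x : ℂ × ℂ} (h1 : c ≤ x.1.im)
    (h2 : c ≤ x.2.im) (n : ℕ) : ‖polylogExp N (x.1 + n * (Real.pi * x.2))‖ ≤
      Real.exp (-2 * c) * (1 - Real.exp (-2 * c))⁻¹ * Real.exp (-2 * (Real.pi * c)) ^ n := by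
  have him : c + n * (Real.pi * c) ≤ (x.1 + n * (Real.pi * x.2)).im := by
    simp; gcongr
  have h0 : (0 : ℝ) ≤ n * (Real.pi * c) := by positivity
  have him' : c ≤ (x.1 + n * (Real.pi * x.2)).im := by linarith
  refine (norm_polylogExp_le N (hc.trans_le him')).trans ?_
  have hlt := exp_neg_two_mul_lt_one hc
  have e : Real.exp (-2 * c) * (1 - Real.exp (-2 * c))⁻¹ * Real.exp (-2 * (Real.pi * c)) ^ n =
      Real.exp (-2 * (c + n * (Real.pi * c))) * (1 - Real.exp (-2 * c))⁻¹ := by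
    rw [← Real.exp_nat_mul, mul_right_comm, ← Real.exp_add]; congr 2; ring
  rw [e]
  have hm : Real.exp (-2 * (x.1 + n * (Real.pi * x.2)).im) ≤ Real.exp (-2 * c) :=
    Real.exp_le_exp.2 (by linarith)
  refine mul_le_mul (Real.exp_le_exp.2 (by linarith)) (inv_anti₀ (by linarith) (by linarith))
    (inv_nonneg.2 (by linarith)) (Real.exp_pos _).le

theorem summable_polylogSum_bound {c : ℝ} (hc : 0 < c) : Summable fun n : ℕ =>
    Real.exp (-2 * c) * (1 - Real.exp (-2 * c))⁻¹ * Real.exp (-2 * (Real.pi * c)) ^ n :=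
  (summable_geometric_of_lt_one (Real.exp_pos _).le
    (exp_neg_two_mul_lt_one (by positivity))).mul_left _

theorem im_add_pos {z τ : ℂ} (hz : 0 < z.im) (hτ : 0 < τ.im) (n : ℕ) :
    0 < (z + n * (Real.pi * τ)).im := by
  simp; positivity

theorem summable_polylogSum (N : ℕ) {x : ℂ × ℂ} (h1 : 0 < x.1.im) (h2 : 0 < x.2.im) :
    Summable fun n : ℕ => polylogExp N (x.1 + n * (Real.pi * x.2)) :=
  Summable.of_norm_bounded (summable_polylogSum_bound (lt_min h1 h2))
    (norm_polylogSum_term_le N (lt_min h1 h2) (min_le_left _ _) (min_le_right _ _))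

theorem analyticAt_polylogSum (N : ℕ) {x : ℂ × ℂ} (h1 : 0 < x.1.im) (h2 : 0 < x.2.im) :
    AnalyticAt ℂ (polylogSum N) x := by
  obtain ⟨c, hc, hcx⟩ := exists_between (lt_min h1 h2)
  have hU : IsOpen {y : ℂ × ℂ | c < y.1.im ∧ c < y.2.im} :=
    (isOpen_lt continuous_const (Complex.continuous_im.comp continuous_fst)).inter
      (isOpen_lt continuous_const (Complex.continuous_im.comp continuous_snd))
  refine TendstoLocallyUniformlyOn.analyticOnNhd_prod hU
    (tendstoUniformlyOn_tsum (summable_polylogSum_bound hc) fun n y hy =>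
      norm_polylogSum_term_le N hc hy.1.le hy.2.le n).tendstoLocallyUniformlyOn (fun s => ?_) x
      ⟨hcx.trans_le (min_le_left _ _), hcx.trans_le (min_le_right _ _)⟩
  intro y hy
  refine Finset.analyticAt_fun_sum _ fun n _ => ?_
  exact (analyticAt_polylogExp N (im_add_pos (hc.trans hy.1) (hc.trans hy.2) n)).comp
    (f := fun y : ℂ × ℂ => y.1 + n * (Real.pi * y.2)) (x := y)
    (analyticAt_of_differentiable (by fun_prop) y)

theorem hasDerivAt_polylogSum (N : ℕ) {z τ : ℂ} (hz : 0 < z.im) (hτ : 0 < τ.im) :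
    HasDerivAt (fun z => polylogSum (N + 1) (z, τ)) (2 * Complex.I * polylogSum N (z, τ)) z := by
  obtain ⟨c, hc, hcx⟩ := exists_between (lt_min hz hτ)
  have hU : IsOpen {w : ℂ | c < w.im} := isOpen_lt continuous_const Complex.continuous_im
  have hzU : z ∈ {w : ℂ | c < w.im} := hcx.trans_le (min_le_left _ _)
  have hterm : ∀ (n : ℕ) (w : ℂ), w ∈ {w : ℂ | c < w.im} →
      HasDerivAt (fun w => polylogExp (N + 1) (w + n * (Real.pi * τ)))
        (2 * Complex.I * polylogExp N (w + n * (Real.pi * τ))) w := fun n w hw =>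
    (hasDerivAt_polylogExp N (im_add_pos (hc.trans hw) hτ n)).comp_add_const w _
  have hd : ∀ n : ℕ, DifferentiableOn ℂ
      (fun w => polylogExp (N + 1) (w + n * (Real.pi * τ))) {w : ℂ | c < w.im} :=
    fun n w hw => (hterm n w hw).differentiableAt.differentiableWithinAt
  have hle : ∀ (n : ℕ) (w : ℂ), w ∈ {w : ℂ | c < w.im} →
      ‖polylogExp (N + 1) (w + n * (Real.pi * τ))‖ ≤ _ := fun n w hw =>
    norm_polylogSum_term_le (x := (w, τ)) (N + 1) hc (le_of_lt hw)
      (hcx.trans_le (min_le_right _ _)).le n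
  have hb := summable_polylogSum_bound hc
  have h1 := (Complex.differentiableOn_tsum_of_summable_norm hb hd hU hle).differentiableAt
    (hU.mem_nhds hzU)
  have h2 := Complex.hasSum_deriv_of_summable_norm hb hd hU hle hzU
  have h4 := h1.hasDerivAt
  rw [← h2.tsum_eq] at h4
  simp only [fun n => (hterm n z hzU).deriv, tsum_mul_left] at h4
  exact h4

/-- The sum over n ≥ 1 at -z is the sum over n ≥ 0 at the reflected point πτ - z. On the strip both
points lie in the upper half plane, and one set of lemmas serves both sums. -/
theorem lambdaSeries_eq (N : ℕ) (x : ℂ × ℂ) : lambdaSeries N x =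
    -(1 / 2) * (2 * Complex.I * x.1) ^ N / (N.factorial : ℂ) - polylogSum N x +
      (-1) ^ N * polylogSum N (Real.pi * x.2 - x.1, x.2) := by
  simp only [lambdaSeries, polylogSum, polylogExp]
  congr 3
  · ext n
    rw [nome_pow_mul_exp]
  · ext n
    rw [show -(2 * Complex.I * x.1) = 2 * Complex.I * (-x.1) by ring, nome_pow_mul_exp]
    congr 3
    push_cast; ring

theorem isOpen_lambdaStrip : IsOpen lambdaStrip :=
  (isOpen_lt continuous_const (Complex.continuous_im.comp continuous_fst)).inter
    (isOpen_lt (Complex.continuous_im.comp continuous_fst)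
      (continuous_const.mul (Complex.continuous_im.comp continuous_snd)))

theorem im_pos_of_mem_lambdaStrip {x : ℂ × ℂ} (hx : x ∈ lambdaStrip) : 0 < x.2.im :=
  pos_of_mul_pos_right (hx.1.trans hx.2) Real.pi_pos.le

theorem im_reflect_pos {x : ℂ × ℂ} (hx : x ∈ lambdaStrip) : 0 < (Real.pi * x.2 - x.1).im := by
  have := hx.2
  simp; linarith

theorem analyticAt_lambdaSeries (N : ℕ) {x : ℂ × ℂ} (hx : x ∈ lambdaStrip) :
    AnalyticAt ℂ (lambdaSeries N) x := by
  have hτ := im_pos_of_mem_lambdaStrip hx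
  have h2 : AnalyticAt ℂ (fun x : ℂ × ℂ => polylogSum N (Real.pi * x.2 - x.1, x.2)) x :=
    (analyticAt_polylogSum N (x := (Real.pi * x.2 - x.1, x.2)) (im_reflect_pos hx) hτ).comp
      (f := fun x : ℂ × ℂ => (Real.pi * x.2 - x.1, x.2)) (x := x)
      ((analyticAt_of_differentiable (by fun_prop) x).prod analyticAt_snd)
  have h3 : AnalyticAt ℂ (fun x : ℂ × ℂ =>
      -(1 / 2) * (2 * Complex.I * x.1) ^ N / (N.factorial : ℂ)) x :=
    analyticAt_of_differentiable (by fun_prop) x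
  exact ((h3.sub (analyticAt_polylogSum N hx.1 hτ)).add (analyticAt_const.mul h2)).congr
    (Eventually.of_forall fun y => (lambdaSeries_eq N y).symm)

/-- Each part lowers its order by one under d/dz with factor 2i; the sign from the reflection z ↦ πτ
- z is absorbed by (-1)^N. -/
theorem hasDerivAt_lambdaSeries (N : ℕ) {x : ℂ × ℂ} (hx : x ∈ lambdaStrip) :
    HasDerivAt (fun z => lambdaSeries (N + 1) (z, x.2)) (2 * Complex.I * lambdaSeries N x) x.1 := by
  have hτ := im_pos_of_mem_lambdaStrip hx
  have h1 := hasDerivAt_polylogSum N hx.1 hτ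
  have h2 := (hasDerivAt_polylogSum N (im_reflect_pos hx) hτ).comp_const_sub (Real.pi * x.2) x.1
  have h3 : HasDerivAt (fun z : ℂ => -(1 / 2) * (2 * Complex.I * z) ^ (N + 1) /
      ((N + 1).factorial : ℂ))
      (2 * Complex.I * (-(1 / 2) * (2 * Complex.I * x.1) ^ N / (N.factorial : ℂ))) x.1 := by
    have := ((((hasDerivAt_id x.1).const_mul (2 * Complex.I)).fun_pow (N + 1)).const_mul
      (-(1 / 2) : ℂ)).div_const ((N + 1).factorial : ℂ)
    refine this.congr_deriv ?_
    have h4 : (N.factorial : ℂ) ≠ 0 := Nat.cast_ne_zero.2 N.factorial_ne_zero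
    have h5 : (N : ℂ) + 1 ≠ 0 := Nat.cast_add_one_ne_zero N
    rw [Nat.factorial_succ]
    push_cast
    simp only [id]
    field_simp
  simp only [lambdaSeries_eq]
  refine ((h3.sub h1).add (h2.const_mul _)).congr_deriv ?_
  rw [pow_succ]; ring

/-- The logarithmic derivative of a locally uniformly convergent product is taken factor by factor,
and each factor yields the geometric series Li₀. -/
theorem logDeriv_thetaProd {v τ : ℂ} (hτ : 0 < τ.im) (hv : 0 < (v + Real.pi * τ).im) :
    thetaProd v τ ≠ 0 ∧
    logDeriv (fun v => thetaProd v τ) v = -(2 * Complex.I) * polylogSum 0 (v + Real.pi * τ, τ) := by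
  have him : ∀ n : ℕ, 0 < (v + (n + 1 : ℕ) * (Real.pi * τ)).im := fun n => by
    have := im_add_pos hv hτ n
    rw [show v + (n + 1 : ℕ) * (Real.pi * τ) = v + Real.pi * τ + n * (Real.pi * τ) by
      push_cast; ring]
    exact this
  have hfac : ∀ n : ℕ, 1 + -(nome τ ^ (2 * (n + 1)) * Complex.exp (2 * Complex.I * v)) ≠ 0 := by
    intro n h
    rw [nome_pow_mul_exp, ← sub_eq_add_neg, sub_eq_zero] at h
    have h1 := congrArg norm h
    rw [norm_exp_two_I_mul, norm_one] at h1
    exact (exp_neg_two_mul_lt_one (him n)).ne' h1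
  have hne : thetaProd v τ ≠ 0 := by
    rw [thetaProd_eq]
    exact tprod_one_add_ne_zero_of_summable hfac (summable_nome_pow_mul hτ _)
  refine ⟨hne, ?_⟩
  have hterm : ∀ n : ℕ, logDeriv (fun v => 1 + -(nome τ ^ (2 * (n + 1)) *
      Complex.exp (2 * Complex.I * v))) v =
      -(2 * Complex.I) * polylogExp 0 (v + Real.pi * τ + n * (Real.pi * τ)) := by
    intro n
    have e : HasDerivAt (fun w : ℂ => Complex.exp (2 * Complex.I * w))
        (Complex.exp (2 * Complex.I * v) * (2 * Complex.I)) v := by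
      simpa using ((hasDerivAt_id v).const_mul (2 * Complex.I)).cexp
    have e2 := (((e.const_mul (nome τ ^ (2 * (n + 1)))).fun_neg).const_add 1).deriv
    have e3 : v + Real.pi * τ + n * (Real.pi * τ) = v + (n + 1 : ℕ) * (Real.pi * τ) := by
      push_cast; ring
    rw [logDeriv_apply, e2, e3, polylogExp_zero (him n), ← nome_pow_mul_exp, ← sub_eq_add_neg]
    ring
  obtain ⟨ρ, hρ, hρ1⟩ := exists_between (norm_nome_lt_one hτ)
  -- The first condition does not involve w; it is kept so that this set is the slice at τ of the
  -- two-variable domain of convergence.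
  have hU : IsOpen {w : ℂ | ‖nome τ‖ < ρ ∧
      ‖Complex.exp (2 * Complex.I * w)‖ < ‖Complex.exp (2 * Complex.I * v)‖ + 1} :=
    isOpen_const.inter (isOpen_lt (by fun_prop : Continuous fun w : ℂ =>
      ‖Complex.exp (2 * Complex.I * w)‖) continuous_const)
  have hm : MultipliableLocallyUniformlyOn (fun (n : ℕ) (w : ℂ) =>
      1 + -(nome τ ^ (2 * (n + 1)) * Complex.exp (2 * Complex.I * w)))
      {w : ℂ | ‖nome τ‖ < ρ ∧
        ‖Complex.exp (2 * Complex.I * w)‖ < ‖Complex.exp (2 * Complex.I * v)‖ + 1} := by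
    refine HasProdLocallyUniformlyOn.multipliableLocallyUniformlyOn
      (g := fun w => thetaProd w τ) ?_
    have := TendstoLocallyUniformlyOn.comp (hasProdLocallyUniformlyOn_theta
      (R := ‖Complex.exp (2 * Complex.I * v)‖ + 1) hρ1) (fun w : ℂ => (w, τ))
      (t := {w : ℂ | ‖nome τ‖ < ρ ∧
        ‖Complex.exp (2 * Complex.I * w)‖ < ‖Complex.exp (2 * Complex.I * v)‖ + 1})
      (fun w hw => hw) (by fun_prop)
    rw [hasProdLocallyUniformlyOn_iff_tendstoLocallyUniformlyOn]
    convert this using 1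
    · ext s w; simp
    · ext w; simp [thetaProd_eq]
  simp only [thetaProd_eq] at hne ⊢
  rw [logDeriv_tprod_eq_tsum hU (x := v) ⟨hρ, lt_add_one ‖_‖⟩ hfac (fun n => by fun_prop) ?_ hm hne]
  · simp only [hterm, tsum_mul_left, polylogSum]
  · simp only [hterm]
    exact (summable_polylogSum 0 (x := (v + Real.pi * τ, τ)) hv hτ).mul_left _

/-- In log ϑ₁ the sine contributes -i and the n = 0 term of the first sum, and the two products
contribute the remaining terms. The -i is 2i times the leading term -½ of Λ₀. -/
theorem thetaZeta_eq_lambdaSeries {x : ℂ × ℂ} (hx : x ∈ lambdaStrip) :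
    thetaZeta x.1 x.2 = 2 * Complex.I * lambdaSeries 0 x := by
  obtain ⟨v, τ⟩ := x
  have hτ : 0 < τ.im := im_pos_of_mem_lambdaStrip hx
  have hv : 0 < v.im := hx.1
  have hr : 0 < (Real.pi * τ - v).im := im_reflect_pos hx
  have hv' : 0 < (v + Real.pi * τ).im := by simpa using im_add_pos hv hτ 1
  obtain ⟨hn1, hl1⟩ := logDeriv_thetaProd hτ hv'
  obtain ⟨hn2, hl2⟩ := logDeriv_thetaProd (v := -v) hτ (by rwa [neg_add_eq_sub])
  obtain ⟨hn3, -⟩ := logDeriv_thetaProd (v := 0) hτ (by simpa using mul_pos Real.pi_pos hτ)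
  have hE : 1 - Complex.exp (2 * Complex.I * v) ≠ 0 := by
    intro h
    have h1 := congrArg norm (sub_eq_zero.1 h)
    rw [norm_exp_two_I_mul, norm_one] at h1
    exact (exp_neg_two_mul_lt_one hv).ne h1.symm
  have hsin : Complex.sin v ≠ 0 := by
    rw [sin_eq_exp]
    have := Complex.exp_ne_zero (-(Complex.I * v))
    simp [hE]
  have d1 := differentiable_thetaProd hτ
  have d2 : Differentiable ℂ fun v => thetaProd (-v) τ := d1.comp differentiable_neg
  have hl3 : logDeriv (fun v => thetaProd (-v) τ) v = -logDeriv (fun v => thetaProd v τ) (-v) := by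
    rw [logDeriv_apply, logDeriv_apply, deriv_comp_neg (fun v => thetaProd v τ), neg_div]
  have hsum : polylogSum 0 (v, τ) = polylogExp 0 v + polylogSum 0 (v + Real.pi * τ, τ) := by
    have := (summable_polylogSum 0 (x := (v, τ)) hv hτ).tsum_eq_zero_add
    simp only [polylogSum]
    rw [this]
    congr 1
    · simp
    · congr 1; ext n; congr 1; push_cast; ring
  have hcot : logDeriv Complex.sin v = -Complex.I - 2 * Complex.I * polylogExp 0 v := by
    rw [logDeriv_apply, Complex.deriv_sin, polylogExp_zero hv, div_eq_iff hsin, sin_eq_exp,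
      Complex.cos]
    have h : Complex.exp (2 * Complex.I * v) =
        Complex.exp (v * Complex.I) * Complex.exp (v * Complex.I) := by
      rw [← Complex.exp_add]; congr 1; ring
    rw [h] at hE ⊢
    rw [show -(Complex.I * v) = -(v * Complex.I) by ring, neg_mul, Complex.exp_neg]
    have := Complex.exp_ne_zero (v * Complex.I)
    rw [← pow_two] at hE ⊢
    field_simp
    ring
  have hθ : (fun v => theta1 v τ) = fun v => (2 * thetaProd 0 τ *
      Complex.exp (Real.pi * Complex.I * τ / 4)) *
        (Complex.sin v * (thetaProd v τ * thetaProd (-v) τ)) := by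
    ext v; rw [theta1_eq]; ring
  have hl : thetaZeta v τ = logDeriv Complex.sin v + (logDeriv (fun v => thetaProd v τ) v +
      logDeriv (fun v => thetaProd (-v) τ) v) := by
    rw [thetaZeta, hθ, logDeriv_const_mul _ _ (by simp [hn3]),
      logDeriv_mul (f := Complex.sin) (g := fun v => thetaProd v τ * thetaProd (-v) τ) v hsin
        (mul_ne_zero hn1 hn2) Complex.differentiableAt_sin ((d1 v).mul (d2 v)),
      logDeriv_mul (f := fun v => thetaProd v τ) (g := fun v => thetaProd (-v) τ) v hn1 hn2
        (d1 v) (d2 v)]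
  rw [hl, hl3, hcot, hl1, hl2, lambdaSeries_eq, hsum]
  simp only [pow_zero, Nat.factorial_zero, Nat.cast_one, div_one, neg_add_eq_sub]
  ring

end JacobiDual
end

noncomputable section
namespace JacobiDual
open Set Metric

/-! ### Analytic continuation of `Λ₃` -/

/-- The partial derivative with respect to the first of two variables. -/
def dfst (f : ℂ × ℂ → ℂ) (y : ℂ × ℂ) : ℂ := deriv (fun z => f (z, y.2)) y.1

theorem dfst_eq_fderiv {f : ℂ × ℂ → ℂ} {x : ℂ × ℂ} (hf : DifferentiableAt ℂ f x) :
    dfst f x = fderiv ℂ f x (1, 0) := by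
  have h : HasDerivAt (fun z : ℂ => (z, x.2)) (1, 0) x.1 :=
    (hasDerivAt_id x.1).prodMk (hasDerivAt_const x.1 x.2)
  exact (hf.hasFDerivAt.comp_hasDerivAt_of_eq x.1 h rfl).deriv

theorem _root_.AnalyticAt.dfst {f : ℂ × ℂ → ℂ} {x : ℂ × ℂ} (hf : AnalyticAt ℂ f x) :
    AnalyticAt ℂ (JacobiDual.dfst f) x := by
  have h : AnalyticAt ℂ (fun y => fderiv ℂ f y (1, 0)) x :=
    ((ContinuousLinearMap.apply ℂ ℂ ((1, 0) : ℂ × ℂ)).analyticAt _).comp hf.fderiv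
  refine h.congr ?_
  filter_upwards [hf.eventually_analyticAt] with y hy
  exact (dfst_eq_fderiv hy.differentiableAt).symm

theorem dfst_congr {f g : ℂ × ℂ → ℂ} {x : ℂ × ℂ} (h : f =ᶠ[𝓝 x] g) :
    dfst f =ᶠ[𝓝 x] dfst g := by
  filter_upwards [h.eventually_nhds] with y hy
  have hc : ContinuousAt (fun z : ℂ => (z, y.2)) y.1 := by fun_prop
  have : (fun z => f (z, y.2)) =ᶠ[𝓝 y.1] fun z => g (z, y.2) := hc.eventually hy
  exact this.deriv_eq

/-- `∂_z³f ϑ₁ + 4 ∂_zϑ₁`, which vanishes if `f` is a branch of `Λ₃`. -/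
def thetaRelation (f : ℂ × ℂ → ℂ) (y : ℂ × ℂ) : ℂ :=
  dfst (dfst (dfst f)) y * theta1 y.1 y.2 + 4 * dfst (fun y => theta1 y.1 y.2) y

theorem analyticAt_thetaRelation {f : ℂ × ℂ → ℂ} {x : ℂ × ℂ} (hf : AnalyticAt ℂ f x)
    (hx : 0 < x.2.im) : AnalyticAt ℂ (thetaRelation f) x :=
  (hf.dfst.dfst.dfst.mul (analyticAt_theta1 hx)).add
    (analyticAt_const.mul (analyticAt_theta1 hx).dfst)

theorem thetaRelation_congr {f g : ℂ × ℂ → ℂ} {x : ℂ × ℂ} (h : f =ᶠ[𝓝 x] g) :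
    thetaRelation f =ᶠ[𝓝 x] thetaRelation g := by
  filter_upwards [dfst_congr (dfst_congr (dfst_congr h))] with y hy
  rw [thetaRelation, thetaRelation, hy]

theorem theta1_ne_zero_of_mem_lambdaStrip {x : ℂ × ℂ} (hx : x ∈ lambdaStrip) :
    theta1 x.1 x.2 ≠ 0 := by
  have hτ := im_pos_of_mem_lambdaStrip hx
  rw [Ne, theta1_eq_zero_iff hτ]
  rintro ⟨m, n, h⟩
  have him : x.1.im = n * (Real.pi * x.2.im) := by rw [h]; simp
  have hp : 0 < Real.pi * x.2.im := by positivity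
  have h1 := hx.1
  have h2 := hx.2
  rw [him] at h1 h2
  have h3 : (0 : ℝ) < n := pos_of_mul_pos_left h1 hp.le
  have h4 : (n : ℝ) < 1 := by
    by_contra hn
    exact h2.not_ge (le_mul_of_one_le_left hp.le (not_lt.1 hn))
  have h3' : (0 : ℤ) < n := by exact_mod_cast h3
  have h4' : n < (1 : ℤ) := by exact_mod_cast h4
  omega

theorem dfst_lambdaSeries (N : ℕ) {x : ℂ × ℂ} (hx : x ∈ lambdaStrip) :
    dfst (lambdaSeries (N + 1)) x = 2 * Complex.I * lambdaSeries N x :=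
  (hasDerivAt_lambdaSeries N hx).deriv

theorem dfst_const_mul (c : ℂ) (f : ℂ × ℂ → ℂ) (x : ℂ × ℂ) :
    dfst (fun y => c * f y) x = c * dfst f x := deriv_const_mul_field c

theorem thetaRelation_lambdaSeries {x : ℂ × ℂ} (hx : x ∈ lambdaStrip) :
    thetaRelation (lambdaSeries 3) =ᶠ[𝓝 x] 0 := by
  have hev : ∀ N, dfst (lambdaSeries (N + 1)) =ᶠ[𝓝 x] fun y => 2 * Complex.I * lambdaSeries N y := by
    intro N
    filter_upwards [isOpen_lambdaStrip.mem_nhds hx] with y hy using dfst_lambdaSeries N hy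
  filter_upwards [isOpen_lambdaStrip.mem_nhds hx, dfst_congr (dfst_congr (hev 2)),
    (dfst_congr (hev 1)), hev 0] with y hy h1 h2 h3
  have h4 : ∀ f : ℂ × ℂ → ℂ, dfst (dfst fun y => 2 * Complex.I * f y) y =
      2 * Complex.I * dfst (dfst f) y := fun f => by
    rw [← dfst_const_mul]
    congr 1; ext w; exact dfst_const_mul _ _ _
  have hθ := theta1_ne_zero_of_mem_lambdaStrip hy
  have hz := thetaZeta_eq_lambdaSeries hy
  have h5 : dfst (fun y => theta1 y.1 y.2) y = thetaZeta y.1 y.2 * theta1 y.1 y.2 :=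
    (div_mul_cancel₀ _ hθ).symm
  rw [thetaRelation, h1, h4, h2, dfst_const_mul, h3, h5, hz]
  simp only [Pi.zero_apply]
  linear_combination 8 * Complex.I * lambdaSeries 0 y * theta1 y.1 y.2 * Complex.I_sq

/-- Permanence of functional relations. Multiplying by ϑ₁ makes the relation analytic at every point
of the path, so lattice points need no separate discussion. -/
theorem IsLambdaGerm.thetaRelation_eq {f : ℂ × ℂ → ℂ} {x : ℂ × ℂ} (h : IsLambdaGerm 3 f x) :
    0 < x.2.im ∧ AnalyticAt ℂ f x ∧ thetaRelation f =ᶠ[𝓝 x] 0 := by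
  obtain ⟨γ, g, hγ, h0, h1, han, hloc, hg0, hg1⟩ := h
  have hI1 : (1 : ℝ) ∈ Icc (0 : ℝ) 1 := ⟨zero_le_one, le_rfl⟩
  have hI0 : (0 : ℝ) ∈ Icc (0 : ℝ) 1 := ⟨le_rfl, zero_le_one⟩
  have key : (thetaRelation (g 0) =ᶠ[𝓝 (γ 0)] 0) ↔ (thetaRelation (g 1) =ᶠ[𝓝 (γ 1)] 0) := by
    -- The truth of the relation is locally constant along the path: nearby function elements agree,
    -- and on a ball the identity theorem moves the vanishing between γ(s) and γ(t) in both
    -- directions.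
    refine isPreconnected_Icc.induction₂ (fun s t => (thetaRelation (g s) =ᶠ[𝓝 (γ s)] 0) ↔
      (thetaRelation (g t) =ᶠ[𝓝 (γ t)] 0)) (fun t ht => ?_) (fun _ _ _ _ _ _ => Iff.trans)
      (fun _ _ _ _ => Iff.symm) hI0 hI1
    obtain ⟨r, hr, hball⟩ := Metric.eventually_nhds_iff_ball.1
      (analyticAt_thetaRelation (han t ht).2 (han t ht).1).eventually_analyticAt
    filter_upwards [hloc t ht, (hγ t ht).eventually (ball_mem_nhds _ hr)] with s hs hsb
    have hc := (convex_ball (γ t) r).isPreconnected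
    have e : thetaRelation (g s) =ᶠ[𝓝 (γ s)] 0 ↔ thetaRelation (g t) =ᶠ[𝓝 (γ s)] 0 :=
      ⟨fun h => (thetaRelation_congr hs).symm.trans h, fun h => (thetaRelation_congr hs).trans h⟩
    rw [e]
    have hA : AnalyticOnNhd ℂ (thetaRelation (g t)) (ball (γ t) r) := hball
    constructor
    · intro h
      exact (hA.eqOn_zero_of_preconnected_of_eventuallyEq_zero hc (mem_ball_self hr)
        h).eventuallyEq_of_mem (isOpen_ball.mem_nhds hsb)
    · intro h
      exact (hA.eqOn_zero_of_preconnected_of_eventuallyEq_zero hc hsb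
        h).eventuallyEq_of_mem (ball_mem_nhds _ hr)
  have hR := key.1 ((thetaRelation_congr hg0).trans (thetaRelation_lambdaSeries h0))
  have hA := han 1 hI1
  rw [h1] at hR hA
  exact ⟨hA.1, hA.2.congr hg1, (thetaRelation_congr hg1).symm.trans hR⟩

/-- The third derivative of every branch of `Λ₃` is `-4 ϑ₁'/ϑ₁`. -/
theorem IsLambdaGerm.dfst_dfst_dfst {f : ℂ × ℂ → ℂ} {x : ℂ × ℂ} (h : IsLambdaGerm 3 f x)
    (hx : x.1 ∉ periodLattice x.2) : dfst (dfst (dfst f)) x = -4 * thetaZeta x.1 x.2 := by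
  obtain ⟨hτ, -, hR⟩ := h.thetaRelation_eq
  have hθ : theta1 x.1 x.2 ≠ 0 := by rwa [Ne, theta1_eq_zero_iff hτ]
  have h0 := hR.self_of_nhds
  rw [thetaRelation, Pi.zero_apply] at h0
  have h5 : dfst (fun y => theta1 y.1 y.2) x = thetaZeta x.1 x.2 * theta1 x.1 x.2 :=
    (div_mul_cancel₀ _ hθ).symm
  rw [h5] at h0
  refine mul_right_cancel₀ hθ ?_
  linear_combination h0

theorem analyticAt_thetaZeta_prod {x : ℂ × ℂ} (hτ : 0 < x.2.im) (hx : theta1 x.1 x.2 ≠ 0) :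
    AnalyticAt ℂ (fun x : ℂ × ℂ => thetaZeta x.1 x.2) x :=
  (analyticAt_theta1 hτ).dfst.div (analyticAt_theta1 hτ) hx

/-- The start point ranges over the midline of the strip. Each of the countably many lattice points
rules out at most one start point, and the line is uncountable. -/
theorem exists_segment_avoiding {z τ : ℂ} (hτ : 0 < τ.im) (hz : z ∉ periodLattice τ) :
    ∃ a, (a, τ) ∈ lambdaStrip ∧ ∀ w ∈ segment ℝ a z, w ∉ periodLattice τ := by
  obtain ⟨c, hc⟩ : ∃ c : ℝ, c = Real.pi * τ.im / 2 := ⟨_, rfl⟩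
  have hp : 0 < Real.pi * τ.im := by positivity
  -- The real part at which the line from z through the lattice point crosses height c. If the
  -- denominator is 0 the value is arbitrary, and that case is excluded below.
  let bad : ℤ × ℤ → ℝ := fun k => (z + ((c - z.im) / ((k.2 : ℝ) * (Real.pi * τ.im) - z.im) : ℝ) *
    ((k.1 : ℂ) * Real.pi + k.2 * (Real.pi * τ) - z)).re
  obtain ⟨r, hr⟩ : ∃ r : ℝ, r ∉ range bad := by
    by_contra! h
    exact Set.not_countable_univ ((countable_range bad).mono fun r _ => h r)
  have hstrip : ((⟨r, c⟩ : ℂ), τ) ∈ lambdaStrip := by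
    constructor
    · change 0 < c; linarith
    · change c < Real.pi * τ.im; linarith
  refine ⟨⟨r, c⟩, hstrip, fun w hw hL => ?_⟩
  rw [segment_symm, segment_eq_image'] at hw
  obtain ⟨t, ht, rfl⟩ := hw
  have ht0 : t ≠ 0 := fun h => hz (by simpa [h] using hL)
  obtain ⟨m, n, h⟩ := hL
  have him : z.im + t * (c - z.im) = n * (Real.pi * τ.im) := by
    simpa using congrArg Complex.im h
  -- Otherwise the segment would be horizontal at height c, half of π Im τ, where there are no
  -- lattice points.
  have hne : (n : ℝ) * (Real.pi * τ.im) - z.im ≠ 0 := by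
    intro h0
    have h1 : t * (c - z.im) = 0 := by linarith
    have h2 : c = z.im := by
      rcases mul_eq_zero.1 h1 with h | h
      · exact absurd h ht0
      · linarith
    refine theta1_ne_zero_of_mem_lambdaStrip hstrip ?_
    exfalso
    have h3 : (n : ℝ) * 2 = 1 := by
      have : (n : ℝ) * (Real.pi * τ.im) = Real.pi * τ.im / 2 := by linarith
      field_simp at this
      linarith
    have h4 : n * 2 = 1 := by exact_mod_cast h3
    omega
  apply hr
  refine ⟨(m, n), ?_⟩
  have hw : (m : ℂ) * Real.pi + n * (Real.pi * τ) - z = t • ((⟨r, c⟩ : ℂ) - z) := by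
    rw [← h]; ring
  have ht' : (c - z.im) / ((n : ℝ) * (Real.pi * τ.im) - z.im) * t = 1 := by
    rw [div_mul_eq_mul_div, div_eq_one_iff_eq hne]; linarith
  simp only [bad, hw]
  rw [Complex.real_smul, ← mul_assoc, ← Complex.ofReal_mul, ht']
  simp

/-- A thickened segment times a small disc is a convex region in z on which ζ is holomorphic and
single-valued. Three successive primitives, each agreeing with the series near the start of the
segment, continue Λ₃ to a neighbourhood of x. -/
theorem exists_lambdaGerm {x : ℂ × ℂ} (hτ : 0 < x.2.im) (hx : x.1 ∉ periodLattice x.2) :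
    ∃ f : ℂ × ℂ → ℂ, ∀ᶠ y in 𝓝 x, IsLambdaGerm 3 f y := by
  obtain ⟨a, ha, hseg⟩ := exists_segment_avoiding hτ hx
  have hΩ : IsOpen {y : ℂ × ℂ | 0 < y.2.im ∧ theta1 y.1 y.2 ≠ 0} := by
    refine isOpen_iff_mem_nhds.2 fun y hy => ?_
    have h1 : ∀ᶠ w : ℂ × ℂ in 𝓝 y, 0 < w.2.im :=
      (isOpen_lt continuous_const (Complex.continuous_im.comp continuous_snd)).mem_nhds hy.1
    have h2 := (analyticAt_theta1 hy.1).continuousAt.eventually_ne hy.2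
    filter_upwards [h1, h2] with w hw1 hw2 using ⟨hw1, hw2⟩
  have hcomp : IsCompact (segment ℝ a x.1) := by
    rw [segment_eq_image']
    exact isCompact_Icc.image (by fun_prop)
  obtain ⟨u, v, hu, hv, hsu, hxv, huv⟩ := generalized_tube_lemma hcomp
    (isCompact_singleton (x := x.2)) hΩ (by
      rintro ⟨w, t⟩ ⟨hw, ht⟩
      obtain rfl : t = x.2 := ht
      exact ⟨hτ, by rw [Ne, theta1_eq_zero_iff hτ]; exact hseg w hw⟩)
  obtain ⟨ε, hε, hεu⟩ := hcomp.exists_thickening_subset_open hu hsu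
  obtain ⟨δ, hδ, hδs⟩ := Metric.isOpen_iff.1 isOpen_lambdaStrip _ ha
  obtain ⟨η, hη, hηv⟩ := Metric.isOpen_iff.1 hv x.2 (hxv rfl)
  rw [← ball_prod_same] at hδs
  obtain ⟨V, hV⟩ : ∃ V, V = thickening ε (segment ℝ a x.1) := ⟨_, rfl⟩
  obtain ⟨V₀, hV₀⟩ : ∃ V₀, V₀ = ball a (min ε δ) := ⟨_, rfl⟩
  obtain ⟨W, hW⟩ : ∃ W, W = ball x.2 (min η δ) := ⟨_, rfl⟩
  have hVo : IsOpen V := hV ▸ isOpen_thickening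
  have hVc : Convex ℝ V := hV ▸ (convex_segment a x.1).thickening ε
  have hV₀o : IsOpen V₀ := hV₀ ▸ isOpen_ball
  have hV₀c : Convex ℝ V₀ := hV₀ ▸ convex_ball _ _
  have hWo : IsOpen W := hW ▸ isOpen_ball
  have hsub : V₀ ⊆ V := by
    rw [hV, hV₀]
    exact (ball_subset_ball (min_le_left _ _)).trans
      (ball_subset_thickening (left_mem_segment ℝ a x.1) ε)
  have haV : a ∈ V₀ := hV₀ ▸ mem_ball_self (lt_min hε hδ)
  have hxW : x.2 ∈ W := hW ▸ mem_ball_self (lt_min hη hδ)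
  have hxV : x.1 ∈ V := hV ▸ self_subset_thickening hε _ (right_mem_segment ℝ a x.1)
  have hstrip : V₀ ×ˢ W ⊆ lambdaStrip := by
    rw [hV₀, hW]
    exact (Set.prod_mono (ball_subset_ball (min_le_right _ _))
      (ball_subset_ball (min_le_right _ _))).trans hδs
  have hΩ' : V ×ˢ W ⊆ {y : ℂ × ℂ | 0 < y.2.im ∧ theta1 y.1 y.2 ≠ 0} := by
    rw [hV, hW]
    exact (Set.prod_mono hεu ((ball_subset_ball (min_le_left _ _)).trans hηv)).trans huv
  have hs : ∀ N, AnalyticOnNhd ℂ (lambdaSeries N) (V₀ ×ˢ W) := fun N y hy =>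
    analyticAt_lambdaSeries N (hstrip hy)
  obtain ⟨G₁, hG₁, -, hG₁s⟩ := exists_extension_primitive_fst hVo hVc hWo hV₀o hV₀c hsub haV
    (Ψ := fun y => thetaZeta y.1 y.2)
    (fun y hy => analyticAt_thetaZeta_prod (hΩ' hy).1 (hΩ' hy).2) (hs 1) (fun y hy => by
      rw [thetaZeta_eq_lambdaSeries (hstrip hy)]; exact hasDerivAt_lambdaSeries 0 (hstrip hy))
  have step : ∀ (N : ℕ) (G : ℂ × ℂ → ℂ), AnalyticOnNhd ℂ G (V ×ˢ W) →
      EqOn G (lambdaSeries N) (V₀ ×ˢ W) → ∃ G' : ℂ × ℂ → ℂ, AnalyticOnNhd ℂ G' (V ×ˢ W) ∧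
        EqOn G' (lambdaSeries (N + 1)) (V₀ ×ˢ W) := by
    intro N G hG hGs
    obtain ⟨G', hG', -, hG's⟩ := exists_extension_primitive_fst hVo hVc hWo hV₀o hV₀c hsub haV
      (Ψ := fun y => 2 * Complex.I * G y) (fun y hy => analyticAt_const.mul (hG y hy)) (hs (N + 1))
      (fun y hy => by rw [hGs hy]; exact hasDerivAt_lambdaSeries N (hstrip hy))
    exact ⟨G', hG', hG's⟩
  obtain ⟨G₂, hG₂, hG₂s⟩ := step 1 G₁ hG₁ hG₁s
  obtain ⟨G, hG, hGs⟩ := step 2 G₂ hG₂ hG₂s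
  refine ⟨G, ?_⟩
  filter_upwards [(hVo.prod hWo).mem_nhds (show x ∈ V ×ˢ W from ⟨hxV, hxW⟩)] with y hy
  have hm : ∀ t ∈ Icc (0 : ℝ) 1, (a + (t : ℂ) * (y.1 - a), y.2) ∈ V ×ˢ W := fun t ht =>
    ⟨by simpa using hVc.add_smul_sub_mem (hsub haV) hy.1 ht, hy.2⟩
  -- One function `G` serves as the function element along the whole straight path, at the fixed
  -- parameter of y.
  refine ⟨fun t => (a + (t : ℂ) * (y.1 - a), y.2), fun _ => G,
    (by fun_prop : Continuous fun t : ℝ => (a + (t : ℂ) * (y.1 - a), y.2)).continuousOn, ?_, by simp,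
    fun t ht => ⟨(hΩ' (hm t ht)).1, hG _ (hm t ht)⟩, fun t _ => Eventually.of_forall fun s => by rfl,
    ?_, by rfl⟩
  · exact hstrip ⟨by simpa using haV, hy.2⟩
  · exact hGs.eventuallyEq_of_mem ((hV₀o.prod hWo).mem_nhds ⟨by simpa using haV, hy.2⟩)

/-! ### The coordinates `zⁱ` and the existence of branches -/

theorem zFull_add {l : ℕ} (z w : Fin l → ℂ) (i : Fin (l + 1)) :
    zFull (z + w) i = zFull z i + zFull w i := by
  refine Fin.cases ?_ (fun i => ?_) i
  · simp [zFull, Finset.sum_add_distrib]; ring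
  · simp [zFull]

theorem zFull_smul {l : ℕ} (c : ℂ) (z : Fin l → ℂ) (i : Fin (l + 1)) :
    zFull (c • z) i = c * zFull z i := by
  refine Fin.cases ?_ (fun i => ?_) i
  · simp [zFull, Finset.mul_sum]
  · simp [zFull]

theorem sum_zFull {l : ℕ} (z : Fin l → ℂ) : ∑ i, zFull z i = 0 := by
  simp [zFull, Fin.sum_univ_succ]

theorem continuous_zFull {l : ℕ} (i : Fin (l + 1)) : Continuous fun z : Fin l → ℂ => zFull z i := by
  refine Fin.cases ?_ (fun i => ?_) i
  · simp only [zFull, Fin.cons_zero]; fun_prop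
  · simp only [zFull, Fin.cons_succ]; fun_prop

theorem exists_branch {l : ℕ} {p : Base l} (hτ : 0 < p.2.im) {w : (Fin l → ℂ) → ℂ}
    (hw : Continuous w) (hp : w p.1 ∉ periodLattice p.2) : ∃ h : Base l → ℂ,
      ∀ᶠ p' in 𝓝 p, ∃ f : ℂ × ℂ → ℂ, IsLambdaGerm 3 f (w p'.1, p'.2) ∧
        h =ᶠ[𝓝 p'] fun p'' => f (w p''.1, p''.2) := by
  obtain ⟨f, hf⟩ := exists_lambdaGerm (x := (w p.1, p.2)) hτ hp
  refine ⟨fun p' => f (w p'.1, p'.2), ?_⟩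
  have hc : ContinuousAt (fun p' : Base l => (w p'.1, p'.2)) p := by fun_prop
  filter_upwards [hc.eventually hf] with p' hp'
  exact ⟨f, hp', by rfl⟩

theorem exists_tempBranch {l : ℕ} {p : Base l} (hp : p ∈ regularBase l) :
    ∃ (U : Set (Base l)) (Ft : Base l → ℂ), IsOpen U ∧ p ∈ U ∧ IsTempBranch U Ft := by
  obtain ⟨hτ, h1, h2⟩ := hp
  have hM : ∀ i, ∃ h : Base l → ℂ, ∀ᶠ p' in 𝓝 p, ∃ f : ℂ × ℂ → ℂ,
      IsLambdaGerm 3 f (zFull p'.1 i, p'.2) ∧ h =ᶠ[𝓝 p'] fun p'' => f (zFull p''.1 i, p''.2) :=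
    fun i => exists_branch hτ (continuous_zFull i) (h1 i)
  have hL : ∀ i j, ∃ h : Base l → ℂ, i ≠ j → ∀ᶠ p' in 𝓝 p, ∃ f : ℂ × ℂ → ℂ,
      IsLambdaGerm 3 f (zFull p'.1 i - zFull p'.1 j, p'.2) ∧
        h =ᶠ[𝓝 p'] fun p'' => f (zFull p''.1 i - zFull p''.1 j, p''.2) := by
    intro i j
    by_cases hij : i = j
    · exact ⟨0, fun h => absurd hij h⟩
    · obtain ⟨h, hh⟩ := exists_branch hτ ((continuous_zFull i).sub (continuous_zFull j)) (h2 i j hij)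
      exact ⟨h, fun _ => hh⟩
  choose M hM using hM
  choose L hL using hL
  have hev := (eventually_all.2 hM).and (eventually_all.2 fun i => eventually_all.2 fun j =>
    eventually_imp_distrib_left.2 (hL i j))
  obtain ⟨U, hU, hUo, hpU⟩ := _root_.mem_nhds_iff.1 hev
  exact ⟨U, _, hUo, hpU, L, M, fun i j hij p hp => (hU hp).2 i j hij, fun i p hp => (hU hp).1 i,
    fun p _ => rfl⟩

end JacobiDual
end

noncomputable section
namespace JacobiDual
open Set Metric

/-! ### Principal parts and residues -/

/-- `h` extends analytically to `v` from a punctured neighbourhood of `v`. -/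
def HasRemovableAt (h : ℂ → ℂ) (v : ℂ) : Prop := ∃ a : ℂ → ℂ, AnalyticAt ℂ a v ∧ h =ᶠ[𝓝[≠] v] a

theorem HasRemovableAt.congr {g h : ℂ → ℂ} {v : ℂ} (hg : HasRemovableAt g v)
    (e : h =ᶠ[𝓝[≠] v] g) : HasRemovableAt h v :=
  let ⟨a, ha, hga⟩ := hg
  ⟨a, ha, e.trans hga⟩

/-- `h` has the principal part `∑_{k < n} c_k (v - p)^{-k-1}` at `p`. -/
def HasPrincipalPart (h : ℂ → ℂ) (p : ℂ) (n : ℕ) (c : ℕ → ℂ) : Prop :=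
  ∃ a : ℂ → ℂ, AnalyticAt ℂ a p ∧
    ∀ᶠ v in 𝓝[≠] p, h v = ∑ k ∈ Finset.range n, c k * ((v - p) ^ (k + 1))⁻¹ + a v

theorem AnalyticAt.eq_add_mul_self {φ : ℂ → ℂ} {p : ℂ} (hφ : AnalyticAt ℂ φ p) :
    ∃ ψ : ℂ → ℂ, AnalyticAt ℂ ψ p ∧ ψ p = deriv φ p ∧ ∀ v, φ v = φ p + (v - p) * ψ v := by
  obtain ⟨q, hq⟩ := hφ
  refine ⟨dslope φ p, ⟨_, hq.has_fpower_series_dslope_fslope⟩, dslope_same _ _, fun v => ?_⟩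
  have := sub_smul_dslope φ p v
  rw [smul_eq_mul] at this
  rw [this]; ring

theorem hasPrincipalPart_of_eq_div {p : ℂ} (n : ℕ) : ∀ {h φ : ℂ → ℂ}, AnalyticAt ℂ φ p →
    (∀ᶠ v in 𝓝[≠] p, h v = φ v / (v - p) ^ n) → ∃ c, HasPrincipalPart h p n c := by
  induction n with
  | zero =>
    intro h φ hφ hh
    exact ⟨0, φ, hφ, by filter_upwards [hh] with v hv; simp [hv]⟩
  | succ n ih =>
    intro h φ hφ hh
    obtain ⟨ψ, hψ, -, hφψ⟩ := AnalyticAt.eq_add_mul_self hφ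
    obtain ⟨c, a, ha, hc⟩ := ih (h := fun v => ψ v / (v - p) ^ n) hψ
      (Eventually.of_forall fun _ => rfl)
    refine ⟨fun k => if k = n then φ p else c k, a, ha, ?_⟩
    filter_upwards [hh, hc, self_mem_nhdsWithin] with v hv hcv hne
    have hvp : v - p ≠ 0 := sub_ne_zero.2 hne
    rw [Finset.sum_range_succ, if_pos rfl]
    have : ∑ k ∈ Finset.range n, (if k = n then φ p else c k) * ((v - p) ^ (k + 1))⁻¹ =
        ∑ k ∈ Finset.range n, c k * ((v - p) ^ (k + 1))⁻¹ :=
      Finset.sum_congr rfl fun k hk => by rw [if_neg (Finset.mem_range.1 hk).ne]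
    rw [this, add_right_comm, ← hcv, hv, hφψ v]
    field_simp
    ring

theorem _root_.MeromorphicAt.exists_hasPrincipalPart {h : ℂ → ℂ} {p : ℂ} (hh : MeromorphicAt h p) :
    ∃ n c, HasPrincipalPart h p (n + 1) c := by
  obtain ⟨n, hn⟩ := hh
  -- The extra factor v - p makes the number of polar coefficients at least one, so that `c 0`, the
  -- residue, is always among them.
  have h1 : AnalyticAt ℂ (fun v => (v - p) * ((v - p) ^ n * h v)) p :=
    AnalyticAt.mul (by fun_prop) hn
  refine ⟨n, hasPrincipalPart_of_eq_div (n + 1) h1 ?_⟩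
  filter_upwards [self_mem_nhdsWithin] with v hne
  have hvp : v - p ≠ 0 := sub_ne_zero.2 hne
  field_simp
  ring

theorem HasPrincipalPart.residue_eq {h : ℂ → ℂ} {p : ℂ} {n : ℕ} {c : ℕ → ℂ}
    (hh : HasPrincipalPart h p (n + 1) c) : residue h p = c 0 := by
  obtain ⟨a, ha, hc⟩ := hh
  have hev : ∀ᶠ v in 𝓝 p, AnalyticAt ℂ a v ∧ (v ≠ p →
      h v = ∑ k ∈ Finset.range (n + 1), c k * ((v - p) ^ (k + 1))⁻¹ + a v) :=
    ha.eventually_analyticAt.and (eventually_nhdsWithin_iff.1 hc)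
  obtain ⟨ε, hε, hball⟩ := Metric.eventually_nhds_iff_ball.1 hev
  refine Tendsto.limUnder_eq (tendsto_const_nhds.congr' ?_)
  filter_upwards [Ioo_mem_nhdsGT hε] with r hr
  have hr0 : 0 < r := hr.1
  have hsub : closedBall p r ⊆ ball p ε := closedBall_subset_ball hr.2
  have hac : ContinuousOn a (closedBall p r) := fun v hv =>
    (hball v (hsub hv)).1.continuousAt.continuousWithinAt
  have hne : ∀ v ∈ sphere p r, v ≠ p := fun v hv => ne_of_mem_sphere hv hr0.ne'
  have h1 : (∮ v in C(p, r), h v) =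
      ∮ v in C(p, r), (∑ k ∈ Finset.range (n + 1), c k * ((v - p) ^ (k + 1))⁻¹) + a v :=
    circleIntegral.integral_congr hr0.le fun v hv =>
      (hball v (hsub (sphere_subset_closedBall hv))).2 (hne v hv)
  have hint : ∀ k : ℕ, CircleIntegrable (fun v => c k * ((v - p) ^ (k + 1))⁻¹) p r := fun k =>
    ContinuousOn.circleIntegrable hr0.le (continuousOn_const.mul
      (ContinuousOn.inv₀ (by fun_prop) fun v hv => pow_ne_zero _ (sub_ne_zero.2 (hne v hv))))
  have h2 : (∮ v in C(p, r), a v) = 0 :=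
    Complex.circleIntegral_eq_zero_of_differentiable_on_off_countable hr0.le countable_empty hac
      fun v hv => (hball v (hsub (ball_subset_closedBall hv.1))).1.differentiableAt
  have h3 : ∀ k : ℕ, k ≠ 0 → (∮ v in C(p, r), c k * ((v - p) ^ (k + 1))⁻¹) = 0 := fun k hk => by
    rw [circleIntegral.integral_const_mul]
    have : (fun v : ℂ => ((v - p) ^ (k + 1))⁻¹) = fun v => (v - p) ^ (-(k + 1 : ℕ) : ℤ) := by
      ext v; rw [zpow_neg, zpow_natCast]
    rw [this, circleIntegral.integral_sub_zpow_of_ne (by omega), mul_zero]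
  have hsum : CircleIntegrable
      (fun v => ∑ k ∈ Finset.range (n + 1), c k * ((v - p) ^ (k + 1))⁻¹) p r := by
    have := CircleIntegrable.sum (Finset.range (n + 1)) fun k _ => hint k
    rwa [Finset.sum_fn] at this
  rw [h1, circleIntegral.integral_add hsum (hac.mono sphere_subset_closedBall |>.circleIntegrable hr0.le), h2, add_zero,
    circleIntegral.integral_fun_sum fun k _ => hint k, Finset.sum_range_succ',
    Finset.sum_eq_zero fun k _ => h3 (k + 1) (Nat.succ_ne_zero k), zero_add,
    circleIntegral.integral_const_mul]
  simp only [zero_add, pow_one]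
  rw [circleIntegral.integral_sub_center_inv p hr0.ne', mul_comm (c 0), ← mul_assoc,
    inv_mul_cancel₀ Complex.two_pi_I_ne_zero, one_mul]

theorem residue_eq_deriv {h φ : ℂ → ℂ} {p : ℂ} (hφ : AnalyticAt ℂ φ p)
    (hh : ∀ᶠ v in 𝓝[≠] p, h v = φ v / (v - p) ^ 2) : residue h p = deriv φ p := by
  obtain ⟨ψ, hψ, hψ0, hφψ⟩ := AnalyticAt.eq_add_mul_self hφ
  obtain ⟨χ, hχ, -, hψχ⟩ := AnalyticAt.eq_add_mul_self hψ
  have : HasPrincipalPart h p (1 + 1) (fun k => if k = 0 then ψ p else φ p) := by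
    refine ⟨χ, hχ, ?_⟩
    filter_upwards [hh, self_mem_nhdsWithin] with v hv hne
    have hvp : v - p ≠ 0 := sub_ne_zero.2 hne
    rw [hv, hφψ v, hψχ v]
    simp [Finset.sum_range_succ]
    field_simp
    ring
  rw [this.residue_eq, ← hψ0, if_pos rfl]

theorem residue_congr {g h : ℂ → ℂ} {p : ℂ} (e : g =ᶠ[𝓝[≠] p] h) : residue g p = residue h p := by
  obtain ⟨ε, hε, hball⟩ := Metric.eventually_nhds_iff_ball.1 (eventually_nhdsWithin_iff.1 e)
  unfold residue limUnder
  congr 1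
  refine Filter.map_congr ?_
  filter_upwards [Ioo_mem_nhdsGT hε] with r hr
  congr 1
  exact circleIntegral.integral_congr hr.1.le fun v hv =>
    hball v (closedBall_subset_ball hr.2 (sphere_subset_closedBall hv)) (ne_of_mem_sphere hv hr.1.ne')

/-! ### Elliptic functions -/

theorem tendsto_add_const_nhdsNE (c v : ℂ) :
    Tendsto (fun w : ℂ => w + c) (𝓝[≠] v) (𝓝[≠] (v + c)) := by
  refine tendsto_nhdsWithin_iff.2 ⟨((continuous_add_const c).tendsto v).mono_left
    nhdsWithin_le_nhds, ?_⟩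
  filter_upwards [self_mem_nhdsWithin] with w hw
  simpa using hw

theorem HasRemovableAt.comp_add {g : ℂ → ℂ} {c v : ℂ} (hg : HasRemovableAt g (v + c)) :
    HasRemovableAt (fun w => g (w + c)) v := by
  obtain ⟨a, ha, hga⟩ := hg
  refine ⟨fun w => a (w + c), ha.comp_of_eq (f := fun w => w + c) (by fun_prop) rfl, ?_⟩
  exact (tendsto_add_const_nhdsNE c v).eventually hga

theorem HasRemovableAt.add_const {g : ℂ → ℂ} {v : ℂ} (hg : HasRemovableAt g v) (c : ℂ) :
    HasRemovableAt (fun w => g w + c) v := by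
  obtain ⟨a, ha, hga⟩ := hg
  refine ⟨fun w => a w + c, ha.add analyticAt_const, ?_⟩
  filter_upwards [hga] with w hw
  rw [hw]

theorem hasRemovableAt_iff_add {g : ℂ → ℂ} {c d : ℂ}
    (h : ∀ v, ∀ᶠ w in 𝓝[≠] v, g (w + c) = g w + d) (v : ℂ) :
    HasRemovableAt g v ↔ HasRemovableAt g (v + c) := by
  constructor
  · intro hg
    have h1 : HasRemovableAt (fun w => g (w + -c)) (v + c) := by
      refine HasRemovableAt.comp_add ?_
      rwa [add_neg_cancel_right]
    refine (h1.add_const d).congr ?_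
    have h2 : ∀ᶠ w in 𝓝[≠] (v + c), g (w + -c + c) = g (w + -c) + d :=
      (tendsto_add_const_nhdsNE (-c) (v + c)).eventually (h _)
    filter_upwards [h2] with w hw
    rwa [neg_add_cancel_right] at hw
  · intro hg
    refine (hg.comp_add.add_const (-d)).congr ?_
    filter_upwards [h v] with w hw
    rw [hw]; ring

theorem eq_of_eventuallyEq_nhdsNE {a b : ℂ → ℂ} {v : ℂ} (ha : ContinuousAt a v)
    (hb : ContinuousAt b v) (h : a =ᶠ[𝓝[≠] v] b) : a v = b v :=
  tendsto_nhds_unique ((ha.tendsto.mono_left nhdsWithin_le_nhds).congr' h)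
    (hb.tendsto.mono_left nhdsWithin_le_nhds)

/-- The local extensions are glued along the diagonal w ↦ A w w: two of them agree on a punctured
neighbourhood, hence at the centre by continuity. Values of `g` at the exceptional points play no
role. -/
theorem exists_entire_of_removable {g : ℂ → ℂ} (hg : ∀ v, HasRemovableAt g v) :
    ∃ G : ℂ → ℂ, Differentiable ℂ G ∧ ∀ v, g =ᶠ[𝓝[≠] v] G := by
  choose A hA hgA using hg
  have key : ∀ v, (fun w => A w w) =ᶠ[𝓝 v] A v := by
    intro v
    have h1 : ∀ᶠ w in 𝓝 v, AnalyticAt ℂ (A v) w ∧ (w ≠ v → ∀ᶠ y in 𝓝 w, y ≠ v → g y = A v y) :=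
      (hA v).eventually_analyticAt.and
        ((eventually_nhdsWithin_iff.1 (hgA v)).eventually_nhds.mono fun w hw _ => hw)
    filter_upwards [h1] with w hw
    by_cases hwv : w = v
    · rw [hwv]
    · refine eq_of_eventuallyEq_nhdsNE (hA w).continuousAt hw.1.continuousAt ?_
      filter_upwards [hgA w, nhdsWithin_le_nhds (hw.2 hwv),
        nhdsWithin_le_nhds (isOpen_ne.mem_nhds hwv)] with y h2 h3 h4
      rw [← h2, h3 h4]
  refine ⟨fun w => A w w, fun v => (hA v).differentiableAt.congr_of_eventuallyEq (key v),
    fun v => ?_⟩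
  filter_upwards [hgA v, nhdsWithin_le_nhds (key v)] with w h1 h2
  rw [h1, h2]

theorem exists_mem_periodCell {τ : ℂ} (hτ : 0 < τ.im) (v : ℂ) :
    ∃ w ∈ periodCell τ, w - v ∈ periodLattice τ := by
  obtain ⟨t, ht⟩ : ∃ t : ℝ, t = v.im / (Real.pi * τ.im) := ⟨_, rfl⟩
  obtain ⟨s, hs⟩ : ∃ s : ℝ, s = (v.re - t * (Real.pi * τ.re)) / Real.pi := ⟨_, rfl⟩
  have hv : v = s * Real.pi + t * (Real.pi * τ) := by
    have h1 : t * (Real.pi * τ.im) = v.im := by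
      rw [ht]; field_simp
    have h2 : s * Real.pi = v.re - t * (Real.pi * τ.re) := by rw [hs]; field_simp
    apply Complex.ext
    · simp [h2]
    · simp [h1]
  refine ⟨Int.fract s * Real.pi + Int.fract t * (Real.pi * τ), ⟨Int.fract s, Int.fract t,
    ⟨Int.fract_nonneg _, Int.fract_lt_one _⟩, ⟨Int.fract_nonneg _, Int.fract_lt_one _⟩, rfl⟩,
    -⌊s⌋, -⌊t⌋, ?_⟩
  rw [hv, ← Int.self_sub_floor, ← Int.self_sub_floor]
  push_cast; ring

theorem periodCell_subset_isCompact (τ : ℂ) : ∃ K : Set ℂ, IsCompact K ∧ periodCell τ ⊆ K := by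
  refine ⟨(fun x : ℝ × ℝ => (x.1 : ℂ) * Real.pi + x.2 * (Real.pi * τ)) '' (Icc 0 1 ×ˢ Icc 0 1),
    (isCompact_Icc.prod isCompact_Icc).image (by fun_prop), ?_⟩
  rintro w ⟨s, t, hs, ht, rfl⟩
  exact ⟨(s, t), ⟨Ico_subset_Icc_self hs, Ico_subset_Icc_self ht⟩, rfl⟩

/-- The elliptic-type function `(-1)^k ζ^(k) / k!` with `ζ = ϑ₁'/ϑ₁`, whose principal part at `0` is
`v^{-k-1}`. -/
def zetaPole (τ : ℂ) : ℕ → ℂ → ℂ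
  | 0 => fun v => thetaZeta v τ
  | k + 1 => fun v => -deriv (zetaPole τ k) v / (k + 1)

theorem analyticAt_zetaPole {τ : ℂ} (hτ : 0 < τ.im) (k : ℕ) : ∀ {v : ℂ}, v ∉ periodLattice τ →
    AnalyticAt ℂ (zetaPole τ k) v := by
  induction k with
  | zero => exact fun hv => analyticAt_thetaZeta hτ hv
  | succ k ih => exact fun hv => (ih hv).deriv.neg.div_const

theorem zetaPole_add_pi {τ : ℂ} (k : ℕ) : ∀ v, zetaPole τ k (v + Real.pi) = zetaPole τ k v := by
  induction k with
  | zero => exact fun v => thetaZeta_add_pi v τ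
  | succ k ih =>
    intro v
    simp only [zetaPole]
    rw [← deriv_comp_add_const]
    simp only [ih]

/-- Differentiation kills the constant quasi-period, so only ζ itself, the carrier of residues, sees
it. -/
theorem zetaPole_add_pi_mul {τ : ℂ} (hτ : 0 < τ.im) (k : ℕ) : ∀ {v : ℂ}, v ∉ periodLattice τ →
    zetaPole τ k (v + Real.pi * τ) = zetaPole τ k v - if k = 0 then 2 * Complex.I else 0 := by
  induction k with
  | zero => exact fun hv => thetaZeta_add_pi_mul hτ hv
  | succ k ih =>
    intro v hv
    simp only [zetaPole]
    rw [← deriv_comp_add_const]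
    have : (fun w => zetaPole τ k (w + Real.pi * τ)) =ᶠ[𝓝 v]
        fun w => zetaPole τ k w - if k = 0 then 2 * Complex.I else 0 := by
      filter_upwards [(isClosed_periodLattice hτ).isOpen_compl.mem_nhds hv] with w hw using ih hw
    rw [this.deriv_eq, deriv_sub_const]
    simp

theorem zetaPole_near_zero {τ : ℂ} (hτ : 0 < τ.im) (k : ℕ) : ∃ a : ℂ → ℂ, AnalyticAt ℂ a 0 ∧
    ∀ᶠ v in 𝓝[≠] 0, zetaPole τ k v = (v ^ (k + 1))⁻¹ + a v := by
  induction k with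
  | zero =>
    obtain ⟨a, ha, -, h⟩ := thetaZeta_near_zero hτ
    exact ⟨a, ha, by simpa [zetaPole] using h⟩
  | succ k ih =>
    obtain ⟨a, ha, h⟩ := ih
    refine ⟨fun v => -deriv a v / (k + 1), ha.deriv.neg.div_const, ?_⟩
    filter_upwards [eventually_eventually_nhdsWithin.2 h, self_mem_nhdsWithin,
      nhdsWithin_le_nhds ha.eventually_analyticAt] with v hv hv0 hav
    have hv0' : v ≠ 0 := hv0
    have h1 : zetaPole τ k =ᶠ[𝓝 v] fun v => (v ^ (k + 1))⁻¹ + a v := by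
      rwa [isOpen_compl_singleton.nhdsWithin_eq hv0] at hv
    have h2 := ((hasDerivAt_pow (k + 1) v).inv (pow_ne_zero _ hv0')).add
      hav.differentiableAt.hasDerivAt
    have h3 : deriv (zetaPole τ k) v = _ := h1.deriv_eq.trans h2.deriv
    simp only [zetaPole]
    rw [h3]
    have h4 : (k : ℂ) + 1 ≠ 0 := Nat.cast_add_one_ne_zero k
    simp only [Nat.add_sub_cancel]
    push_cast
    field_simp
    ring

/-- An entire function with constant quasi-periods `0` and `C` has `C = 0`. -/
theorem quasiPeriod_eq_zero {τ : ℂ} (hτ : 0 < τ.im) {G : ℂ → ℂ} {C : ℂ} (hG : Differentiable ℂ G)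
    (h1 : ∀ v, G (v + Real.pi) = G v) (h2 : ∀ v, G (v + Real.pi * τ) = G v + C) : C = 0 := by
  have d1 : ∀ v, deriv G (v + Real.pi) = deriv G v := fun v => by
    rw [← deriv_comp_add_const]; simp only [h1]
  have d2 : ∀ v, deriv G (v + Real.pi * τ) = deriv G v := fun v => by
    rw [← deriv_comp_add_const]; simp only [h2, deriv_add_const]
  have hd : Differentiable ℂ (deriv G) := fun v => (hG.analyticAt v).deriv.differentiableAt
  obtain ⟨K, hK, hcell⟩ := periodCell_subset_isCompact τ
  -- G' is doubly periodic and entire, hence constant by Liouville. Thus G is affine, the period π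
  -- makes its slope 0, and the second quasi-period is then 0.
  have hb : Bornology.IsBounded (range (deriv G)) := by
    refine (hK.image hd.continuous).isBounded.subset ?_
    rintro _ ⟨v, rfl⟩
    obtain ⟨w, hw, hwv⟩ := exists_mem_periodCell hτ v
    refine ⟨w, hcell hw, ?_⟩
    exact (iff_of_sub_mem_periodLattice (Q := fun w => deriv G w = deriv G v)
      (fun u => by rw [d1]) (fun u => by rw [d2]) hwv).1 rfl
  have hc : ∀ v, deriv G v = deriv G 0 := fun v => hd.apply_eq_apply_of_bounded hb v 0
  have hlin : ∀ v w, G v - deriv G 0 * v = G w - deriv G 0 * w := by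
    have hD : ∀ v, HasDerivAt (fun v => G v - deriv G 0 * v) 0 v := fun v => by
      have := (hG v).hasDerivAt.sub ((hasDerivAt_id v).const_mul (deriv G 0))
      rwa [hc v, mul_one, sub_self] at this
    exact is_const_of_deriv_eq_zero (fun v => (hD v).differentiableAt) fun v => (hD v).deriv
  have e1 := hlin (0 + Real.pi) 0
  rw [h1] at e1
  have e2 : deriv G 0 = 0 := by
    have : deriv G 0 * Real.pi = 0 := by linear_combination -e1
    simpa [Real.pi_ne_zero] using this
  have e3 := hlin (0 + Real.pi * τ) 0
  rw [h2, e2] at e3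
  linear_combination e3

/-- The residues of an elliptic function on the torus sum to zero. -/
theorem sum_residue_eq_zero {τ : ℂ} (hτ : 0 < τ.im) {h : ℂ → ℂ} {S : Finset ℂ}
    (hmer : ∀ s ∈ S, MeromorphicAt h s)
    (hrem : ∀ v, (∀ s ∈ S, v - s ∉ periodLattice τ) → HasRemovableAt h v)
    (hS : ∀ s ∈ S, ∀ s' ∈ S, s ≠ s' → s - s' ∉ periodLattice τ)
    (hper₁ : ∀ v, ∀ᶠ w in 𝓝[≠] v, h (w + Real.pi) = h w)
    (hper₂ : ∀ v, ∀ᶠ w in 𝓝[≠] v, h (w + Real.pi * τ) = h w) : ∑ s ∈ S, residue h s = 0 := by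
  have hpp : ∀ s, ∃ n c, s ∈ S → HasPrincipalPart h s (n + 1) c := fun s => by
    by_cases hs : s ∈ S
    · obtain ⟨n, c, hc⟩ := (hmer s hs).exists_hasPrincipalPart
      exact ⟨n, c, fun _ => hc⟩
    · exact ⟨0, 0, fun h => absurd h hs⟩
  choose n c hc using hpp
  -- Subtracting ζ-functions with the same principal parts leaves an essentially entire function. It
  -- has period π and quasi-period 2i times the sum of the residues, which must therefore vanish.
  obtain ⟨g, hg⟩ : ∃ g : ℂ → ℂ, g = fun v => h v -
    ∑ s ∈ S, ∑ k ∈ Finset.range (n s + 1), c s k * zetaPole τ k (v - s) := ⟨_, rfl⟩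
  have hshift : ∀ v s : ℂ, ∀ᶠ w in 𝓝[≠] v, w - s ∉ periodLattice τ := fun v s =>
    (tendsto_add_const_nhdsNE (-s) v).eventually (eventually_notMem_periodLattice hτ _)
  have g1 : ∀ v, ∀ᶠ w in 𝓝[≠] v, g (w + Real.pi) = g w + 0 := by
    intro v
    filter_upwards [hper₁ v] with w hw
    rw [hg]
    simp only [hw, add_sub_right_comm, zetaPole_add_pi, add_zero]
  have g2 : ∀ v, ∀ᶠ w in 𝓝[≠] v, g (w + Real.pi * τ) = g w + 2 * Complex.I * ∑ s ∈ S, c s 0 := by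
    intro v
    filter_upwards [hper₂ v, (Finset.eventually_all S).2 fun s _ => hshift v s] with w hw hws
    rw [hg]
    simp only [hw, add_sub_right_comm]
    have : ∑ s ∈ S, ∑ k ∈ Finset.range (n s + 1), c s k * zetaPole τ k (w - s + Real.pi * τ) =
        ∑ s ∈ S, ((∑ k ∈ Finset.range (n s + 1), c s k * zetaPole τ k (w - s)) -
          2 * Complex.I * c s 0) := by
      refine Finset.sum_congr rfl fun s hs => ?_
      simp only [zetaPole_add_pi_mul hτ _ (hws s hs), mul_sub, Finset.sum_sub_distrib]
      congr 1
      simp [mul_comm]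
    rw [this, Finset.sum_sub_distrib, ← Finset.mul_sum]
    ring
  have hE : ∀ v, (∀ s ∈ S, v - s ∉ periodLattice τ) → ∀ s ∈ S, AnalyticAt ℂ
      (fun v => ∑ k ∈ Finset.range (n s + 1), c s k * zetaPole τ k (v - s)) v := by
    intro v hv s hs
    refine Finset.analyticAt_fun_sum _ fun k _ => analyticAt_const.mul ?_
    exact (analyticAt_zetaPole hτ k (hv s hs)).comp_of_eq (f := fun v => v - s) (by fun_prop) rfl
  have hgood : ∀ v, HasRemovableAt g v := by
    intro v
    by_cases hv : ∃ s ∈ S, v - s ∈ periodLattice τ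
    · obtain ⟨s, hs, hvs⟩ := hv
      refine (iff_of_sub_mem_periodLattice (hasRemovableAt_iff_add g1) (hasRemovableAt_iff_add g2)
        hvs).1 ?_
      obtain ⟨a, ha, hca⟩ := hc s hs
      choose b hb hbz using fun k => zetaPole_near_zero hτ k
      refine ⟨fun v => a v - (∑ k ∈ Finset.range (n s + 1), c s k * b k (v - s)) -
        ∑ s' ∈ S.erase s, ∑ k ∈ Finset.range (n s' + 1), c s' k * zetaPole τ k (v - s'),
        (ha.sub (Finset.analyticAt_fun_sum _ fun k _ => analyticAt_const.mul ?_)).sub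
        (Finset.analyticAt_fun_sum _ fun s' hs' => Finset.analyticAt_fun_sum _ fun k _ =>
          analyticAt_const.mul ?_), ?_⟩
      · exact (hb k).comp_of_eq (f := fun v => v - s) (by fun_prop) (sub_self s)
      · exact (analyticAt_zetaPole hτ k (hS s hs s' (Finset.mem_of_mem_erase hs')
          (Finset.ne_of_mem_erase hs').symm)).comp_of_eq (f := fun v => v - s') (by fun_prop) rfl
      · have hz : ∀ k, ∀ᶠ v in 𝓝[≠] s, zetaPole τ k (v - s) = ((v - s) ^ (k + 1))⁻¹ + b k (v - s) := by
          intro k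
          have := tendsto_add_const_nhdsNE (-s) s
          rw [add_neg_cancel] at this
          exact this.eventually (hbz k)
        filter_upwards [hca, (Finset.eventually_all (Finset.range (n s + 1))).2 fun k _ => hz k]
          with w hw hwz
        rw [hg]
        simp only
        have hz' : ∑ k ∈ Finset.range (n s + 1), c s k * zetaPole τ k (w - s) =
            ∑ k ∈ Finset.range (n s + 1), c s k * (((w - s) ^ (k + 1))⁻¹ + b k (w - s)) :=
          Finset.sum_congr rfl fun k hk => by rw [hwz k hk]
        rw [← Finset.add_sum_erase S _ hs, hw, hz']
        simp only [mul_add, Finset.sum_add_distrib]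
        ring
    · push Not at hv
      obtain ⟨a, ha, hha⟩ := hrem v hv
      refine ⟨fun v => a v - ∑ s ∈ S, ∑ k ∈ Finset.range (n s + 1), c s k * zetaPole τ k (v - s),
        ha.sub (Finset.analyticAt_fun_sum _ (hE v hv)), ?_⟩
      filter_upwards [hha] with w hw
      rw [hg]
      simp only [hw]
  obtain ⟨G, hG, hgG⟩ := exists_entire_of_removable hgood
  have transfer : ∀ p d : ℂ, (∀ v, ∀ᶠ w in 𝓝[≠] v, g (w + p) = g w + d) →
      ∀ v, G (v + p) = G v + d := by
    intro p d hgp v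
    refine eq_of_eventuallyEq_nhdsNE (a := fun v => G (v + p)) (b := fun v => G v + d)
      (hG.continuous.comp (continuous_add_const p)).continuousAt
      (hG.continuous.add continuous_const).continuousAt ?_
    filter_upwards [hgp v, hgG v, (tendsto_add_const_nhdsNE p v).eventually (hgG (v + p))]
      with w h1 h2 h3
    rw [← h3, ← h2, h1]
  have hC := quasiPeriod_eq_zero hτ hG (by simpa using transfer _ _ g1) (transfer _ _ g2)
  have hsum : ∑ s ∈ S, c s 0 = 0 := by simpa using hC
  rw [← hsum]
  exact Finset.sum_congr rfl fun s hs => (hc s hs).residue_eq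

end JacobiDual
end

noncomputable section
namespace JacobiDual
open Set

/-! ### The residue formula -/

/-- `-∑ₐ δₐ ζ(v - xₐ)`, where `ζ = ϑ₁'/ϑ₁`. -/
def poleSum {n : ℕ} (τ : ℂ) (x δ : Fin n → ℂ) (v : ℂ) : ℂ :=
  -∑ a, δ a * thetaZeta (v - x a) τ

/-- `∑ₐ ζ(v - xₐ) - n ζ(v)`, where `ζ = ϑ₁'/ϑ₁`. -/
def logForm {n : ℕ} (τ : ℂ) (x : Fin n → ℂ) (v : ℂ) : ℂ :=
  ∑ a, thetaZeta (v - x a) τ - n * thetaZeta v τ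

theorem poleSum_add_pi {n : ℕ} (τ : ℂ) (x δ : Fin n → ℂ) (v : ℂ) :
    poleSum τ x δ (v + Real.pi) = poleSum τ x δ v := by
  simp only [poleSum, add_sub_right_comm, thetaZeta_add_pi]

theorem logForm_add_pi {n : ℕ} (τ : ℂ) (x : Fin n → ℂ) (v : ℂ) :
    logForm τ x (v + Real.pi) = logForm τ x v := by
  simp only [logForm, add_sub_right_comm, thetaZeta_add_pi]

theorem poleSum_add_pi_mul {n : ℕ} {τ : ℂ} (hτ : 0 < τ.im) {x δ : Fin n → ℂ} (hδ : ∑ a, δ a = 0)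
    {v : ℂ} (hv : ∀ a, v - x a ∉ periodLattice τ) :
    poleSum τ x δ (v + Real.pi * τ) = poleSum τ x δ v := by
  simp only [poleSum, add_sub_right_comm, thetaZeta_add_pi_mul hτ (hv _), mul_sub,
    Finset.sum_sub_distrib, ← Finset.sum_mul, hδ, zero_mul, sub_zero]

theorem logForm_add_pi_mul {n : ℕ} {τ : ℂ} (hτ : 0 < τ.im) {x : Fin n → ℂ}
    {v : ℂ} (hv0 : v ∉ periodLattice τ) (hv : ∀ a, v - x a ∉ periodLattice τ) :
    logForm τ x (v + Real.pi * τ) = logForm τ x v := by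
  simp only [logForm, add_sub_right_comm, thetaZeta_add_pi_mul hτ (hv _),
    thetaZeta_add_pi_mul hτ hv0, Finset.sum_sub_distrib]
  simp
  ring

theorem meromorphicAt_thetaZeta {τ : ℂ} (hτ : 0 < τ.im) (v : ℂ) :
    MeromorphicAt (fun v => thetaZeta v τ) v := by
  have hd := (differentiable_theta1 hτ).analyticAt v
  exact hd.deriv.meromorphicAt.div hd.meromorphicAt

theorem meromorphicAt_thetaZeta_sub {τ : ℂ} (hτ : 0 < τ.im) (c v : ℂ) :
    MeromorphicAt (fun v => thetaZeta (v - c) τ) v := by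
  have hd := ((differentiable_theta1 hτ).analyticAt (v - c)).deriv.comp_of_eq
    (f := fun v => v - c) (x := v) (by fun_prop) rfl
  have hd' := ((differentiable_theta1 hτ).analyticAt (v - c)).comp_of_eq
    (f := fun v => v - c) (x := v) (by fun_prop) rfl
  exact hd.meromorphicAt.div hd'.meromorphicAt

theorem meromorphicAt_poleSum {n : ℕ} {τ : ℂ} (hτ : 0 < τ.im) (x δ : Fin n → ℂ) (v : ℂ) :
    MeromorphicAt (poleSum τ x δ) v :=
  (MeromorphicAt.fun_sum fun a _ => (MeromorphicAt.const (δ a) v).mul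
    (meromorphicAt_thetaZeta_sub hτ (x a) v)).neg

theorem meromorphicAt_logForm {n : ℕ} {τ : ℂ} (hτ : 0 < τ.im) (x : Fin n → ℂ) (v : ℂ) :
    MeromorphicAt (logForm τ x) v :=
  (MeromorphicAt.fun_sum fun a _ => meromorphicAt_thetaZeta_sub hτ (x a) v).sub
    ((MeromorphicAt.const (n : ℂ) v).mul (meromorphicAt_thetaZeta hτ v))

theorem analyticAt_thetaZeta_sub {τ : ℂ} (hτ : 0 < τ.im) {c v : ℂ} (h : v - c ∉ periodLattice τ) :
    AnalyticAt ℂ (fun v => thetaZeta (v - c) τ) v :=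
  (analyticAt_thetaZeta hτ h).comp_of_eq (f := fun v => v - c) (by fun_prop) rfl

theorem analyticAt_poleSum {n : ℕ} {τ : ℂ} (hτ : 0 < τ.im) {x : Fin n → ℂ} (δ : Fin n → ℂ) {v : ℂ}
    (hv : ∀ a, v - x a ∉ periodLattice τ) : AnalyticAt ℂ (poleSum τ x δ) v :=
  (Finset.analyticAt_fun_sum _ fun a _ => analyticAt_const.mul
    (analyticAt_thetaZeta_sub hτ (hv a))).neg

theorem analyticAt_logForm {n : ℕ} {τ : ℂ} (hτ : 0 < τ.im) {x : Fin n → ℂ} {v : ℂ}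
    (hv0 : v ∉ periodLattice τ) (hv : ∀ a, v - x a ∉ periodLattice τ) :
    AnalyticAt ℂ (logForm τ x) v :=
  (Finset.analyticAt_fun_sum _ fun a _ => analyticAt_thetaZeta_sub hτ (hv a)).sub
    (analyticAt_const.mul (analyticAt_thetaZeta hτ hv0))

/-- Local form of `poleSum` at the pole `xₘ`. -/
theorem poleSum_near_pole {n : ℕ} {τ : ℂ} (hτ : 0 < τ.im) {x : Fin n → ℂ} (δ : Fin n → ℂ)
    (hx : ∀ a b, a ≠ b → x a - x b ∉ periodLattice τ) (m : Fin n) :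
    ∃ A : ℂ → ℂ, AnalyticAt ℂ A (x m) ∧ A (x m) = -∑ b, δ b * thetaZeta (x m - x b) τ ∧
      ∀ᶠ v in 𝓝[≠] x m, poleSum τ x δ v = -δ m * (v - x m)⁻¹ + A v := by
  obtain ⟨a, ha, ha0, hev⟩ := thetaZeta_near_zero hτ
  -- Oddness fixes the totalised value of ζ at its pole to be 0. The sums over all b may therefore
  -- include b = m.
  have hz0 : thetaZeta 0 τ = 0 := by
    have h1 := thetaZeta_neg 0 τ
    rw [neg_zero] at h1
    have : (2 : ℂ) * thetaZeta 0 τ = 0 := by linear_combination h1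
    simpa using this
  refine ⟨fun v => -(δ m * a (v - x m) + ∑ b ∈ Finset.univ.erase m, δ b * thetaZeta (v - x b) τ),
    ((analyticAt_const.mul (ha.comp_of_eq (f := fun v => v - x m) (by fun_prop) (sub_self _))).add
      (Finset.analyticAt_fun_sum _ fun b hb => analyticAt_const.mul
        (analyticAt_thetaZeta_sub hτ (hx m b (Finset.ne_of_mem_erase hb).symm)))).neg, ?_, ?_⟩
  · rw [← Finset.add_sum_erase _ _ (Finset.mem_univ m)]
    simp [ha0, hz0]
  · have := tendsto_add_const_nhdsNE (-x m) (x m)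
    rw [add_neg_cancel] at this
    filter_upwards [this.eventually hev] with v hv
    rw [← sub_eq_add_neg] at hv
    rw [poleSum, ← Finset.add_sum_erase _ _ (Finset.mem_univ m), hv]
    ring

theorem logForm_near_pole {n : ℕ} {τ : ℂ} (hτ : 0 < τ.im) {x : Fin n → ℂ}
    (hx0 : ∀ a, x a ∉ periodLattice τ)
    (hx : ∀ a b, a ≠ b → x a - x b ∉ periodLattice τ) (m : Fin n) :
    ∃ B : ℂ → ℂ, AnalyticAt ℂ B (x m) ∧
      B (x m) = ∑ b, thetaZeta (x m - x b) τ - n * thetaZeta (x m) τ ∧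
      ∀ᶠ v in 𝓝[≠] x m, logForm τ x v = (v - x m)⁻¹ + B v := by
  obtain ⟨A, hA, hA0, hev⟩ := poleSum_near_pole hτ (fun _ => 1) hx m
  refine ⟨fun v => -A v - n * thetaZeta v τ,
    hA.neg.sub (analyticAt_const.mul (analyticAt_thetaZeta hτ (hx0 m))), ?_, ?_⟩
  · simp only [hA0]; simp
  · filter_upwards [hev] with v hv
    have : logForm τ x v = -poleSum τ x (fun _ => 1) v - n * thetaZeta v τ := by
      simp [logForm, poleSum]
    rw [this, hv]; ring

/-- `F F' F'' / d log λ`, as a function on the universal cover of the elliptic curve. -/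
def tripleForm {n : ℕ} (τ : ℂ) (x δ₁ δ₂ δ₃ : Fin n → ℂ) (v : ℂ) : ℂ :=
  poleSum τ x δ₁ v * poleSum τ x δ₂ v * poleSum τ x δ₃ v / logForm τ x v

/-- Each factor is (c + (v - xₘ)A(v))/(v - xₘ), so the quotient is φ(v)/(v - xₘ)² with φ analytic.
The residue is φ'(xₘ), and only the values of the regular parts at xₘ enter. -/
theorem residue_tripleForm {n : ℕ} {τ : ℂ} (hτ : 0 < τ.im) {x : Fin n → ℂ}
    (hx0 : ∀ a, x a ∉ periodLattice τ) (hx : ∀ a b, a ≠ b → x a - x b ∉ periodLattice τ)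
    (δ₁ δ₂ δ₃ : Fin n → ℂ) (m : Fin n) :
    residue (tripleForm τ x δ₁ δ₂ δ₃) (x m) =
      -∑ b, (δ₁ b * δ₂ m * δ₃ m + δ₁ m * δ₂ b * δ₃ m + δ₁ m * δ₂ m * δ₃ b - δ₁ m * δ₂ m * δ₃ m) *
        thetaZeta (x m - x b) τ - n * (δ₁ m * δ₂ m * δ₃ m) * thetaZeta (x m) τ := by
  obtain ⟨A₁, a₁, e₁, h₁⟩ := poleSum_near_pole hτ δ₁ hx m
  obtain ⟨A₂, a₂, e₂, h₂⟩ := poleSum_near_pole hτ δ₂ hx m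
  obtain ⟨A₃, a₃, e₃, h₃⟩ := poleSum_near_pole hτ δ₃ hx m
  obtain ⟨B, b, e, h⟩ := logForm_near_pole hτ hx0 hx m
  have hlin : ∀ (c : ℂ) (A : ℂ → ℂ), AnalyticAt ℂ A (x m) →
      AnalyticAt ℂ (fun v => c + (v - x m) * A v) (x m) ∧
        HasDerivAt (fun v => c + (v - x m) * A v) (A (x m)) (x m) := by
    intro c A hA
    refine ⟨AnalyticAt.add (by fun_prop) (AnalyticAt.mul (by fun_prop) hA), ?_⟩
    have := (((hasDerivAt_id (x m)).sub_const (x m)).mul hA.differentiableAt.hasDerivAt).const_add c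
    exact this.congr_deriv (by simp)
  obtain ⟨p₁, d₁⟩ := hlin (-δ₁ m) A₁ a₁
  obtain ⟨p₂, d₂⟩ := hlin (-δ₂ m) A₂ a₂
  obtain ⟨p₃, d₃⟩ := hlin (-δ₃ m) A₃ a₃
  obtain ⟨p, d⟩ := hlin 1 B b
  rw [residue_eq_deriv (φ := fun v => (-δ₁ m + (v - x m) * A₁ v) * (-δ₂ m + (v - x m) * A₂ v) *
    (-δ₃ m + (v - x m) * A₃ v) / (1 + (v - x m) * B v)) (((p₁.mul p₂).mul p₃).div p (by simp))]
  · have hd := ((d₁.mul d₂).mul d₃).div d (by simp)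
    refine hd.deriv.trans ?_
    simp only [Pi.mul_apply, sub_self, zero_mul, add_zero]
    rw [e₁, e₂, e₃, e]
    simp only [add_mul, sub_mul, Finset.sum_add_distrib, Finset.sum_sub_distrib]
    have k1 : ∀ (c c' : ℂ) (δ : Fin n → ℂ), ∑ b, δ b * c * c' * thetaZeta (x m - x b) τ =
        c * c' * ∑ b, δ b * thetaZeta (x m - x b) τ := fun c c' δ => by
      rw [Finset.mul_sum]; exact Finset.sum_congr rfl fun b _ => by ring
    have k2 : ∀ (c c' : ℂ) (δ : Fin n → ℂ), ∑ b, c * δ b * c' * thetaZeta (x m - x b) τ =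
        c * c' * ∑ b, δ b * thetaZeta (x m - x b) τ := fun c c' δ => by
      rw [Finset.mul_sum]; exact Finset.sum_congr rfl fun b _ => by ring
    have k3 : ∀ (c c' : ℂ) (δ : Fin n → ℂ), ∑ b, c * c' * δ b * thetaZeta (x m - x b) τ =
        c * c' * ∑ b, δ b * thetaZeta (x m - x b) τ := fun c c' δ => by
      rw [Finset.mul_sum]; exact Finset.sum_congr rfl fun b _ => by ring
    rw [k1, k2, k3, ← Finset.mul_sum]
    ring
  · filter_upwards [h₁, h₂, h₃, h, self_mem_nhdsWithin] with v v₁ v₂ v₃ v₄ hv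
    have hv' : v - x m ≠ 0 := sub_ne_zero.2 hv
    have f : ∀ c A : ℂ, c * (v - x m)⁻¹ + A = (c + (v - x m) * A) / (v - x m) := fun c A => by
      field_simp
    have f4 := f 1 (B v)
    rw [one_mul] at f4
    rw [tripleForm, v₁, v₂, v₃, v₄, f, f, f, f4]
    field_simp

/-- At 0 the numerator is analytic while the denominator has a simple pole with coefficient -n ≠ 0.
-/
theorem hasRemovableAt_tripleForm_zero {n : ℕ} {τ : ℂ} (hτ : 0 < τ.im) {x : Fin n → ℂ}
    (hn : n ≠ 0) (hx0 : ∀ a, x a ∉ periodLattice τ) (δ₁ δ₂ δ₃ : Fin n → ℂ) :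
    HasRemovableAt (tripleForm τ x δ₁ δ₂ δ₃) 0 := by
  obtain ⟨a, ha, -, hev⟩ := thetaZeta_near_zero hτ
  have h0 : ∀ a, 0 - x a ∉ periodLattice τ := fun b h => hx0 b (by simpa using periodLattice_neg h)
  have hB : AnalyticAt ℂ (fun v => ∑ b, thetaZeta (v - x b) τ - n * a v) 0 :=
    (Finset.analyticAt_fun_sum _ fun b _ => analyticAt_thetaZeta_sub hτ (h0 b)).sub
      (analyticAt_const.mul ha)
  have hF := ((analyticAt_poleSum hτ δ₁ h0).mul (analyticAt_poleSum hτ δ₂ h0)).mul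
    (analyticAt_poleSum hτ δ₃ h0)
  have hden : AnalyticAt ℂ (fun v => -(n : ℂ) + v * (∑ b, thetaZeta (v - x b) τ - n * a v)) 0 :=
    AnalyticAt.add analyticAt_const (analyticAt_id.mul hB)
  refine ⟨_, (hF.mul analyticAt_id).div hden (by simpa using hn), ?_⟩
  filter_upwards [hev, self_mem_nhdsWithin] with v hv hv0
  have hv0' : v ≠ 0 := hv0
  have : logForm τ x v = (-(n : ℂ) + v * (∑ b, thetaZeta (v - x b) τ - n * a v)) / v := by
    rw [logForm, hv]; field_simp; ring
  rw [tripleForm, this]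
  simp only [Pi.mul_apply, Pi.div_apply, id]
  rw [div_div_eq_mul_div]

theorem eventually_regular {n : ℕ} {τ : ℂ} (hτ : 0 < τ.im) (x : Fin n → ℂ) (v : ℂ) :
    ∀ᶠ w in 𝓝[≠] v, w ∉ periodLattice τ ∧ ∀ a, w - x a ∉ periodLattice τ :=
  (eventually_notMem_periodLattice hτ v).and (eventually_all.2 fun a =>
    (tendsto_add_const_nhdsNE (-x a) v).eventually (eventually_notMem_periodLattice hτ _))

/-- The function has a genuine pole at one of the xₘ, so its order is finite there, and by
connectedness finite everywhere. -/
theorem eventually_logForm_ne_zero {n : ℕ} {τ : ℂ} (hτ : 0 < τ.im) {x : Fin n → ℂ} (hn : n ≠ 0)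
    (hx0 : ∀ a, x a ∉ periodLattice τ) (hx : ∀ a b, a ≠ b → x a - x b ∉ periodLattice τ) (v : ℂ) :
    ∀ᶠ w in 𝓝[≠] v, logForm τ x w ≠ 0 := by
  have hm : MeromorphicOn (logForm τ x) univ := fun v _ => meromorphicAt_logForm hτ x v
  let m : Fin n := ⟨0, Nat.pos_of_ne_zero hn⟩
  obtain ⟨B, hB, -, hev⟩ := logForm_near_pole hτ hx0 hx m
  have h1 : meromorphicOrderAt (logForm τ x) (x m) ≠ ⊤ := by
    rw [meromorphicOrderAt_ne_top_iff_eventually_ne_zero (hm _ trivial)]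
    have hc : ContinuousAt (fun v => 1 + (v - x m) * B v) (x m) :=
      ContinuousAt.add (by fun_prop) (ContinuousAt.mul (by fun_prop) hB.continuousAt)
    filter_upwards [hev, self_mem_nhdsWithin,
      nhdsWithin_le_nhds (hc.eventually_ne (by simp : (1 : ℂ) + (x m - x m) * B (x m) ≠ 0))]
      with w hw hne h0 h
    have hne' : w - x m ≠ 0 := sub_ne_zero.2 hne
    rw [hw] at h
    apply h0
    have := congrArg (fun y => (w - x m) * y) h
    simpa [mul_add, mul_inv_cancel₀ hne'] using this
  have h2 := (hm.exists_meromorphicOrderAt_ne_top_iff_forall isConnected_univ).1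
    ⟨⟨x m, trivial⟩, h1⟩ ⟨v, trivial⟩
  exact (meromorphicOrderAt_ne_top_iff_eventually_ne_zero (hm _ trivial)).1 h2

/-- The zeros of `logForm` away from its poles, one for each point of the elliptic curve. -/
def logFormZeros {n : ℕ} (τ : ℂ) (x : Fin n → ℂ) : Set ℂ :=
  {v | v ∈ periodCell τ ∧ (v ∉ periodLattice τ ∧ ∀ a, v - x a ∉ periodLattice τ) ∧
    logForm τ x v = 0}

theorem finite_logFormZeros {n : ℕ} {τ : ℂ} (hτ : 0 < τ.im) {x : Fin n → ℂ} (hn : n ≠ 0)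
    (hx0 : ∀ a, x a ∉ periodLattice τ) (hx : ∀ a b, a ≠ b → x a - x b ∉ periodLattice τ) :
    (logFormZeros τ x).Finite := by
  obtain ⟨K, hK, hcell⟩ := periodCell_subset_isCompact τ
  by_contra hinf
  obtain ⟨v, -, hv⟩ := Set.Infinite.exists_accPt_of_subset_isCompact hinf hK
    fun w hw => hcell hw.1
  rw [accPt_iff_frequently_nhdsNE] at hv
  obtain ⟨w, hw, hw'⟩ := (hv.and_eventually (eventually_logForm_ne_zero hτ hn hx0 hx v)).exists
  exact hw' hw.2.2

theorem periodCell_sub_notMem {τ : ℂ} (hτ : 0 < τ.im) {v w : ℂ} (hv : v ∈ periodCell τ)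
    (hw : w ∈ periodCell τ) (h : v ≠ w) : v - w ∉ periodLattice τ := by
  obtain ⟨s, t, hs, ht, rfl⟩ := hv
  obtain ⟨s', t', hs', ht', rfl⟩ := hw
  rintro ⟨m, n, hmn⟩
  apply h
  have him := congrArg Complex.im hmn
  have hre := congrArg Complex.re hmn
  simp at him hre
  have hp : Real.pi * τ.im ≠ 0 := by positivity
  have h1 : t - t' = n := mul_right_cancel₀ hp (by linarith)
  have hn : n = 0 := by
    have a1 : (n : ℝ) < 1 := by linarith [ht.2, ht'.1]
    have a2 : (-1 : ℝ) < n := by linarith [ht.1, ht'.2]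
    have a1' : n < 1 := by exact_mod_cast a1
    have a2' : -1 < n := by exact_mod_cast a2
    omega
  subst hn
  have ht0 : t = t' := by simpa [sub_eq_zero] using h1
  subst ht0
  have h2 : s - s' = m := mul_right_cancel₀ Real.pi_ne_zero (by
    simp at hre; linarith)
  have hm : m = 0 := by
    have a1 : (m : ℝ) < 1 := by linarith [hs.2, hs'.1]
    have a2 : (-1 : ℝ) < m := by linarith [hs.1, hs'.2]
    have a1' : m < 1 := by exact_mod_cast a1
    have a2' : -1 < m := by exact_mod_cast a2
    omega
  subst hm
  have hs0 : s = s' := by simpa [sub_eq_zero] using h2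
  rw [hs0]

theorem sum_residue_logFormZeros {n : ℕ} {τ : ℂ} (hτ : 0 < τ.im) {x : Fin n → ℂ} (hn : n ≠ 0)
    (hx0 : ∀ a, x a ∉ periodLattice τ) (hx : ∀ a b, a ≠ b → x a - x b ∉ periodLattice τ)
    {δ₁ δ₂ δ₃ : Fin n → ℂ} (s₁ : ∑ a, δ₁ a = 0) (s₂ : ∑ a, δ₂ a = 0) (s₃ : ∑ a, δ₃ a = 0) :
    ∑ᶠ v ∈ logFormZeros τ x, residue (tripleForm τ x δ₁ δ₂ δ₃) v =
      -∑ m, residue (tripleForm τ x δ₁ δ₂ δ₃) (x m) := by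
  have hfin := finite_logFormZeros hτ hn hx0 hx
  have hinj : Function.Injective x := fun a b hab => by
    by_contra hne
    exact hx a b hne (by rw [hab, sub_self]; exact periodLattice_zero τ)
  have hper₁ : ∀ v, ∀ᶠ w in 𝓝[≠] v,
      tripleForm τ x δ₁ δ₂ δ₃ (w + Real.pi) = tripleForm τ x δ₁ δ₂ δ₃ w := fun v =>
    Eventually.of_forall fun w => by simp only [tripleForm, poleSum_add_pi, logForm_add_pi]
  have hper₂ : ∀ v, ∀ᶠ w in 𝓝[≠] v,
      tripleForm τ x δ₁ δ₂ δ₃ (w + Real.pi * τ) = tripleForm τ x δ₁ δ₂ δ₃ w := fun v => by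
    filter_upwards [eventually_regular hτ x v] with w hw
    simp only [tripleForm, poleSum_add_pi_mul hτ s₁ hw.2, poleSum_add_pi_mul hτ s₂ hw.2,
      poleSum_add_pi_mul hτ s₃ hw.2, logForm_add_pi_mul hτ hw.1 hw.2]
  have hdisj : Disjoint hfin.toFinset (Finset.univ.image x) := by
    rw [Finset.disjoint_left]
    intro v hv hv'
    obtain ⟨a, -, rfl⟩ := Finset.mem_image.1 hv'
    refine ((hfin.mem_toFinset.1 hv).2.1.2 a) ?_
    rw [sub_self]; exact periodLattice_zero τ
  have key := sum_residue_eq_zero (S := hfin.toFinset ∪ Finset.univ.image x) hτ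
    (h := tripleForm τ x δ₁ δ₂ δ₃)
    (fun s _ => (((meromorphicAt_poleSum hτ x δ₁ s).mul (meromorphicAt_poleSum hτ x δ₂ s)).mul
      (meromorphicAt_poleSum hτ x δ₃ s)).div (meromorphicAt_logForm hτ x s)) ?_ ?_ hper₁ hper₂
  · rw [Finset.sum_union hdisj, Finset.sum_image fun a _ b _ h => hinj h] at key
    rw [finsum_mem_eq_finite_toFinset_sum _ hfin]
    linear_combination key
  · intro v hv
    have hvx : ∀ a, v - x a ∉ periodLattice τ := fun a =>
      hv _ (Finset.mem_union_right _ (Finset.mem_image_of_mem x (Finset.mem_univ a)))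
    by_cases hv0 : v ∈ periodLattice τ
    · exact (iff_of_sub_mem_periodLattice
        (hasRemovableAt_iff_add (d := 0) (by simpa using hper₁))
        (hasRemovableAt_iff_add (d := 0) (by simpa using hper₂)) (by simpa using hv0)).1
        (hasRemovableAt_tripleForm_zero hτ hn hx0 δ₁ δ₂ δ₃)
    -- A zero of the denominator could be translated into the period cell and would then be
    -- congruent to a point of S, against `hv`.
    · have hne : logForm τ x v ≠ 0 := by
        intro h0
        obtain ⟨w, hw, hwv⟩ := exists_mem_periodCell hτ v
        have hL : ∀ c u : ℂ, u - c ∉ periodLattice τ ↔ u + Real.pi - c ∉ periodLattice τ := by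
          intro c u
          rw [← theta1_eq_zero_iff hτ, ← theta1_eq_zero_iff hτ, add_sub_right_comm, theta1_add_pi,
            neg_eq_zero]
        have hL' : ∀ c u : ℂ, u - c ∉ periodLattice τ ↔ u + Real.pi * τ - c ∉ periodLattice τ := by
          intro c u
          rw [← theta1_eq_zero_iff hτ, ← theta1_eq_zero_iff hτ, add_sub_right_comm,
            theta1_add_pi_mul hτ, mul_eq_zero]
          simp
        have hQ := (iff_of_sub_mem_periodLattice (Q := fun u => (u - 0 ∉ periodLattice τ ∧
          ∀ a, u - x a ∉ periodLattice τ) ∧ logForm τ x u = 0) (fun u => ?_) (fun u => ?_) hwv).1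
          ⟨⟨by simpa using hv0, hvx⟩, h0⟩
        · refine hv w (Finset.mem_union_left _ (hfin.mem_toFinset.2
            ⟨hw, ⟨by simpa using hQ.1.1, hQ.1.2⟩, hQ.2⟩)) ?_
          simpa using periodLattice_neg hwv
        · rw [logForm_add_pi]
          exact and_congr_left' (and_congr (hL 0 u) (forall_congr' fun a => hL (x a) u))
        · rw [← hL']
          simp only [← hL']
          refine and_congr_right fun h => ?_
          rw [logForm_add_pi_mul hτ (by simpa using h.1) h.2]
      exact ⟨_, (((analyticAt_poleSum hτ δ₁ hvx).mul (analyticAt_poleSum hτ δ₂ hvx)).mul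
        (analyticAt_poleSum hτ δ₃ hvx)).div (analyticAt_logForm hτ hv0 hvx) hne, by rfl⟩
  · intro s hs s' hs' hne
    rcases Finset.mem_union.1 hs with h | h <;> rcases Finset.mem_union.1 hs' with h' | h'
    · exact periodCell_sub_notMem hτ (hfin.mem_toFinset.1 h).1 (hfin.mem_toFinset.1 h').1 hne
    · obtain ⟨a, -, rfl⟩ := Finset.mem_image.1 h'
      exact (hfin.mem_toFinset.1 h).2.1.2 a
    · obtain ⟨a, -, rfl⟩ := Finset.mem_image.1 h
      intro hL
      exact (hfin.mem_toFinset.1 h').2.1.2 a (by simpa using periodLattice_neg hL)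
    · obtain ⟨a, -, rfl⟩ := Finset.mem_image.1 h
      obtain ⟨b, -, rfl⟩ := Finset.mem_image.1 h'
      exact hx a b fun hab => hne (by rw [hab])

end JacobiDual
end

noncomputable section
namespace JacobiDual
open Set

/-! ### The dual structure functions -/

/-- The derivative of `zᵃ` with respect to the coordinate `zᵏ`. -/
def zCoeff {l : ℕ} (k : Fin l) (a : Fin (l + 1)) : ℂ := zFull (Pi.single k 1) a

theorem sum_zCoeff {l : ℕ} (k : Fin l) : ∑ a, zCoeff k a = 0 := sum_zFull _

theorem deriv_comp_mul_const (c : ℂ) (f : ℂ → ℂ) (t : ℂ) :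
    deriv (fun t => f (t * c)) t = c * deriv f (t * c) := by
  rw [mul_comm t c, ← smul_eq_mul c (deriv f (c * t)), ← deriv_comp_mul_left]
  congr 1; ext s; rw [mul_comm]

theorem logDeriv_comp_affine (f : ℂ → ℂ) (c d t : ℂ) :
    logDeriv (fun t => f (c + t * d)) t = d * logDeriv f (c + t * d) := by
  have h : deriv (fun t => f (c + t * d)) t = d * deriv f (c + t * d) := by
    have h1 := deriv_comp_mul_const d (fun y => f (c + y)) t
    have h2 := deriv_comp_const_add f c (t * d)
    rw [h1, h2]
  rw [logDeriv_apply, logDeriv_apply, h, mul_div_assoc]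

theorem superpotential_eq {l : ℕ} (P : Space l) (v : ℂ) : superpotential P v =
    Complex.exp (2 * Real.pi * Complex.I * P.1) *
      ∏ i : Fin (l + 1), theta1 (v - zFull P.2.1 i) P.2.2 / theta1 v P.2.2 := rfl

theorem logDeriv_superpotential {l : ℕ} {P : Space l} (hτ : 0 < P.2.2.im) {v : ℂ}
    (hv0 : v ∉ periodLattice P.2.2) (hv : ∀ a, v - zFull P.2.1 a ∉ periodLattice P.2.2) :
    logDeriv (superpotential P) v = logForm P.2.2 (zFull P.2.1) v := by
  have hd := differentiable_theta1 hτ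
  have h0 : theta1 v P.2.2 ≠ 0 := by rwa [Ne, theta1_eq_zero_iff hτ]
  have h1 : ∀ a, theta1 (v - zFull P.2.1 a) P.2.2 ≠ 0 := fun a => by
    rw [Ne, theta1_eq_zero_iff hτ]; exact hv a
  have hda : ∀ a, DifferentiableAt ℂ (fun v => theta1 (v - zFull P.2.1 a) P.2.2) v := fun a =>
    (hd _).comp (f := fun v => v - zFull P.2.1 a) v (by fun_prop)
  have e : superpotential P = fun v => Complex.exp (2 * Real.pi * Complex.I * P.1) *
      ∏ i : Fin (l + 1), theta1 (v - zFull P.2.1 i) P.2.2 / theta1 v P.2.2 := rfl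
  rw [e, logDeriv_const_mul _ _ (Complex.exp_ne_zero _),
    logDeriv_prod (f := fun a v => theta1 (v - zFull P.2.1 a) P.2.2 / theta1 v P.2.2)
      (fun a _ => div_ne_zero (h1 a) h0) (fun a _ => (hda a).div (hd v) h0)]
  have h2 : ∀ a, logDeriv (fun v => theta1 (v - zFull P.2.1 a) P.2.2 / theta1 v P.2.2) v =
      thetaZeta (v - zFull P.2.1 a) P.2.2 - thetaZeta v P.2.2 := fun a => by
    rw [logDeriv_div (f := fun v => theta1 (v - zFull P.2.1 a) P.2.2)
      (g := fun v => theta1 v P.2.2) v (h1 a) h0 (hda a) (hd v)]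
    congr 1
    have := logDeriv_comp_affine (fun v => theta1 v P.2.2) (-zFull P.2.1 a) 1 v
    simp only [mul_one, one_mul, neg_add_eq_sub] at this
    exact this
  simp only [h2, Finset.sum_sub_distrib, logForm]
  simp

theorem logPartial_z {l : ℕ} {P : Space l} (hτ : 0 < P.2.2.im) (k : Fin l) {v : ℂ}
    (hv0 : v ∉ periodLattice P.2.2) (hv : ∀ a, v - zFull P.2.1 a ∉ periodLattice P.2.2) :
    logPartial (.z k) P v = poleSum P.2.2 (zFull P.2.1) (zCoeff k) v := by
  have hd := differentiable_theta1 hτ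
  have h0 : theta1 v P.2.2 ≠ 0 := by rwa [Ne, theta1_eq_zero_iff hτ]
  have h1 : ∀ a, theta1 (v - zFull P.2.1 a) P.2.2 ≠ 0 := fun a => by
    rw [Ne, theta1_eq_zero_iff hτ]; exact hv a
  have e : ∀ t : ℂ, superpotential (P + t • (Coord.z k).dir) v =
      Complex.exp (2 * Real.pi * Complex.I * P.1) * ∏ a : Fin (l + 1),
        (fun t => theta1 (v - zFull P.2.1 a + t * -zCoeff k a) P.2.2 / theta1 v P.2.2) t := by
    intro t
    simp only [superpotential, Coord.dir, Prod.fst_add, Prod.snd_add, Prod.smul_fst, Prod.smul_snd,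
      smul_zero, add_zero, zFull_add, zFull_smul, zCoeff]
    congr 1
    refine Finset.prod_congr rfl fun a _ => ?_
    congr 2; ring
  have e0 : superpotential P v = superpotential (P + (0 : ℂ) • (Coord.z k).dir) v := by simp
  have hld : logPartial (.z k) P v =
      logDeriv (fun t : ℂ => superpotential (P + t • (Coord.z k).dir) v) 0 := by
    rw [logDeriv_apply, ← e0]; rfl
  have hda : ∀ a, DifferentiableAt ℂ
      (fun t => theta1 (v - zFull P.2.1 a + t * -zCoeff k a) P.2.2 / theta1 v P.2.2) 0 := fun a =>
    ((hd _).comp (f := fun t => v - zFull P.2.1 a + t * -zCoeff k a) 0 (by fun_prop)).div_const _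
  rw [hld]
  simp only [e]
  rw [logDeriv_const_mul _ _ (Complex.exp_ne_zero _), logDeriv_prod (fun a _ => ?_)
    fun a _ => hda a]
  · rw [poleSum, ← Finset.sum_neg_distrib]
    refine Finset.sum_congr rfl fun a _ => ?_
    simp only [div_eq_mul_inv]
    rw [logDeriv_mul_const _ _ (inv_ne_zero h0),
      logDeriv_comp_affine (fun v => theta1 v P.2.2), zero_mul, add_zero]
    simp only [thetaZeta]; ring
  · simpa using div_ne_zero (h1 a) h0

/-- Where λ is finite and nonzero, dλ = 0 means d log λ = 0. At a zero zᵃ of λ the derivative does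
not vanish, since regularity makes that zero simple. -/
theorem criticalPoints_eq {l : ℕ} {P : Space l} (hP : P.2 ∈ regularBase l) :
    criticalPoints P = logFormZeros P.2.2 (zFull P.2.1) := by
  obtain ⟨hτ, hx0, hx⟩ := hP
  have hd := differentiable_theta1 hτ
  ext v
  have hpole : theta1 v P.2.2 ≠ 0 ↔ v ∉ periodLattice P.2.2 := by
    rw [Ne, theta1_eq_zero_iff hτ]
  simp only [criticalPoints, logFormZeros, mem_ofPred_eq, hpole]
  refine and_congr_right fun _ => ?_
  rw [and_assoc]
  refine and_congr_right fun hv0 => ?_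
  have h0 : theta1 v P.2.2 ≠ 0 := hpole.2 hv0
  by_cases hv : ∀ a, v - zFull P.2.1 a ∉ periodLattice P.2.2
  · have hne : superpotential P v ≠ 0 := by
      rw [superpotential_eq]
      refine mul_ne_zero (Complex.exp_ne_zero _) (Finset.prod_ne_zero_iff.2 fun a _ =>
        div_ne_zero ?_ h0)
      rw [Ne, theta1_eq_zero_iff hτ]; exact hv a
    rw [← logDeriv_superpotential hτ hv0 hv, logDeriv_apply, div_eq_zero_iff]
    simp [hne, hv]
  · refine iff_of_false (fun hdv => ?_) fun h => hv h.1
    push Not at hv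
    obtain ⟨a, ha⟩ := hv
    obtain ⟨R, hR⟩ : ∃ R : ℂ → ℂ, R = fun v => Complex.exp (2 * Real.pi * Complex.I * P.1) *
      ((∏ i ∈ Finset.univ.erase a, theta1 (v - zFull P.2.1 i) P.2.2 / theta1 v P.2.2) /
        theta1 v P.2.2) := ⟨_, rfl⟩
    have hda : ∀ a, DifferentiableAt ℂ (fun v => theta1 (v - zFull P.2.1 a) P.2.2) v := fun a =>
      (hd _).comp (f := fun v => v - zFull P.2.1 a) v (by fun_prop)
    have hRd : DifferentiableAt ℂ R v := by
      rw [hR]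
      exact ((DifferentiableAt.fun_finsetProd fun i _ => (hda i).div (hd v) h0).div (hd v)
        h0).const_mul _
    have hRne : R v ≠ 0 := by
      rw [hR]
      refine mul_ne_zero (Complex.exp_ne_zero _) (div_ne_zero (Finset.prod_ne_zero_iff.2
        fun i hi => div_ne_zero ?_ h0) h0)
      rw [Ne, theta1_eq_zero_iff hτ]
      intro hi'
      refine hx i a (Finset.ne_of_mem_erase hi) ?_
      have := periodLattice_sub ha hi'
      rwa [sub_sub_sub_cancel_left] at this
    have e : superpotential P = fun v => theta1 (v - zFull P.2.1 a) P.2.2 * R v := by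
      ext v
      rw [superpotential_eq, hR, ← Finset.mul_prod_erase _ _ (Finset.mem_univ a)]
      ring
    rw [e, deriv_fun_mul (hda a) hRd, (theta1_eq_zero_iff hτ _).2 ha, zero_mul, add_zero,
      deriv_comp_sub_const (fun v => theta1 v P.2.2)] at hdv
    exact mul_ne_zero (deriv_theta1_ne_zero hτ ha) hRne hdv

theorem dualStructure_z {l : ℕ} {P : Space l} (hP : P.2 ∈ regularBase l) (i j k : Fin l) :
    dualStructure P (.z i) (.z j) (.z k) =
      ∑ m, ∑ b, (zCoeff i b * zCoeff j m * zCoeff k m + zCoeff i m * zCoeff j b * zCoeff k m +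
        zCoeff i m * zCoeff j m * zCoeff k b - zCoeff i m * zCoeff j m * zCoeff k m) *
        thetaZeta (zFull P.2.1 m - zFull P.2.1 b) P.2.2 +
      (l + 1) * ∑ m, zCoeff i m * zCoeff j m * zCoeff k m * thetaZeta (zFull P.2.1 m) P.2.2 := by
  have hP' := hP
  obtain ⟨hτ, hx0, hx⟩ := hP
  rw [dualStructure, criticalPoints_eq hP']
  have h1 : ∀ v ∈ logFormZeros P.2.2 (zFull P.2.1),
      residue (fun w => logPartial (.z i) P w * logPartial (.z j) P w * logPartial (.z k) P w /
        logDeriv (superpotential P) w) v =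
      residue (tripleForm P.2.2 (zFull P.2.1) (zCoeff i) (zCoeff j) (zCoeff k)) v := by
    intro v _
    refine residue_congr ?_
    filter_upwards [eventually_regular hτ (zFull P.2.1) v] with w hw
    rw [logPartial_z hτ i hw.1 hw.2, logPartial_z hτ j hw.1 hw.2, logPartial_z hτ k hw.1 hw.2,
      logDeriv_superpotential hτ hw.1 hw.2]
    rfl
  rw [finsum_mem_congr rfl h1, sum_residue_logFormZeros hτ (Nat.succ_ne_zero l) hx0 hx
    (sum_zCoeff i) (sum_zCoeff j) (sum_zCoeff k)]
  simp only [residue_tripleForm hτ hx0 hx]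
  rw [← Finset.sum_neg_distrib, Finset.mul_sum, ← Finset.sum_add_distrib]
  refine Finset.sum_congr rfl fun m _ => ?_
  push_cast
  ring

/-! ### Third derivatives of `F_temp` -/

/-- Against an antisymmetric kernel only the antisymmetric part of the coefficients counts; the
kernel in view is ζ(zᵃ - zᵇ). -/
theorem sum_antisymm {n : ℕ} {T : Fin n → Fin n → ℂ} (hT : ∀ a b, T b a = -T a b)
    (X : Fin n → Fin n → ℂ) :
    ∑ a, ∑ b, X a b * T a b = 1 / 2 * ∑ a, ∑ b, (X a b - X b a) * T a b := by
  have h : ∑ a, ∑ b, X a b * T a b = -∑ a, ∑ b, X b a * T a b := by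
    rw [Finset.sum_comm, ← Finset.sum_neg_distrib]
    refine Finset.sum_congr rfl fun a _ => ?_
    rw [← Finset.sum_neg_distrib]
    refine Finset.sum_congr rfl fun b _ => ?_
    rw [hT]; ring
  simp only [sub_mul, Finset.sum_sub_distrib]
  linear_combination (1 / 2 : ℂ) * h

theorem partialD_comp {l : ℕ} (k : Fin l) (f : ℂ × ℂ → ℂ) {w : (Fin l → ℂ) → ℂ} {c : ℂ}
    (hw : ∀ z t, w (z + t • Pi.single k 1) = w z + t * c) :
    partialD (.z k) (fun P : Space l => f (w P.2.1, P.2.2)) =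
      fun P => c * dfst f (w P.2.1, P.2.2) := by
  ext P
  have h1 := deriv_comp_mul_const c (fun y => f (w P.2.1 + y, P.2.2)) 0
  have h2 := deriv_comp_const_add (fun y => f (y, P.2.2)) (w P.2.1) (0 * c)
  rw [h2, zero_mul, add_zero] at h1
  rw [partialD, lineDeriv, dfst]
  simp only [Coord.dir, Prod.fst_add, Prod.snd_add, Prod.smul_fst, Prod.smul_snd, smul_zero,
    add_zero, hw]
  exact h1

theorem partialD_const_mul {l : ℕ} (a : Coord l) (c : ℂ) (F : Space l → ℂ) :
    partialD a (fun P => c * F P) = fun P => c * partialD a F P := by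
  ext P
  exact deriv_const_mul_field c

theorem partialD3_comp {l : ℕ} (i j k : Fin l) (f : ℂ × ℂ → ℂ) {w : (Fin l → ℂ) → ℂ}
    {c : Fin l → ℂ} (hw : ∀ k z t, w (z + t • Pi.single k 1) = w z + t * c k) (P : Space l) :
    partialD3 (.z i) (.z j) (.z k) (fun P : Space l => f (w P.2.1, P.2.2)) P =
      c i * c j * c k * dfst (dfst (dfst f)) (w P.2.1, P.2.2) := by
  rw [partialD3, partialD_comp k f (hw k), partialD_const_mul, partialD_comp j (dfst f) (hw j),
    partialD_const_mul]
  simp only [partialD_const_mul]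
  rw [partialD_comp i _ (hw i)]
  ring

theorem partialD_congr {l : ℕ} (a : Coord l) {F G : Space l → ℂ} {P : Space l}
    (h : F =ᶠ[𝓝 P] G) : partialD a F =ᶠ[𝓝 P] partialD a G := by
  filter_upwards [h.eventually_nhds] with Q hQ
  exact Filter.EventuallyEq.lineDeriv_eq hQ

theorem partialD3_congr {l : ℕ} (a b c : Coord l) {F G : Space l → ℂ} {P : Space l}
    (h : F =ᶠ[𝓝 P] G) : partialD3 a b c F P = partialD3 a b c G P :=
  (partialD_congr a (partialD_congr b (partialD_congr c h))).self_of_nhds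

theorem AnalyticAt.partialD {l : ℕ} (a : Coord l) {F : Space l → ℂ} {P : Space l}
    (hF : AnalyticAt ℂ F P) : AnalyticAt ℂ (JacobiDual.partialD a F) P := by
  have h : AnalyticAt ℂ (fun y => fderiv ℂ F y a.dir) P :=
    ((ContinuousLinearMap.apply ℂ ℂ a.dir).analyticAt _).comp hF.fderiv
  refine h.congr ?_
  filter_upwards [hF.eventually_analyticAt] with y hy
  exact hy.differentiableAt.lineDeriv_eq_fderiv.symm

theorem partialD_add {l : ℕ} (a : Coord l) {F G : Space l → ℂ} {P : Space l}
    (hF : AnalyticAt ℂ F P) (hG : AnalyticAt ℂ G P) :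
    partialD a (fun Q => F Q + G Q) =ᶠ[𝓝 P] fun Q => partialD a F Q + partialD a G Q := by
  filter_upwards [hF.eventually_analyticAt, hG.eventually_analyticAt] with Q h1 h2
  simp only [partialD]
  rw [(h1.differentiableAt.fun_add h2.differentiableAt).lineDeriv_eq_fderiv,
    h1.differentiableAt.lineDeriv_eq_fderiv, h2.differentiableAt.lineDeriv_eq_fderiv,
    fderiv_fun_add h1.differentiableAt h2.differentiableAt]
  rfl

theorem partialD3_add {l : ℕ} (a b c : Coord l) {F G : Space l → ℂ} {P : Space l}
    (hF : AnalyticAt ℂ F P) (hG : AnalyticAt ℂ G P) :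
    partialD3 a b c (fun Q => F Q + G Q) P = partialD3 a b c F P + partialD3 a b c G P := by
  have h1 := partialD_congr b (partialD_add c hF hG)
  have h2 := partialD_add b (AnalyticAt.partialD c hF) (AnalyticAt.partialD c hG)
  have h3 := partialD_congr a (h1.trans h2)
  have h4 := partialD_add a (AnalyticAt.partialD b (AnalyticAt.partialD c hF))
    (AnalyticAt.partialD b (AnalyticAt.partialD c hG))
  exact (h3.trans h4).self_of_nhds

theorem partialD3_const_mul {l : ℕ} (a b c : Coord l) (r : ℂ) (F : Space l → ℂ) (P : Space l) :
    partialD3 a b c (fun Q => r * F Q) P = r * partialD3 a b c F P := by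
  simp only [partialD3, partialD_const_mul]

theorem partialD_zero {l : ℕ} (a : Coord l) : partialD a (fun _ : Space l => 0) = fun _ => 0 := by
  ext P; simp [partialD, lineDeriv]

theorem partialD3_zero {l : ℕ} (a b c : Coord l) (P : Space l) :
    partialD3 a b c (fun _ : Space l => 0) P = 0 := by
  simp only [partialD3, partialD_zero]

theorem partialD3_sum {l : ℕ} {ι : Type*} (a b c : Coord l) (s : Finset ι) {F : ι → Space l → ℂ}
    {P : Space l} (hF : ∀ i ∈ s, AnalyticAt ℂ (F i) P) :
    partialD3 a b c (fun Q => ∑ i ∈ s, F i Q) P = ∑ i ∈ s, partialD3 a b c (F i) P := by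
  classical
  induction s using Finset.induction_on with
  | empty => simpa using partialD3_zero a b c P
  | insert i s hi ih =>
    simp only [Finset.sum_insert hi]
    rw [partialD3_add a b c (hF i (Finset.mem_insert_self i s))
      (Finset.analyticAt_fun_sum _ fun j hj => hF j (Finset.mem_insert_of_mem hj)),
      ih fun j hj => hF j (Finset.mem_insert_of_mem hj)]

theorem analyticAt_zFull {l : ℕ} (i : Fin (l + 1)) (z : Fin l → ℂ) :
    AnalyticAt ℂ (fun z : Fin l → ℂ => zFull z i) z := by
  let L : (Fin l → ℂ) →ₗ[ℂ] ℂ :=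
    { toFun := fun z => zFull z i
      map_add' := fun z w => zFull_add z w i
      map_smul' := fun c z => zFull_smul c z i }
  exact L.toContinuousLinearMap.analyticAt z

theorem IsLambdaBranch.local {l : ℕ} {U : Set (Base l)} {w : (Fin l → ℂ) → ℂ} {h : Base l → ℂ}
    (hh : IsLambdaBranch 3 U w h) {p : Base l} (hp : p ∈ U) (hw : AnalyticAt ℂ w p.1)
    {c : Fin l → ℂ} (hc : ∀ k z t, w (z + t • Pi.single k 1) = w z + t * c k)
    (hreg : w p.1 ∉ periodLattice p.2) (u : ℂ) :
    AnalyticAt ℂ h p ∧ AnalyticAt ℂ (fun P : Space l => h P.2) (u, p) ∧ ∀ i j k : Fin l,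
      partialD3 (.z i) (.z j) (.z k) (fun P : Space l => h P.2) (u, p) =
        -4 * (c i * c j * c k) * thetaZeta (w p.1) p.2 := by
  obtain ⟨f, hf, hhf⟩ := hh p hp
  obtain ⟨-, hfa, -⟩ := hf.thetaRelation_eq
  have hpair : AnalyticAt ℂ (fun p' : Base l => (w p'.1, p'.2)) p :=
    (hw.comp_of_eq (f := Prod.fst) analyticAt_fst rfl).prod analyticAt_snd
  have hha : AnalyticAt ℂ h p := (hfa.comp_of_eq hpair rfl).congr hhf.symm
  have hev : (fun P : Space l => h P.2) =ᶠ[𝓝 (u, p)] fun P => f (w P.2.1, P.2.2) :=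
    (continuous_snd.tendsto (u, p)).eventually hhf
  refine ⟨hha, hha.comp_of_eq (f := Prod.snd) analyticAt_snd rfl, fun i j k => ?_⟩
  rw [partialD3_congr _ _ _ hev, partialD3_comp i j k f hc, hf.dfst_dfst_dfst hreg]
  ring

theorem IsTempBranch.local {l : ℕ} {U : Set (Base l)} (hU : IsOpen U) (hreg : U ⊆ regularBase l)
    {Ft : Base l → ℂ} (hFt : IsTempBranch U Ft) {p : Base l} (hp : p ∈ U) :
    AnalyticAt ℂ Ft p ∧ ∀ (u : ℂ) (i j k : Fin l),
      partialD3 (.z i) (.z j) (.z k) (fun P : Space l => Ft P.2) (u, p) =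
        dualStructure (u, p) (.z i) (.z j) (.z k) := by
  obtain ⟨L, M, hL, hM, hF⟩ := hFt
  obtain ⟨hτ, hx0, hx⟩ := hreg hp
  have hcM : ∀ (a : Fin (l + 1)) (k : Fin l) (z : Fin l → ℂ) (t : ℂ),
      zFull (z + t • Pi.single k 1) a = zFull z a + t * zCoeff k a := fun a k z t => by
    rw [zFull_add, zFull_smul, zCoeff]
  have lM := fun a u => (hM a).local hp (analyticAt_zFull a p.1) (hcM a) (hx0 a) u
  have lL := fun a b (hab : a ≠ b) u => (hL a b hab).local hp
    ((analyticAt_zFull a p.1).sub (analyticAt_zFull b p.1))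
    (c := fun k => zCoeff k a - zCoeff k b) (fun k z t => by rw [hcM, hcM]; ring) (hx a b hab) u
  have hFev : Ft =ᶠ[𝓝 p] fun p => (1 / 8 * ∑ i, ∑ j, if i ≠ j then L i j p else 0) +
      (-((l : ℂ) + 1) / 4) * ∑ i, M i p := by
    filter_upwards [hU.mem_nhds hp] with p' hp'
    rw [hF p' hp']; ring
  have hLa : ∀ a b, AnalyticAt ℂ (fun p => if a ≠ b then L a b p else 0) p := fun a b => by
    by_cases hab : a ≠ b
    · simpa only [if_pos hab] using (lL a b hab 0).1
    · simpa only [if_neg hab] using analyticAt_const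
  have hFa : AnalyticAt ℂ Ft p := by
    refine AnalyticAt.congr ?_ hFev.symm
    exact (analyticAt_const.mul (Finset.analyticAt_fun_sum _ fun a _ =>
      Finset.analyticAt_fun_sum _ fun b _ => hLa a b)).add
      (analyticAt_const.mul (Finset.analyticAt_fun_sum _ fun a _ => (lM a 0).1))
  refine ⟨hFa, fun u i j k => ?_⟩
  have hsnd : ∀ {g : Base l → ℂ}, AnalyticAt ℂ g p →
      AnalyticAt ℂ (fun P : Space l => g P.2) (u, p) := fun hg =>
    hg.comp_of_eq (f := Prod.snd) analyticAt_snd rfl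
  have hev : (fun P : Space l => Ft P.2) =ᶠ[𝓝 (u, p)] fun P =>
      (1 / 8 * ∑ i, ∑ j, if i ≠ j then L i j P.2 else 0) +
      (-((l : ℂ) + 1) / 4) * ∑ i, M i P.2 :=
    (continuous_snd.tendsto (u, p)).eventually hFev
  have hLL : ∀ a b, partialD3 (.z i) (.z j) (.z k)
      (fun P : Space l => if a ≠ b then L a b P.2 else 0) (u, p) =
      -4 * ((zCoeff i a - zCoeff i b) * (zCoeff j a - zCoeff j b) * (zCoeff k a - zCoeff k b)) *
        thetaZeta (zFull p.1 a - zFull p.1 b) p.2 := fun a b => by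
    by_cases hab : a ≠ b
    · simp only [if_pos hab]
      exact (lL a b hab u).2.2 i j k
    · simp only [if_neg hab, partialD3_zero]
      rw [not_not.1 hab]; simp
  rw [partialD3_congr _ _ _ hev, partialD3_add, partialD3_const_mul, partialD3_const_mul,
    partialD3_sum, partialD3_sum, dualStructure_z (P := (u, p)) ⟨hτ, hx0, hx⟩]
  · have h1 : ∀ a, partialD3 (.z i) (.z j) (.z k)
        (fun P : Space l => ∑ b, if a ≠ b then L a b P.2 else 0) (u, p) =
        ∑ b, -4 * ((zCoeff i a - zCoeff i b) * (zCoeff j a - zCoeff j b) *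
          (zCoeff k a - zCoeff k b)) * thetaZeta (zFull p.1 a - zFull p.1 b) p.2 := fun a => by
      rw [partialD3_sum _ _ _ _ fun b _ => hsnd (hLa a b)]
      simp only [hLL]
    simp only [h1, (lM _ u).2.2 i j k]
    -- Here X(a,b) - X(b,a) is minus the product of the three differences δ(a) - δ(b). The resulting
    -- factor -½ equals 1/8 · (-4), and for the single sums -(l+1)/4 · (-4) = l + 1.
    have h2 := sum_antisymm (T := fun a b => thetaZeta (zFull p.1 a - zFull p.1 b) p.2)
      (fun a b => by rw [← thetaZeta_neg, neg_sub]) fun m b =>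
        zCoeff i b * zCoeff j m * zCoeff k m + zCoeff i m * zCoeff j b * zCoeff k m +
        zCoeff i m * zCoeff j m * zCoeff k b - zCoeff i m * zCoeff j m * zCoeff k m
    rw [h2]
    simp only [Finset.mul_sum]
    congr 1
    · refine Finset.sum_congr rfl fun a _ => Finset.sum_congr rfl fun b _ => ?_
      ring
    · refine Finset.sum_congr rfl fun a _ => ?_
      ring
  · exact fun a _ => (lM a u).2.1
  · exact fun a _ => hsnd (Finset.analyticAt_fun_sum _ fun b _ => hLa a b)
  · exact analyticAt_const.mul (Finset.analyticAt_fun_sum _ fun a _ =>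
      hsnd (Finset.analyticAt_fun_sum _ fun b _ => hLa a b))
  · exact analyticAt_const.mul (Finset.analyticAt_fun_sum _ fun a _ => (lM a u).2.1)

end JacobiDual
end

noncomputable section
namespace JacobiDual
open Set

/-! ### Functions with vanishing third derivatives -/

theorem clm_ext_single {l : ℕ} {A B : (Fin l → ℂ) →L[ℂ] ℂ}
    (h : ∀ k, A (Pi.single k 1) = B (Pi.single k 1)) : A = B :=
  ContinuousLinearMap.coe_injective (LinearMap.pi_ext' fun k => LinearMap.ext_ring (h k))

/-- The partial derivative `∂g/∂zᵏ` at fixed `τ`. -/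
def partialZ {l : ℕ} (k : Fin l) (g : (Fin l → ℂ) → ℂ) (z : Fin l → ℂ) : ℂ :=
  lineDeriv ℂ g z (Pi.single k 1)

theorem partialZ_eventuallyEq {l : ℕ} (k : Fin l) {g : (Fin l → ℂ) → ℂ} {z : Fin l → ℂ}
    (hg : AnalyticAt ℂ g z) : partialZ k g =ᶠ[𝓝 z] fun y => fderiv ℂ g y (Pi.single k 1) := by
  filter_upwards [hg.eventually_analyticAt] with y hy
  exact hy.differentiableAt.lineDeriv_eq_fderiv

theorem AnalyticAt.partialZ {l : ℕ} (k : Fin l) {g : (Fin l → ℂ) → ℂ} {z : Fin l → ℂ}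
    (hg : AnalyticAt ℂ g z) : AnalyticAt ℂ (JacobiDual.partialZ k g) z :=
  (((ContinuousLinearMap.apply ℂ ℂ (Pi.single k 1 : Fin l → ℂ)).analyticAt _).comp hg.fderiv).congr
    (partialZ_eventuallyEq k hg).symm

theorem partialZ_eq_fderiv {l : ℕ} (k : Fin l) {g : (Fin l → ℂ) → ℂ} {z : Fin l → ℂ}
    (hg : AnalyticAt ℂ g z) : partialZ k g z = fderiv ℂ g z (Pi.single k 1) :=
  hg.differentiableAt.lineDeriv_eq_fderiv

theorem partialZ_symm {l : ℕ} (j k : Fin l) {g : (Fin l → ℂ) → ℂ} {z : Fin l → ℂ}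
    (hg : AnalyticAt ℂ g z) : partialZ j (partialZ k g) z = partialZ k (partialZ j g) z := by
  have key : ∀ j k : Fin l, partialZ j (partialZ k g) z =
      fderiv ℂ (fderiv ℂ g) z (Pi.single j 1) (Pi.single k 1) := fun j k => by
    rw [partialZ_eq_fderiv j (AnalyticAt.partialZ k hg), (partialZ_eventuallyEq k hg).fderiv_eq,
      fderiv_clm_apply hg.fderiv.differentiableAt (differentiableAt_const _)]
    simp
  rw [key, key]
  exact hg.contDiffAt.isSymmSndFDerivAt_of_omega _ _

theorem fderiv_quadratic {l : ℕ} {a : Fin l → Fin l → ℂ} (ha : ∀ i j, a i j = a j i)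
    (b : Fin l → ℂ) (z : Fin l → ℂ) (k : Fin l) :
    Differentiable ℂ (fun z : Fin l → ℂ => 1 / 2 * (∑ i, ∑ j, a i j * z i * z j) + ∑ i, b i * z i) ∧
    fderiv ℂ (fun z : Fin l → ℂ => 1 / 2 * (∑ i, ∑ j, a i j * z i * z j) + ∑ i, b i * z i) z
      (Pi.single k 1) = ∑ j, a j k * z j + b k := by
  have hp : ∀ i, HasFDerivAt (fun z : Fin l → ℂ => z i)
      (ContinuousLinearMap.proj (R := ℂ) (φ := fun _ : Fin l => ℂ) i) z := fun i => hasFDerivAt_apply i z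
  have h1 := (((HasFDerivAt.fun_sum fun i (_ : i ∈ Finset.univ) =>
    HasFDerivAt.fun_sum fun j (_ : j ∈ Finset.univ) =>
      ((hp i).const_mul (a i j)).fun_mul (hp j)).const_mul (1 / 2 : ℂ)).fun_add
    (HasFDerivAt.fun_sum fun i (_ : i ∈ Finset.univ) => (hp i).const_mul (b i)))
  refine ⟨by fun_prop, ?_⟩
  rw [h1.fderiv]
  simp only [add_apply, smul_apply, sum_apply,
    ContinuousLinearMap.proj_apply, smul_eq_mul, Pi.single_apply, mul_ite, mul_one, mul_zero,
    Finset.sum_add_distrib, Finset.sum_ite_eq', Finset.mem_univ, if_true]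
  have h2 : ∑ i, ∑ j, z j * (if i = k then a i j else 0) = ∑ j, a j k * z j := by
    rw [Finset.sum_comm]
    refine Finset.sum_congr rfl fun j _ => ?_
    simp [mul_comm, ha j k]
  simp only [mul_ite, mul_zero] at h2
  rw [h2]
  ring

/-- Three integrations on a connected open set: the second derivatives are constant, so the first
are affine and the function is quadratic. -/
theorem exists_quadratic {l : ℕ} {V : Set (Fin l → ℂ)} (hV : IsOpen V) (hVc : IsPreconnected V)
    {φ : (Fin l → ℂ) → ℂ} (hφ : AnalyticOnNhd ℂ φ V)
    (h : ∀ z ∈ V, ∀ i j k, partialZ i (partialZ j (partialZ k φ)) z = 0) :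
    ∃ (a : Fin l → Fin l → ℂ) (b : Fin l → ℂ) (c : ℂ), ∀ z ∈ V,
      φ z = 1 / 2 * (∑ i, ∑ j, a i j * z i * z j) + ∑ i, b i * z i + c := by
  rcases V.eq_empty_or_nonempty with rfl | ⟨z₀, hz₀⟩
  · exact ⟨0, 0, 0, fun z hz => hz.elim⟩
  have h2 : ∀ j k, ∃ c, ∀ z ∈ V, partialZ j (partialZ k φ) z = c := fun j k => by
    refine hV.exists_is_const_of_fderiv_eq_zero hVc (fun z hz =>
      (AnalyticAt.partialZ j (AnalyticAt.partialZ k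
        (hφ z hz))).differentiableAt.differentiableWithinAt) fun z hz => ?_
    refine clm_ext_single fun i => ?_
    rw [← partialZ_eq_fderiv i (AnalyticAt.partialZ j (AnalyticAt.partialZ k (hφ z hz))), h z hz]
    rfl
  choose a ha using h2
  -- Symmetry of mixed derivatives is needed for the quadratic form with the factor 1/2 to have the
  -- right gradient.
  have hsymm : ∀ i j, a i j = a j i := fun i j => by
    rw [← ha i j z₀ hz₀, ← ha j i z₀ hz₀, partialZ_symm i j (hφ z₀ hz₀)]
  have h1 : ∀ k, ∃ c, V.EqOn (partialZ k φ) (fun z => (∑ j, a j k * z j) + c) := fun k => by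
    refine hV.exists_eq_add_of_fderiv_eq hVc (fun z hz =>
      (AnalyticAt.partialZ k (hφ z hz)).differentiableAt.differentiableWithinAt)
      (by fun_prop) fun z hz => ?_
    refine clm_ext_single fun j => ?_
    rw [← partialZ_eq_fderiv j (AnalyticAt.partialZ k (hφ z hz)), ha j k z hz]
    have hp := HasFDerivAt.fun_sum fun i (_ : i ∈ Finset.univ) =>
      (hasFDerivAt_apply (𝕜 := ℂ) (F' := fun _ : Fin l => ℂ) i z).const_mul (a i k)
    rw [hp.fderiv]
    simp [Pi.single_apply]
  choose b hb using h1
  obtain ⟨c, hc⟩ := hV.exists_eq_add_of_fderiv_eq hVc (f := φ)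
    (g := fun z : Fin l → ℂ => 1 / 2 * (∑ i, ∑ j, a i j * z i * z j) + ∑ i, b i * z i)
    hφ.differentiableOn (by fun_prop) fun z hz => clm_ext_single fun k => by
      rw [(fderiv_quadratic hsymm b z k).2,
        ← partialZ_eq_fderiv k (hφ z hz), hb k hz]
  exact ⟨a, b, c, fun z hz => hc hz⟩

theorem partialD_slice {l : ℕ} (k : Fin l) (F : Space l → ℂ) (u τ : ℂ) :
    (fun z => partialD (.z k) F (u, (z, τ))) = partialZ k fun z => F (u, (z, τ)) := by
  ext z
  simp [partialD, partialZ, lineDeriv, Coord.dir]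

theorem partialD3_slice {l : ℕ} (i j k : Fin l) (F : Space l → ℂ) (u τ : ℂ) (z : Fin l → ℂ) :
    partialD3 (.z i) (.z j) (.z k) F (u, (z, τ)) =
      partialZ i (partialZ j (partialZ k fun z => F (u, (z, τ)))) z := by
  rw [← partialD_slice k, ← partialD_slice j, ← partialD_slice i]
  rfl

theorem exists_quadratic_difference {l : ℕ} {U : Set (Base l)} (hU : IsOpen U)
    (hreg : U ⊆ regularBase l) {Ft Fq : Base l → ℂ} (hFt : IsTempBranch U Ft)
    (hFq : IsQuantumPart U Fq) {τ : ℂ} (hconn : IsPreconnected {z : Fin l → ℂ | (z, τ) ∈ U}) :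
    ∃ (a : Fin l → Fin l → ℂ) (b : Fin l → ℂ) (c : ℂ), ∀ z, (z, τ) ∈ U →
      Fq (z, τ) = Ft (z, τ) + 1 / 2 * (∑ i, ∑ j, a i j * z i * z j) + ∑ i, b i * z i + c := by
  obtain ⟨hA, hD⟩ := hFq
  -- The difference is restricted to u = 0, where the explicit part vanishes identically; its third
  -- z-derivatives cancel because both terms give the dual structure functions.
  obtain ⟨F, hF⟩ : ∃ F : Space l → ℂ, F = fun P => (classicalPart P + Fq P.2) + -1 * Ft P.2 :=
    ⟨_, rfl⟩
  have hTa : ∀ {z}, (z, τ) ∈ U → AnalyticAt ℂ (fun P : Space l => Ft P.2) (0, (z, τ)) := fun hz =>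
    (hFt.local hU hreg hz).1.comp_of_eq (f := Prod.snd) analyticAt_snd rfl
  have hFa : ∀ {z}, (z, τ) ∈ U → AnalyticAt ℂ F (0, (z, τ)) := fun {z} hz => by
    rw [hF]
    exact (hA (0, (z, τ)) hz).add (analyticAt_const.mul (hTa hz))
  have hslice : ∀ z, F (0, (z, τ)) = Fq (z, τ) - Ft (z, τ) := fun z => by
    simp [hF, classicalPart, sub_eq_add_neg]
  have hφ : AnalyticOnNhd ℂ (fun z => F (0, (z, τ))) {z : Fin l → ℂ | (z, τ) ∈ U} := fun z hz =>
    (hFa hz).comp_of_eq (f := fun z => ((0 : ℂ), (z, τ)))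
      (analyticAt_const.prod (analyticAt_id.prod analyticAt_const)) rfl
  obtain ⟨a, b, c, h⟩ := exists_quadratic (hU.preimage (by fun_prop)) hconn hφ fun z hz i j k => by
    have hT' : AnalyticAt ℂ (fun P : Space l => -1 * Ft P.2) (0, (z, τ)) :=
      analyticAt_const.mul (hTa hz)
    rw [← partialD3_slice, hF, partialD3_add _ _ _ (hA (0, (z, τ)) hz) hT', partialD3_const_mul, hD (0, (z, τ)) hz,
      (hFt.local hU hreg hz).2]
    ring
  refine ⟨a, b, c, fun z hz => ?_⟩
  have := h z hz
  rw [hslice] at this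
  linear_combination this

end JacobiDual
end

/-! ### The proposition -/

theorem mainTheorem3 (l : ℕ) :
    (∀ p ∈ JacobiDual.regularBase l, ∃ (U : Set (JacobiDual.Base l)) (Ft : JacobiDual.Base l → ℂ),
      IsOpen U ∧ p ∈ U ∧ JacobiDual.IsTempBranch U Ft) ∧
    ∀ (U : Set (JacobiDual.Base l)), IsOpen U → U ⊆ JacobiDual.regularBase l →
      ∀ (Ft : JacobiDual.Base l → ℂ), JacobiDual.IsTempBranch U Ft →
        (∀ (u : ℂ), ∀ p ∈ U, ∀ i j k : Fin l,
          JacobiDual.dualStructure (u, p) (.z i) (.z j) (.z k) =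
            JacobiDual.partialD3 (.z i) (.z j) (.z k)
              (fun P : JacobiDual.Space l => Ft P.2) (u, p)) ∧
        ((∀ τ : ℂ, IsPreconnected {z : Fin l → ℂ | (z, τ) ∈ U}) →
          ∀ Fq : JacobiDual.Base l → ℂ, JacobiDual.IsQuantumPart U Fq →
            ∃ (A : Fin (l + 1) → Fin (l + 1) → ℂ → ℂ) (B : Fin (l + 1) → ℂ → ℂ) (C : ℂ → ℂ),
              ∀ (z : Fin l → ℂ) (τ : ℂ), (z, τ) ∈ U →
                Fq (z, τ) = Ft (z, τ) +
                  1 / 2 * (∑ i, ∑ j, A i j τ * JacobiDual.zFull z i * JacobiDual.zFull z j) +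
                  (∑ i, B i τ * JacobiDual.zFull z i) + C τ) := by
  refine ⟨fun p hp => JacobiDual.exists_tempBranch hp, fun U hU hreg Ft hFt =>
    ⟨fun u p hp i j k => ((hFt.local hU hreg hp).2 u i j k).symm, fun hconn Fq hFq => ?_⟩⟩
  choose a b c h using fun τ =>
    JacobiDual.exists_quadratic_difference hU hreg hFt hFq (hconn τ)
  -- Since z⁰ depends on the other coordinates, every coefficient with an index 0 may be taken to be
  -- 0.
  refine ⟨fun i j τ => Fin.cases 0 (fun i' => Fin.cases 0 (fun j' => a τ i' j') j) i,
    fun i τ => Fin.cases 0 (fun i' => b τ i') i, c, fun z τ hz => ?_⟩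
  rw [h τ z hz]
  simp [Fin.sum_univ_succ, JacobiDual.zFull]
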